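/- **Setting.** Let $k\ge 2$ and $m\in\mathbb N$. For $p\in[m]=\{1,\dots,m\}$ let $F_p^c$ be a probability distribution on a subset $\Xi_p$ of a Euclidean space that has a density with respect to Lebesgue measure; write $\mathbf F^c=(F_1^c,\dots,F_m^c)$. For $i\in[k]$ and $p\in[m]$ let $T_{ip}\ge 1$ be an integer and let $h_i:\Xi_1^{T_{i1}}\times\dots\times\Xi_m^{T_{im}}\to\mathbb R$ be measurable. For an input model $\mathbf F=(F_1,\dots,F_m)$ let $\mathrm E_{\mathbf F}$ be the expectation under which all inputs $Z^i_p(t)$, $t\in[T_{ip}]$, $p\in[m]$, are independent with $Z^i_p(t)\sim F_p$; put $\mathbf Z^i_p=(Z^i_p(t))_{t\in[T_{ip}]}$ and $\eta_i(\mathbf F)=\mathrm E_{\mathbf F}[h_i(\mathbf Z^i_1,\dots,\mathbf Z^i_m)]$. A replication of solution $i$ under $\mathbf F$ is an evaluation of $h_i$ at such inputs. Let $$\mathrm{IF}_{ip}(x;\mathbf F)=\lim_{\epsilon\to0^+}\epsilon^{-1}\big(\eta_i(F_1,\dots,F_p+\epsilon(\delta_x-F_p),\dots,F_m)-\eta_i(\mathbf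 F)\big)$$ be the influence functions. Assume that $i^c=\arg\max_{i}\eta_i(\mathbf F^c)$ is unique. Let $\alpha\in(0,1)$, and let $\chi^2_{k-1,1-\alpha}$ be the $(1-\alpha)$-quantile of the chi-square distribution with $k-1$ degrees of freedom. **Data and ambiguity set.** For each $p$ there are $n_p\ge1$ i.i.d. observations $X_{p1},\dots,X_{pn_p}\sim F_p^c$, independent across $p$; let $n=m^{-1}\sum_p n_p$. Let $$\mathcal U_\alpha=\Big\{\mathbf w=(w_{pj}):\ w_{pj}\ge 0,\ \sum_{j=1}^{n_p}w_{pj}=1\ \text{for all } p,\ -2\sum_{p=1}^m\sum_{j=1}^{n_p}\log(n_pw_{pj})\le\chi^2_{k-1,1-\alpha}\Big\}$$ (with $\log 0=-\infty$). Weights $\mathbf w$ are identified with the input model $\big(\sum_j w_{pj}\delta_{X_{pj}}\big)_{p}$, and $\widehat{\mathbf F}$ is the empirical input model, with weights $w_{pj}=1/n_p$. **NIOU-C algorithm** (with simulation sample sizes $R_1,R_2$). 1. For each $i$, given the data, generate the inputs $\mathbf Z^{ir}=(\mathbf Z^{ir}_1,\dots,\mathbf Z^{ir}_m)$, $r\in[R_1]$,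 of $R_1$ i.i.d. replications of solution $i$ under $\widehat{\mathbf F}$. With $\overline h_i=R_1^{-1}\sum_r h_i(\mathbf Z^{ir})$ compute $$\widehat{\mathrm{IF}}_{ip}(X_{pj})=R_1^{-1}\sum_{r=1}^{R_1}\big(h_i(\mathbf Z^{ir})-\overline h_i\big)\Big(n_p\sum_{t=1}^{T_{ip}}\mathbf 1\{Z^{ir}_p(t)=X_{pj}\}-T_{ip}\Big).$$ 2. For each ordered pair $i\ne\ell$ let $\widehat{\mathbf w}^*_{i\ell}$ be a maximizer of $\sum_p\sum_j\big(\widehat{\mathrm{IF}}_{ip}(X_{pj})-\widehat{\mathrm{IF}}_{\ell p}(X_{pj})\big)w_{pj}$ over $\mathbf w\in\mathcal U_\alpha$. Given the data, the first-stage inputs and all these maximizers, run $R_2$ i.i.d. replications of each of the solutions $i$ and $\ell$ under the input model $\widehat{\mathbf w}^*_{i\ell}$, with outputs $Y_{ir}(\widehat{\mathbf w}^*_{i\ell})$ and $Y_{\ell r}(\widehat{\mathbf w}^*_{i\ell})$, and put $\widehat U_{i\ell,n}=R_2^{-1}\sum_{r=1}^{R_2}\big(Y_{ir}(\widehat{\mathbf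 w}^*_{i\ell})-Y_{\ell r}(\widehat{\mathbf w}^*_{i\ell})\big)$. 3. Let $\widehat D^+_{i,n}=\max\{0,\min_{\ell\ne i}\widehat U_{i\ell,n}\}$ and $\widehat I_n=\{i\in[k]:\widehat D^+_{i,n}>0\}$. Let $\widehat D^-_{i,n}=0$ if $\widehat I_n=\{i\}$, and $\widehat D^-_{i,n}=-\max\{0,-\min_{\ell\in\widehat I_n,\,\ell\ne i}(-\widehat U_{\ell i,n})\}$ otherwise (an empty minimum being $+\infty$). The dependence of the replications across different solutions and pairs is arbitrary (common random numbers are allowed). **Assumptions.** 1. $\mathrm E_{\mathbf F^c}\big[|h_i(\mathbf Z^i_1,\dots,\mathbf Z^i_m)|^2\big]<\infty$ for every $i\in[k]$. 2. For every $p\in[m]$ there is $\beta_p>0$ with $n_p/n\to\beta_p$ as $n\to\infty$. 3. For every $p\in[m]$ the covariance matrix of $(\mathrm{IF}_{ip}(X_p;\mathbf F^c))_{i\in[k]}$, where $X_p\sim F_p^c$, is positive definite. 4. For every $i\in[k]$, the random quantity $\sup_{\mathbf w\in\mathcal U_\alpha}\mathrm E_{\mathbf w}[|h_i(\mathbf Z^i_1,\dots,\mathbf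 Z^i_m)|^4]$ is bounded in probability as $n\to\infty$; and for all index sequences $I^p\in[T_{ip}]^{T_{ip}}$, $p\in[m]$, with $\mathbf Z^i_{p,I^p}=(Z^i_p(I^p_1),\dots,Z^i_p(I^p_{T_{ip}}))$, one has $\mathrm E_{\mathbf F^c}[|h_i(\mathbf Z^i_{1,I^1},\dots,\mathbf Z^i_{m,I^m})|^4]<\infty$. **Theorem.** Under these assumptions, along every sequence of data sizes $(n_1,\dots,n_m)$ and simulation sample sizes $(R_1,R_2)$ with $n\to\infty$, $R_1/n\to\infty$ and $R_2/n\to\infty$, $$\liminf\ \Pr\Big\{\eta_i(\mathbf F^c)-\max_{\ell\ne i}\eta_\ell(\mathbf F^c)\in[\widehat D^-_{i,n},\widehat D^+_{i,n}]\ \text{ for all } i\in[k]\Big\}\ \ge\ 1-\alpha \qquad\text{and}\qquad \liminf\ \Pr\{i^c\in\widehat I_n\}\ \ge\ 1-\alpha .$$ -/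

import Mathlib

open MeasureTheory ProbabilityTheory Filter Topology
open scoped ENNReal NNReal

noncomputable section

namespace NIOUC

/-- Input arrays of one simulation replication (or of one data set): `T p` points of the `p`-th
input space for every source `p`. -/
abbrev Inputs {m : ℕ} (S : Fin m → Type*) (T : Fin m → ℕ) : Type _ := ∀ p, Fin (T p) → S p

section InputModels

variable {m : ℕ} {S : Fin m → Type*} [∀ p, MeasurableSpace (S p)] {T : Fin m → ℕ}

/-- The joint law of independent inputs, of which the `T p` inputs from source `p` are i.i.d.
with law `F p`. -/
def inputLaw (F : ∀ p, Measure (S p)) (T : Fin m → ℕ) : Measure (Inputs S T) :=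
  Measure.pi fun p => Measure.pi fun _ : Fin (T p) => F p

/-- The performance measure `η(F) = E[h(Z₁, …, Z_m)]` of the output function `h` under `F`. -/
def perf (h : Inputs S T → ℝ) (F : ∀ p, Measure (S p)) : ℝ :=
  ∫ z, h z ∂(inputLaw F T)

/-- The input model `F` with its `p`-th component replaced by `F_p + ε (δ_x - F_p)`. -/
def contaminate (F : ∀ p, Measure (S p)) (p : Fin m) (x : S p) (ε : ℝ) : ∀ p, Measure (S p) :=
  Function.update F p (ENNReal.ofReal (1 - ε) • F p + ENNReal.ofReal ε • Measure.dirac x)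

/-- The influence function `IF_p(x; F)` of the performance measure of `h`: the one-sided
derivative at `ε = 0` of `η` along `F_p + ε (δ_x - F_p)`. -/
def influence (h : Inputs S T → ℝ) (F : ∀ p, Measure (S p)) (p : Fin m) (x : S p) : ℝ :=
  limUnder (𝓝[>] (0 : ℝ)) fun ε => (perf h (contaminate F p x ε) - perf h F) / ε

/-- The variance-covariance matrix of `(IF_{ip}(X_p; F))_i`, where `X_p ∼ F_p`. -/
def influenceCov {k : ℕ} {T : Fin k → Fin m → ℕ} (h : ∀ i, Inputs S (T i) → ℝ)
    (F : ∀ p, Measure (S p)) (p : Fin m) : Matrix (Fin k) (Fin k) ℝ :=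
  Matrix.of fun i j => covariance (influence (h i) F p) (influence (h j) F p) (F p)

/-- The reweighted empirical distributions `∑ⱼ w_{pj} δ_{x_{pj}}` of the data `x`. -/
def weightedEmpirical {N : Fin m → ℕ} (x : Inputs S N) (w : ∀ p, Fin (N p) → ℝ) (p : Fin m) :
    Measure (S p) :=
  ∑ j, ENNReal.ofReal (w p j) • Measure.dirac (x p j)

/-- The empirical distributions of the data `x`: all weights of source `p` are `1 / N p`. -/
def empirical {N : Fin m → ℕ} (x : Inputs S N) : ∀ p, Measure (S p) :=
  weightedEmpirical x fun p _ => (N p : ℝ)⁻¹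

end InputModels

/-- The chi-square distribution with `q` degrees of freedom: the law of `∑ Zᵢ²` for
`Z₁, …, Z_q` i.i.d. standard normal. -/
def chiSquared (q : ℕ) : Measure ℝ :=
  (Measure.pi fun _ : Fin q => gaussianReal 0 1).map fun z => ∑ i, z i ^ 2

/-- The `β`-quantile of the chi-square distribution with `q` degrees of freedom. -/
def chiSquaredQuantile (q : ℕ) (β : ℝ) : ℝ :=
  sInf {x : ℝ | β ≤ (chiSquared q).real (Set.Iic x)}

/-- The empirical likelihood ambiguity set of weights at level `c`. The weights have to be
positive, since `log 0 = -∞` in the definition of the likelihood ratio. -/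
def ambiguitySet {m : ℕ} (N : Fin m → ℕ) (c : ℝ) : Set (∀ p, Fin (N p) → ℝ) :=
  {w | (∀ p j, 0 < w p j) ∧ (∀ p, ∑ j, w p j = 1) ∧
    -2 * ∑ p, ∑ j, Real.log (N p * w p j) ≤ c}

section Algorithm

variable {k m : ℕ} {S : Fin m → Type*} [∀ p, MeasurableSpace (S p)] {N : Fin m → ℕ}

open Classical in
/-- The estimator of the influence function at the data point `x_{pj}` from the replications
`z₁, …, z_R`: the sample covariance of the outputs `h z_r` and of
`N_p ∑ₜ 1{z_r(p, t) = x_{pj}} - T_p`. -/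
def influenceEst {T : Fin m → ℕ} {R : ℕ} (h : Inputs S T → ℝ) (x : Inputs S N)
    (z : Fin R → Inputs S T) (p : Fin m) (j : Fin (N p)) : ℝ :=
  (R : ℝ)⁻¹ * ∑ r, (h (z r) - (R : ℝ)⁻¹ * ∑ s, h (z s)) *
    (N p * (∑ t, if z r p t = x p j then (1 : ℝ) else 0) - T p)

/-- Conditionally on the σ-algebra `𝒢`, the replications `Z ω 1, …, Z ω R` are i.i.d. input
arrays, generated from the (random) input model `Q ω`. -/
def IsCondReplication {Ω : Type*} [MeasurableSpace Ω] (P : Measure Ω) (𝒢 : MeasurableSpace Ω)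
    (Q : Ω → ∀ p, Measure (S p)) {T : Fin m → ℕ} {R : ℕ} (Z : Ω → Fin R → Inputs S T) : Prop :=
  ∀ A : Set Ω, MeasurableSet[𝒢] A → ∀ B : Set (Fin R → Inputs S T), MeasurableSet B →
    P (A ∩ Z ⁻¹' B) = ∫⁻ ω in A, (Measure.pi fun _ : Fin R => inputLaw (Q ω) T) B ∂P

/-- The random quantities of one run of the NIOU-C algorithm with data sizes `N`, `R₁`
first-stage and `R₂` second-stage replications. -/
structure Run (S : Fin m → Type*) (T : Fin k → Fin m → ℕ) (N : Fin m → ℕ) (R₁ R₂ : ℕ)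
    (Ω : Type*) where
  /-- the input data `X_{pj}` -/
  data : Ω → Inputs S N
  /-- the inputs of the `R₁` replications of solution `i` under the empirical distributions -/
  sim₁ : ∀ i : Fin k, Ω → Fin R₁ → Inputs S (T i)
  /-- the weights `ŵ*_{iℓ}` -/
  weights : Fin k → Fin k → Ω → ∀ p, Fin (N p) → ℝ
  /-- for the pair `(i, ℓ)`, the inputs of the `R₂` replications of solution `i` -/
  sim₂ : ∀ i : Fin k, Fin k → Ω → Fin R₂ → Inputs S (T i)
  /-- for the pair `(i, ℓ)`, the inputs of the `R₂` replications of solution `ℓ` -/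
  sim₂' : Fin k → ∀ ℓ : Fin k, Ω → Fin R₂ → Inputs S (T ℓ)

namespace Run

variable {T : Fin k → Fin m → ℕ} {R₁ R₂ : ℕ} {Ω : Type*}

/-- The objective `w ↦ ∑_p ∑_j (ÎF_{ip}(X_{pj}) - ÎF_{ℓp}(X_{pj})) w_{pj}`. -/
def objective (ρ : Run S T N R₁ R₂ Ω) (h : ∀ i, Inputs S (T i) → ℝ) (i ℓ : Fin k) (ω : Ω)
    (w : ∀ p, Fin (N p) → ℝ) : ℝ :=
  ∑ p, ∑ j, (influenceEst (h i) (ρ.data ω) (ρ.sim₁ i ω) p j -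
    influenceEst (h ℓ) (ρ.data ω) (ρ.sim₁ ℓ ω) p j) * w p j

/-- The estimated bound `Û_{iℓ}`. -/
def bound (ρ : Run S T N R₁ R₂ Ω) (h : ∀ i, Inputs S (T i) → ℝ) (ω : Ω) (i ℓ : Fin k) : ℝ :=
  (R₂ : ℝ)⁻¹ * ∑ r, (h i (ρ.sim₂ i ℓ ω r) - h ℓ (ρ.sim₂' i ℓ ω r))

/-- The σ-algebra generated by the data. -/
abbrev dataAlgebra (ρ : Run S T N R₁ R₂ Ω) : MeasurableSpace Ω :=
  MeasurableSpace.comap ρ.data inferInstance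

/-- The σ-algebra generated by the data, all first-stage inputs and all weights `ŵ*_{iℓ}`. -/
abbrev stageOneAlgebra (ρ : Run S T N R₁ R₂ Ω) : MeasurableSpace Ω :=
  ρ.dataAlgebra ⊔ (⨆ i, MeasurableSpace.comap (ρ.sim₁ i) inferInstance) ⊔
    ⨆ i, ⨆ ℓ, MeasurableSpace.comap (ρ.weights i ℓ) inferInstance

/-- `ρ` is a run of the NIOU-C algorithm with confidence level `1 - α` under the true input
model `F`. The conditional laws of the replications are prescribed separately for each solution
(and each pair), so that common random numbers may be used across solutions and pairs. -/
structure IsNIOUC [MeasurableSpace Ω] (ρ : Run S T N R₁ R₂ Ω) (P : Measure Ω)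
    (F : ∀ p, Measure (S p)) (h : ∀ i, Inputs S (T i) → ℝ) (α : ℝ) : Prop where
  measurable_data : Measurable ρ.data
  measurable_sim₁ : ∀ i, Measurable (ρ.sim₁ i)
  measurable_weights : ∀ i ℓ, Measurable (ρ.weights i ℓ)
  measurable_sim₂ : ∀ i ℓ, Measurable (ρ.sim₂ i ℓ)
  measurable_sim₂' : ∀ i ℓ, Measurable (ρ.sim₂' i ℓ)
  /-- the data are independent, and i.i.d. with law `F p` for each source `p` -/
  data_law : P.map ρ.data = inputLaw F N
  /-- first stage: given the data, i.i.d. replications under the empirical distributions -/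
  stage_one : ∀ i,
    IsCondReplication P ρ.dataAlgebra (fun ω => empirical (ρ.data ω)) (ρ.sim₁ i)
  /-- `ŵ*_{iℓ}` maximizes the estimated linear objective over the ambiguity set -/
  optimal : ∀ i ℓ, i ≠ ℓ → ∀ᵐ ω ∂P,
    ρ.weights i ℓ ω ∈ ambiguitySet N (chiSquaredQuantile (k - 1) (1 - α)) ∧
    IsMaxOn (ρ.objective h i ℓ ω) (ambiguitySet N (chiSquaredQuantile (k - 1) (1 - α)))
      (ρ.weights i ℓ ω)
  /-- second stage: given the first stage, i.i.d. replications of solutions `i` and `ℓ` under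
  the input model with weights `ŵ*_{iℓ}` -/
  stage_two : ∀ i ℓ, i ≠ ℓ → IsCondReplication P ρ.stageOneAlgebra
    (fun ω => weightedEmpirical (ρ.data ω) (ρ.weights i ℓ ω)) (ρ.sim₂ i ℓ)
  stage_two' : ∀ i ℓ, i ≠ ℓ → IsCondReplication P ρ.stageOneAlgebra
    (fun ω => weightedEmpirical (ρ.data ω) (ρ.weights i ℓ ω)) (ρ.sim₂' i ℓ)

/-- `sup_{w ∈ 𝒰_α} E_w[|h_i|⁴]`, as a function of the outcome `ω`. -/
def supFourthMoment (ρ : Run S T N R₁ R₂ Ω) (h : ∀ i, Inputs S (T i) → ℝ) (α : ℝ) (i : Fin k)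
    (ω : Ω) : ℝ≥0∞ :=
  ⨆ w ∈ ambiguitySet N (chiSquaredQuantile (k - 1) (1 - α)),
    ∫⁻ z, ‖h i z‖ₑ ^ 4 ∂(inputLaw (weightedEmpirical (ρ.data ω) w) (T i))

end Run

end Algorithm

section MCB

variable {k : ℕ}

/-- `D⁺_i = (min_{ℓ ≠ i} U_{iℓ})⁺`. -/
def mcbUpper (U : Fin k → Fin k → ℝ) (i : Fin k) : ℝ :=
  max 0 (⨅ ℓ : {ℓ : Fin k // ℓ ≠ i}, U i ℓ)

/-- The set of solutions `I = {i : D⁺_i > 0}`. -/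
def confidenceSet (U : Fin k → Fin k → ℝ) : Set (Fin k) :=
  {i | 0 < mcbUpper U i}

open Classical in
/-- `D⁻_i = 0` if `I = {i}`, and `D⁻_i = -(min_{ℓ ∈ I, ℓ ≠ i} (-U_{ℓi}))⁻` otherwise. If `I` is
empty then `D⁻_i = 0`, in agreement with the convention that the empty minimum is `+∞`. -/
def mcbLower (U : Fin k → Fin k → ℝ) (i : Fin k) : ℝ :=
  if confidenceSet U = {i} then 0
  else -max 0 (-(⨅ ℓ : {ℓ : Fin k // ℓ ∈ confidenceSet U ∧ ℓ ≠ i}, -U ℓ i))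

end MCB

end NIOUC

end

/-!
Let `c` be the best solution and `Δ_ℓ = η_c - η_ℓ`. Both claims follow deterministically from the
event that `Δ_ℓ ≤ Û_{cℓ}` for every `ℓ ≠ c` (`mem_confidenceSet_of_bounds`,
`mem_mcbInterval_of_bounds`): only the `k - 1` comparisons with the best solution matter, which is
why a chi-square quantile with `k - 1` degrees of freedom suffices. It remains to show that this
event has asymptotic probability at least `1 - α` (`eventually_le_prob_bounds`).

Let `g_ℓ` be the difference of the first-order (Hájek) projections of `h_c` and `h_ℓ`, let
`v_ℓ = ∑_p E[g_{ℓp}²] / β_p`, and let `q` be the quantile that defines the ambiguity set. The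
analytic core is the one-sided expansion `isSmallOP_min_bound`: for every `a` with `a² v_ℓ < q`,

  `√n (Û_{cℓ} - Δ_ℓ) ≥ √n ∑_p mean(g_{ℓp}) + a v_ℓ - o_P(1)`,

where `mean` is the average over the data of source `p`. It is assembled from the following facts.

* Second stage: given the first stage, `Û_{cℓ}` is an average of `R₂ ≫ n` replications, so that it
  differs from its conditional mean by `o_P(n^{-1/2})` (`isSmallOP_sqrt_mul_error`).
* The performance at the weights `w` is multilinear in `w`. The empirical likelihood constraint
  confines the relative deviations `n_p w_{pj} - 1` to a fixed Euclidean ball (`sum_sq_relDev_le`),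
  and there the remainder beyond the linear term is `O_P(1 / n)`: under uniformly drawn indices the
  slots are independent and the deviations centred, so that its mean square is computed explicitly
  (`sq_avgSel_sub_linPart_le`).
* First stage: the linear objective with estimated influence functions is uniformly close to the
  linear term on that ball, by the Cauchy–Schwarz inequality (`sq_linEst_sub_linPart_le`) and a
  bound for the simulation error of all influence estimates together (`isSmallOP_momentError`).
  Here the data points have to be distinct, which holds almost surely for distributions without
  atoms (`ae_injective_inputLaw`).
* The performance at the uniform weights is a V-statistic, and it is approximated by the sum of its
  projections up to `O_P(1 / n)` (`exists_integral_vstat_sub_proj_sq_le`): after the projections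
  are removed the kernel is degenerate, and then two index arrays contribute to the second moment
  only if they share two data points or have repetitions.
* Optimality: the maximizer does at least as well as any other element of the ambiguity set. It is
  compared with the explicit weights `(1 + b_{pj}) / n_p`, where the tilt `b` is proportional to
  the centred values of `g_ℓ` with factor `a √n / n_p`. They belong to the ambiguity set with
  probability tending to one if `a² v_ℓ < q` (`tendsto_tilt_notMem_ambiguitySet`), and the linear
  term at `b`, times `√n`, tends to `a v_ℓ` (`isSmallOP_sqrt_mul_linPart_tilt`). No analysis of the
  maximizer itself is needed.

With `a = r' / √v_ℓ` for `r'² < q` the expansion says that `Δ_ℓ ≤ Û_{cℓ}` for all `ℓ` as soon as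
`√n ∑_p mean(g_{ℓp}) > - r √v_ℓ` for all `ℓ`, up to an event of vanishing probability, for any
fixed `r < r'`. By the central limit theorem (`liminf_scoreVec_ge`) the left-hand sides form
asymptotically a centred Gaussian vector with variances `v_ℓ`. Such a vector is a linear image of a
standard Gaussian vector in dimension `k - 1`, and by the Cauchy–Schwarz inequality all the
inequalities hold when the norm of the latter is less than `r` (Scheffé's method,
`chiSquared_le_multivariateGaussian`). As `r² ↑ q` the probability of this tends to at least
`1 - α`, because the quantile is attained and the chi-square distribution has no atoms
(`le_chiSquared_Iio_quantile`).

The assumption on the covariance matrices enters through `v_ℓ > 0`: the influence function is almost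
everywhere the sum of the projections over the slots of the source (`influence_ae_eq`).
-/

namespace NIOUC

set_option linter.unusedSectionVars false

/-! ### Product measures -/

section ProductMeasures

variable {ι κ : Type*} [Fintype ι] [Fintype κ] {X : ι → Type*} [∀ i, MeasurableSpace (X i)]

lemma measurePreserving_pi_comp_injective (μ : ∀ i, Measure (X i)) [∀ i, IsProbabilityMeasure (μ i)]
    {f : κ → ι} (hf : Function.Injective f) :
    MeasurePreserving (fun (x : ∀ i, X i) k => x (f k)) (Measure.pi μ)
      (Measure.pi fun k => μ (f k)) := by
  refine ⟨by fun_prop, ?_⟩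
  have h : iIndepFun (fun i (x : ∀ i, X i) => x i) (Measure.pi μ) :=
    iIndepFun_pi (X := fun i x => x) (fun i => aemeasurable_id)
  have h2 := h.precomp hf
  rw [iIndepFun_iff_map_fun_eq_pi_map (fun k => (measurable_pi_apply _).aemeasurable)] at h2
  rw [h2]
  congr 1
  funext k
  exact (measurePreserving_eval μ (f k)).map_eq

/-- Replacing some coordinates of a random point by those of an independent copy does not change
its law. -/
lemma measurePreserving_pi_mix (μ : ∀ i, Measure (X i)) [∀ i, IsProbabilityMeasure (μ i)]
    (A : ι → Prop) [DecidablePred A] :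
    MeasurePreserving (fun (q : (∀ i, X i) × (∀ i, X i)) i => if A i then q.1 i else q.2 i)
      ((Measure.pi μ).prod (Measure.pi μ)) (Measure.pi μ) := by
  have hm : Measurable (fun (q : (∀ i, X i) × (∀ i, X i)) i => if A i then q.1 i else q.2 i) := by
    refine measurable_pi_lambda _ fun i => ?_
    split_ifs <;> fun_prop
  refine ⟨hm, (Measure.pi_eq fun s hs => ?_).symm⟩
  rw [Measure.map_apply hm (MeasurableSet.univ_pi hs)]
  have : (fun (q : (∀ i, X i) × (∀ i, X i)) i => if A i then q.1 i else q.2 i) ⁻¹'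
      (Set.univ.pi s) = (Set.univ.pi fun i => if A i then s i else Set.univ) ×ˢ
        (Set.univ.pi fun i => if A i then Set.univ else s i) := by
    ext q
    simp only [Set.mem_preimage, Set.mem_univ_pi, Set.mem_prod, ← forall_and]
    refine forall_congr' fun i => ?_
    split_ifs <;> simp
  rw [this, Measure.prod_prod, Measure.pi_pi, Measure.pi_pi, ← Finset.prod_mul_distrib]
  refine Finset.prod_congr rfl fun i _ => ?_
  split_ifs <;> simp

/-- A product of finite mixtures is the mixture, over all choices of components, of the products. -/
lemma pi_finset_sum [DecidableEq ι] {κ : ι → Type*} [∀ i, Fintype (κ i)]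
    (μ : ∀ i, κ i → Measure (X i)) [∀ i a, IsFiniteMeasure (μ i a)] :
    Measure.pi (fun i => ∑ a, μ i a) = ∑ J : ∀ i, κ i, Measure.pi fun i => μ i (J i) := by
  refine Measure.pi_eq fun s hs => ?_
  simp only [Measure.finsetSum_apply, Measure.pi_pi]
  rw [Finset.prod_univ_sum, Fintype.piFinset_univ]

lemma pi_smul_dirac (c : ι → ℝ≥0) (x : ∀ i, X i) :
    Measure.pi (fun i => (c i : ℝ≥0∞) • Measure.dirac (x i)) =
      ((∏ i, c i : ℝ≥0) : ℝ≥0∞) • Measure.dirac x := by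
  have : ∀ i, IsFiniteMeasure ((c i : ℝ≥0∞) • Measure.dirac (x i)) := fun i =>
    inferInstanceAs (IsFiniteMeasure (c i • Measure.dirac (x i)))
  refine Measure.pi_eq fun s hs => ?_
  classical
  simp only [Measure.smul_apply, smul_eq_mul, Measure.dirac_apply' _ (hs _),
    Measure.dirac_apply' _ (MeasurableSet.univ_pi hs), Finset.prod_mul_distrib]
  rw [ENNReal.ofNNReal_finsetProd]
  congr 1
  by_cases h : ∀ i, x i ∈ s i
  · rw [Set.indicator_of_mem (by simpa using h)]
    exact (Finset.prod_eq_one fun i _ => by simp [h i]).symm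
  · rw [Set.indicator_of_notMem (by simpa using h)]
    push Not at h
    obtain ⟨i, hi⟩ := h
    exact (Finset.prod_eq_zero (Finset.mem_univ i) (by simp [hi])).symm

/-- The mean squared error of an average of i.i.d. variables. -/
lemma integral_sq_mean_sub_le {α : Type*} [MeasurableSpace α] (μ : Measure α)
    [IsProbabilityMeasure μ] {f : α → ℝ} (hf : MemLp f 2 μ) (hκ : 0 < Fintype.card κ) :
    ∫ z, ((Fintype.card κ : ℝ)⁻¹ * ∑ r, f (z r) - ∫ a, f a ∂μ) ^ 2 ∂(Measure.pi fun _ : κ => μ) ≤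
      (∫ a, f a ^ 2 ∂μ) / Fintype.card κ := by
  have hκ' : (Fintype.card κ : ℝ) ≠ 0 := by positivity
  set P := Measure.pi fun _ : κ => μ
  have hL : ∀ r, MemLp (fun z : κ → α => f (z r)) 2 P := fun r =>
    hf.comp_measurePreserving (measurePreserving_eval (fun _ : κ => μ) r)
  have hE : ∀ r, ∫ z, f (z r) ∂P = ∫ a, f a ∂μ := fun r =>
    integral_comp_eval (μ := fun _ : κ => μ) hf.aestronglyMeasurable
  have hmean : ∫ z, (Fintype.card κ : ℝ)⁻¹ * ∑ r, f (z r) ∂P = ∫ a, f a ∂μ := by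
    rw [integral_const_mul, integral_finsetSum _ fun r _ => (hL r).integrable one_le_two]
    simp [hE, hκ']
  have hL' : MemLp (fun z : κ → α => (Fintype.card κ : ℝ)⁻¹ * ∑ r, f (z r)) 2 P :=
    (memLp_finsetSum _ fun r _ => hL r).const_mul _
  have hv := variance_eq_integral hL'.aestronglyMeasurable.aemeasurable
  rw [hmean] at hv
  rw [← hv, variance_const_mul]
  have h3 := variance_sum_pi (μ := fun _ : κ => μ) (X := fun _ => f) fun _ => hf
  have h4 : (fun z : κ → α => ∑ r, f (z r)) = ∑ r, fun z : κ → α => f (z r) := by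
    ext z; simp
  rw [h4, h3]
  have h5 : Var[f; μ] ≤ ∫ a, f a ^ 2 ∂μ := variance_le_expectation_sq hf.aestronglyMeasurable
  simp only [Finset.sum_const, Finset.card_univ, nsmul_eq_mul]
  calc ((Fintype.card κ : ℝ)⁻¹) ^ 2 * (Fintype.card κ * Var[f; μ])
      = Var[f; μ] / Fintype.card κ := by field_simp
    _ ≤ _ := by gcongr

end ProductMeasures

/-! ### Convergence in probability along a sequence of probability spaces -/

section InProbability

variable {Ω : ℕ → Type*} [∀ ν, MeasurableSpace (Ω ν)] {P : ∀ ν, Measure (Ω ν)}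

/-- `Y_ν = o_P(1)`: convergence to zero in probability, for variables on varying probability
spaces. -/
def IsSmallOP (P : ∀ ν, Measure (Ω ν)) (Y : ∀ ν, Ω ν → ℝ) : Prop :=
  ∀ ε : ℝ, 0 < ε → Tendsto (fun ν => P ν {ω | ε ≤ |Y ν ω|}) atTop (𝓝 0)

/-- `Y_ν = O_P(1)`: boundedness in probability, for variables on varying probability spaces. -/
def IsBigOP (P : ∀ ν, Measure (Ω ν)) (Y : ∀ ν, Ω ν → ℝ) : Prop :=
  ∀ δ : ℝ≥0∞, 0 < δ → ∃ M : ℝ, 0 < M ∧ ∀ᶠ ν in atTop, P ν {ω | M < |Y ν ω|} ≤ δ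

variable {Y Z : ∀ ν, Ω ν → ℝ}

lemma IsSmallOP.mono (hY : IsSmallOP P Y)
    (h : ∀ᶠ ν in atTop, ∀ᵐ ω ∂(P ν), |Z ν ω| ≤ |Y ν ω|) : IsSmallOP P Z := by
  intro ε hε
  refine tendsto_of_tendsto_of_tendsto_of_le_of_le' tendsto_const_nhds (hY ε hε)
    (.of_forall fun _ => zero_le) ?_
  filter_upwards [h] with ν hν
  refine measure_mono_ae ?_
  filter_upwards [hν] with ω hω h1
  exact le_trans (show ε ≤ _ from h1) hω

lemma IsBigOP.mono (hY : IsBigOP P Y)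
    (h : ∀ᶠ ν in atTop, ∀ᵐ ω ∂(P ν), |Z ν ω| ≤ |Y ν ω|) : IsBigOP P Z := by
  intro δ hδ
  obtain ⟨M, hM, h1⟩ := hY δ hδ
  refine ⟨M, hM, ?_⟩
  filter_upwards [h, h1] with ν hν h2
  refine (measure_mono_ae ?_).trans h2
  filter_upwards [hν] with ω hω h1
  exact lt_of_lt_of_le (show M < _ from h1) hω

lemma IsSmallOP.add (hY : IsSmallOP P Y) (hZ : IsSmallOP P Z) :
    IsSmallOP P fun ν ω => Y ν ω + Z ν ω := by
  intro ε hε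
  have h := (hY (ε / 2) (by positivity)).add (hZ (ε / 2) (by positivity))
  rw [add_zero] at h
  refine tendsto_of_tendsto_of_tendsto_of_le_of_le tendsto_const_nhds h
    (fun _ => zero_le) fun ν => ?_
  refine (measure_mono ?_).trans (measure_union_le _ _)
  intro ω hω
  by_contra hc
  simp only [Set.mem_union, Set.mem_ofPred_eq, not_or, not_le] at hc hω
  have := abs_add_le (Y ν ω) (Z ν ω)
  linarith

lemma IsSmallOP.neg (hY : IsSmallOP P Y) : IsSmallOP P fun ν ω => -Y ν ω :=
  hY.mono (.of_forall fun ν => .of_forall fun ω => by simp)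

lemma IsSmallOP.sub (hY : IsSmallOP P Y) (hZ : IsSmallOP P Z) :
    IsSmallOP P fun ν ω => Y ν ω - Z ν ω := by
  simpa only [sub_eq_add_neg] using hY.add hZ.neg

lemma isSmallOP_zero : IsSmallOP P fun _ _ => 0 := by
  intro ε hε
  simp [not_le.2 hε]

lemma IsSmallOP.sum {ι : Type*} (s : Finset ι) {Y : ι → ∀ ν, Ω ν → ℝ}
    (h : ∀ i ∈ s, IsSmallOP P (Y i)) : IsSmallOP P fun ν ω => ∑ i ∈ s, Y i ν ω := by
  classical
  induction s using Finset.induction_on with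
  | empty => simpa using isSmallOP_zero
  | insert a s ha ih =>
    simp only [Finset.sum_insert ha]
    exact (h a (Finset.mem_insert_self a s)).add
      (ih fun i hi => h i (Finset.mem_insert_of_mem hi))

lemma IsSmallOP.mul_isBigOP (hY : IsSmallOP P Y) (hZ : IsBigOP P Z) :
    IsSmallOP P fun ν ω => Y ν ω * Z ν ω := by
  intro ε hε
  rw [ENNReal.tendsto_nhds_zero]
  intro δ hδ
  obtain ⟨M, hM, hM'⟩ := hZ (δ / 2) (ENNReal.half_pos hδ.ne')
  filter_upwards [hM', (ENNReal.tendsto_nhds_zero.1 (hY (ε / M) (by positivity))) (δ / 2)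
    (ENNReal.half_pos hδ.ne')] with ν h1 h2
  rw [← ENNReal.add_halves δ]
  refine le_trans ((measure_mono ?_).trans (measure_union_le _ _)) (add_le_add h2 h1)
  intro ω hω
  by_contra hc
  simp only [Set.mem_union, Set.mem_ofPred_eq, not_or, not_le, not_lt, abs_mul] at hc hω
  have h3 : |Y ν ω| * |Z ν ω| < ε := by
    calc |Y ν ω| * |Z ν ω| ≤ |Y ν ω| * M := by gcongr; exact hc.2
      _ < ε / M * M := by gcongr; exact hc.1
      _ = ε := by field_simp
  linarith

lemma IsBigOP.mul_isSmallOP (hZ : IsBigOP P Z) (hY : IsSmallOP P Y) :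
    IsSmallOP P fun ν ω => Z ν ω * Y ν ω := by
  simpa only [mul_comm] using hY.mul_isBigOP hZ

lemma IsSmallOP.isBigOP (hY : IsSmallOP P Y) : IsBigOP P Y := by
  intro δ hδ
  refine ⟨1, one_pos, ?_⟩
  filter_upwards [ENNReal.tendsto_nhds_zero.1 (hY 1 one_pos) δ hδ] with ν h
  exact (measure_mono fun ω hω => le_of_lt (show 1 < |Y ν ω| from hω)).trans h

lemma IsBigOP.add (hY : IsBigOP P Y) (hZ : IsBigOP P Z) :
    IsBigOP P fun ν ω => Y ν ω + Z ν ω := by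
  intro δ hδ
  obtain ⟨M, hM, hM'⟩ := hY (δ / 2) (ENNReal.half_pos hδ.ne')
  obtain ⟨L, hL, hL'⟩ := hZ (δ / 2) (ENNReal.half_pos hδ.ne')
  refine ⟨M + L, by positivity, ?_⟩
  filter_upwards [hM', hL'] with ν h1 h2
  rw [← ENNReal.add_halves δ]
  refine le_trans ((measure_mono ?_).trans (measure_union_le _ _)) (add_le_add h1 h2)
  intro ω hω
  by_contra hc
  simp only [Set.mem_union, Set.mem_ofPred_eq, not_or, not_lt] at hc hω
  have := abs_add_le (Y ν ω) (Z ν ω)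
  linarith

lemma IsBigOP.const_mul (hY : IsBigOP P Y) (c : ℝ) : IsBigOP P fun ν ω => c * Y ν ω := by
  intro δ hδ
  obtain ⟨M, hM, hM'⟩ := hY δ hδ
  refine ⟨|c| * M + 1, by positivity, ?_⟩
  filter_upwards [hM'] with ν hν
  refine (measure_mono fun ω hω => ?_).trans hν
  by_contra hc
  simp only [Set.mem_ofPred_eq, not_lt, abs_mul] at hc hω
  have := mul_le_mul_of_nonneg_left hc (abs_nonneg c)
  linarith

/-- A deterministic sequence that converges is bounded in probability. -/
lemma isBigOP_of_tendsto {a : ℕ → ℝ} {c : ℝ} (h : Tendsto a atTop (𝓝 c)) :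
    IsBigOP P fun ν _ => a ν := by
  intro δ hδ
  refine ⟨|c| + 1, by positivity, ?_⟩
  filter_upwards [h.abs.eventually (gt_mem_nhds (lt_add_one |c|))] with ν hν
  simp [not_lt.2 hν.le]

lemma isSmallOP_of_tendsto {a : ℕ → ℝ} (h : Tendsto a atTop (𝓝 0)) :
    IsSmallOP P fun ν _ => a ν := by
  intro ε hε
  refine tendsto_const_nhds.congr' ?_
  filter_upwards [h.abs.eventually (gt_mem_nhds (by simpa using hε : |(0 : ℝ)| < ε))] with ν hν
  simp [not_le.2 hν]

/-- Products of convergent deterministic sequences with variables that converge in probability. -/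
lemma isSmallOP_mul_sub {a : ℕ → ℝ} {c y : ℝ} (ha : Tendsto a atTop (𝓝 c))
    (hY : IsSmallOP P fun ν ω => Y ν ω - y) :
    IsSmallOP P fun ν ω => a ν * Y ν ω - c * y := by
  have h1 := (isBigOP_of_tendsto (P := P) ha).mul_isSmallOP hY
  have h2 : IsSmallOP P fun ν (_ : Ω ν) => (a ν - c) * y :=
    isSmallOP_of_tendsto (by simpa using (ha.sub_const c).mul_const y)
  refine (h1.add h2).mono (.of_forall fun ν => .of_forall fun ω => le_of_eq ?_)
  congr 1
  ring

lemma isSmallOP_of_lintegral {Y : ∀ ν, Ω ν → ℝ} (hm : ∀ ν, AEMeasurable (Y ν) (P ν))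
    (h : Tendsto (fun ν => ∫⁻ ω, ENNReal.ofReal |Y ν ω| ∂(P ν)) atTop (𝓝 0)) :
    IsSmallOP P Y := by
  intro ε hε
  have hε' : ENNReal.ofReal ε ≠ 0 := by simpa using hε
  have h2 : Tendsto (fun ν => (∫⁻ ω, ENNReal.ofReal |Y ν ω| ∂(P ν)) / ENNReal.ofReal ε)
      atTop (𝓝 0) := by
    have := ENNReal.Tendsto.div_const h (b := ENNReal.ofReal ε) (Or.inr hε')
    simpa using this
  refine tendsto_of_tendsto_of_tendsto_of_le_of_le tendsto_const_nhds h2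
    (fun _ => zero_le) fun ν => ?_
  refine le_trans (measure_mono ?_)
    (meas_ge_le_lintegral_div (hm ν).abs.ennreal_ofReal hε' (by simp))
  intro ω hω
  exact ENNReal.ofReal_le_ofReal hω

lemma isBigOP_of_lintegral {Y : ∀ ν, Ω ν → ℝ} (hm : ∀ ν, AEMeasurable (Y ν) (P ν)) {C : ℝ≥0}
    (h : ∀ᶠ ν in atTop, ∫⁻ ω, ENNReal.ofReal |Y ν ω| ∂(P ν) ≤ C) :
    IsBigOP P Y := by
  intro δ hδ
  obtain ⟨M, hM, hMδ⟩ : ∃ M : ℝ, 0 < M ∧ (C : ℝ≥0∞) / ENNReal.ofReal M ≤ δ := by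
    rcases eq_or_ne δ ∞ with rfl | hδ'
    · exact ⟨1, one_pos, le_top⟩
    · have hδ0 : 0 < δ.toReal := ENNReal.toReal_pos hδ.ne' hδ'
      refine ⟨(C + 1) / δ.toReal, by positivity, ?_⟩
      rw [ENNReal.ofReal_div_of_pos hδ0, ENNReal.ofReal_toReal hδ']
      refine ENNReal.div_le_of_le_mul ?_
      rw [ENNReal.mul_div_cancel hδ.ne' hδ']
      rw [ENNReal.ofReal_add (by positivity) zero_le_one]
      simp
  refine ⟨M, hM, ?_⟩
  filter_upwards [h] with ν hν
  refine le_trans (measure_mono ?_) ((meas_ge_le_lintegral_div (hm ν).abs.ennreal_ofReal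
    (by simpa using hM) (by simp) (ε := ENNReal.ofReal M)).trans
      ((ENNReal.div_le_div_right hν _).trans hMδ))
  intro ω hω
  exact ENNReal.ofReal_le_ofReal (le_of_lt hω)

lemma IsSmallOP.of_sq (h : IsSmallOP P fun ν ω => Y ν ω ^ 2) : IsSmallOP P Y := by
  intro ε hε
  refine (h (ε ^ 2) (by positivity)).congr fun ν => ?_
  congr 1
  ext ω
  simp only [Set.mem_ofPred_eq, abs_pow]
  exact pow_le_pow_iff_left₀ hε.le (abs_nonneg _) two_ne_zero

lemma isSmallOP_of_integral_sq {Ω : ℕ → Type*} [∀ ν, MeasurableSpace (Ω ν)]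
    {P : ∀ ν, Measure (Ω ν)} {Y : ∀ ν, Ω ν → ℝ} {r : ℕ → ℝ} (hY : ∀ ν, MemLp (Y ν) 2 (P ν))
    (hr : Tendsto r atTop (𝓝 0)) (h : ∀ᶠ ν in atTop, ∫ ω, Y ν ω ^ 2 ∂(P ν) ≤ r ν) :
    IsSmallOP P Y := by
  refine IsSmallOP.of_sq (isSmallOP_of_lintegral
    (fun ν => ((hY ν).aestronglyMeasurable.aemeasurable.pow_const 2)) ?_)
  have h0 : Tendsto (fun ν => ENNReal.ofReal (r ν)) atTop (𝓝 0) := by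
    simpa using ENNReal.tendsto_ofReal hr
  refine tendsto_of_tendsto_of_tendsto_of_le_of_le' tendsto_const_nhds h0
    (.of_forall fun _ => zero_le) ?_
  filter_upwards [h] with ν hν
  have e : ∀ ω, |Y ν ω ^ 2| = Y ν ω ^ 2 := fun ω => abs_of_nonneg (sq_nonneg _)
  simp only [e]
  rw [← ofReal_integral_eq_lintegral_ofReal (hY ν).integrable_sq
    (.of_forall fun _ => sq_nonneg _)]
  exact ENNReal.ofReal_le_ofReal hν

lemma isBigOP_of_integral {Ω : ℕ → Type*} [∀ ν, MeasurableSpace (Ω ν)]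
    {P : ∀ ν, Measure (Ω ν)} {Y : ∀ ν, Ω ν → ℝ} {C : ℝ} (hY : ∀ ν, Integrable (Y ν) (P ν))
    (h0 : ∀ ν ω, 0 ≤ Y ν ω) (h : ∀ ν, ∫ ω, Y ν ω ∂(P ν) ≤ C) :
    IsBigOP P Y := by
  refine isBigOP_of_lintegral (fun ν => (hY ν).aestronglyMeasurable.aemeasurable)
    (C := C.toNNReal) (.of_forall fun ν => ?_)
  simp only [abs_of_nonneg (h0 ν _)]
  rw [← ofReal_integral_eq_lintegral_ofReal (hY ν) (.of_forall fun _ => h0 ν _)]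
  exact ENNReal.ofReal_le_ofReal (h ν)

lemma IsSmallOP.comp_of_map_eq {Ω Ω' : ℕ → Type*} [∀ ν, MeasurableSpace (Ω ν)]
    [∀ ν, MeasurableSpace (Ω' ν)] {P : ∀ ν, Measure (Ω ν)} {P' : ∀ ν, Measure (Ω' ν)}
    {f : ∀ ν, Ω ν → Ω' ν} (hf : ∀ ν, Measurable (f ν)) (hP : ∀ ν, (P ν).map (f ν) = P' ν)
    {Y : ∀ ν, Ω' ν → ℝ} (h : IsSmallOP P' Y) : IsSmallOP P fun ν ω => Y ν (f ν ω) := by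
  intro ε hε
  refine tendsto_of_tendsto_of_tendsto_of_le_of_le tendsto_const_nhds (h ε hε)
    (fun _ => zero_le) fun ν => ?_
  rw [← hP ν]
  exact Measure.le_map_apply (hf ν).aemeasurable _

lemma IsBigOP.comp_of_map_eq {Ω Ω' : ℕ → Type*} [∀ ν, MeasurableSpace (Ω ν)]
    [∀ ν, MeasurableSpace (Ω' ν)] {P : ∀ ν, Measure (Ω ν)} {P' : ∀ ν, Measure (Ω' ν)}
    {f : ∀ ν, Ω ν → Ω' ν} (hf : ∀ ν, Measurable (f ν)) (hP : ∀ ν, (P ν).map (f ν) = P' ν)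
    {Y : ∀ ν, Ω' ν → ℝ} (h : IsBigOP P' Y) : IsBigOP P fun ν ω => Y ν (f ν ω) := by
  intro δ hδ
  obtain ⟨M, hM, h'⟩ := h δ hδ
  refine ⟨M, hM, ?_⟩
  filter_upwards [h'] with ν hν
  refine le_trans ?_ hν
  rw [← hP ν]
  exact Measure.le_map_apply (hf ν).aemeasurable _

lemma IsSmallOP.isBigOP_of_sub {Ω : ℕ → Type*} [∀ ν, MeasurableSpace (Ω ν)]
    {P : ∀ ν, Measure (Ω ν)} {Y : ∀ ν, Ω ν → ℝ} {y : ℝ} (h : IsSmallOP P fun ν ω => Y ν ω - y) :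
    IsBigOP P Y :=
  (h.isBigOP.add (isBigOP_of_tendsto (tendsto_const_nhds (x := y)))).mono
    (.of_forall fun _ => .of_forall fun _ => by simp)

lemma IsBigOP.mul {Ω : ℕ → Type*} [∀ ν, MeasurableSpace (Ω ν)]
    {P : ∀ ν, Measure (Ω ν)} {Y Z : ∀ ν, Ω ν → ℝ} (hY : IsBigOP P Y) (hZ : IsBigOP P Z) :
    IsBigOP P fun ν ω => Y ν ω * Z ν ω := by
  intro δ hδ
  obtain ⟨M, hM, hM'⟩ := hY (δ / 2) (ENNReal.half_pos hδ.ne')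
  obtain ⟨L, hL, hL'⟩ := hZ (δ / 2) (ENNReal.half_pos hδ.ne')
  refine ⟨M * L, by positivity, ?_⟩
  filter_upwards [hM', hL'] with ν h1 h2
  rw [← ENNReal.add_halves δ]
  refine le_trans ((measure_mono ?_).trans (measure_union_le _ _)) (add_le_add h1 h2)
  intro ω hω
  by_contra hc
  simp only [Set.mem_union, Set.mem_ofPred_eq, not_or, not_lt, abs_mul] at hc hω
  have := mul_le_mul hc.1 hc.2 (abs_nonneg _) hM.le
  linarith

/-- The domination is needed only outside events whose probability tends to zero. -/
lemma IsSmallOP.mono_of_compl {Ω : ℕ → Type*} [∀ ν, MeasurableSpace (Ω ν)]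
    {P : ∀ ν, Measure (Ω ν)} {Y Z : ∀ ν, Ω ν → ℝ} (hY : IsSmallOP P Y) {A : ∀ ν, Set (Ω ν)}
    (hA : Tendsto (fun ν => P ν (A ν)) atTop (𝓝 0))
    (h : ∀ ν, ∀ᵐ ω ∂(P ν), ω ∉ A ν → |Z ν ω| ≤ |Y ν ω|) : IsSmallOP P Z := by
  intro ε hε
  have h0 := (hY ε hε).add hA
  rw [add_zero] at h0
  refine tendsto_of_tendsto_of_tendsto_of_le_of_le tendsto_const_nhds h0
    (fun _ => zero_le) fun ν => ?_
  refine (measure_mono_ae ?_).trans (measure_union_le _ _)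
  filter_upwards [h ν] with ω hω h1
  by_cases hA : ω ∈ A ν
  · exact Or.inr hA
  · exact Or.inl (le_trans (show ε ≤ _ from h1) (hω hA))

end InProbability

/-! ### Slots, selections and the law of the inputs -/

/-- The positions of the inputs of one replication: the `t`-th input of source `p`. -/
abbrev Slot {m : ℕ} (T : Fin m → ℕ) : Type := Σ p, Fin (T p)

section Selection

variable {m : ℕ} {S : Fin m → Type*} {T N : Fin m → ℕ}

/-- The input array `(x_{p, J(p,t)})_{p,t}` selected from the data `x` by the index array `J`. -/
def sel (J : ∀ s : Slot T, Fin (N s.1)) (x : Inputs S N) : Inputs S T :=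
  fun p t => x p (J ⟨p, t⟩)

/-- The data point to which the slot `s` is sent by the index array `J`. -/
def target (J : ∀ s : Slot T, Fin (N s.1)) (s : Slot T) : Slot N := ⟨s.1, J s⟩

/-- The input array `z` with the input in slot `s` replaced by `ξ`. -/
def updateSlot (z : Inputs S T) (s : Slot T) (ξ : S s.1) : Inputs S T :=
  Function.update z s.1 (Function.update (z s.1) s.2 ξ)

lemma updateSlot_apply_self (z : Inputs S T) (s : Slot T) (ξ : S s.1) :
    updateSlot z s ξ s.1 s.2 = ξ := by
  simp [updateSlot]

lemma updateSlot_apply_of_ne (z : Inputs S T) {s : Slot T} (ξ : S s.1) {p : Fin m} {t : Fin (T p)}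
    (h : (⟨p, t⟩ : Slot T) ≠ s) : updateSlot z s ξ p t = z p t := by
  obtain ⟨p', t'⟩ := s
  unfold updateSlot
  rcases eq_or_ne p p' with rfl | hp
  · have : t ≠ t' := fun h' => h (by rw [h'])
    simp [this]
  · simp [hp]

variable [∀ p, MeasurableSpace (S p)]

@[fun_prop]
lemma measurable_sel (J : ∀ s : Slot T, Fin (N s.1)) :
    Measurable (sel (S := S) J) := by
  unfold sel; fun_prop

lemma measurable_updateSlot (s : Slot T) :
    Measurable fun q : S s.1 × Inputs S T => updateSlot q.2 s q.1 := by
  refine measurable_pi_lambda _ fun p => measurable_pi_lambda _ fun t => ?_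
  by_cases h : (⟨p, t⟩ : Slot T) = s
  · subst h
    have e : (fun c : S p × Inputs S T => updateSlot c.2 ⟨p, t⟩ c.1 p t) = Prod.fst :=
      funext fun c => updateSlot_apply_self c.2 ⟨p, t⟩ c.1
    exact e.symm.subst (motive := Measurable) measurable_fst
  · simp only [updateSlot_apply_of_ne _ _ h]
    fun_prop

variable (F : ∀ p, Measure (S p)) [∀ p, IsProbabilityMeasure (F p)]

instance isProbabilityMeasure_inputLaw (T : Fin m → ℕ) : IsProbabilityMeasure (inputLaw F T) := by
  unfold inputLaw; infer_instance

/-- The law of the inputs is a product measure over all slots. -/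
lemma measurePreserving_curry_inputLaw (T : Fin m → ℕ) :
    MeasurePreserving (MeasurableEquiv.piCurry fun p (_ : Fin (T p)) => S p)
      (Measure.pi fun s : Slot T => F s.1) (inputLaw F T) := by
  refine ⟨MeasurableEquiv.measurable _, ?_⟩
  have h := Measure.infinitePi_map_piCurry (fun p (_ : Fin (T p)) => F p)
  simp only [Measure.infinitePi_eq_pi] at h
  exact h

lemma measurePreserving_uncurry_inputLaw (T : Fin m → ℕ) :
    MeasurePreserving (fun (z : Inputs S T) (s : Slot T) => z s.1 s.2)
      (inputLaw F T) (Measure.pi fun s : Slot T => F s.1) :=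
  (measurePreserving_curry_inputLaw F T).symm

lemma measurePreserving_of_uncurry {α : Type*} [MeasurableSpace α] {μ : Measure α}
    {f : α → Inputs S T}
    (h : MeasurePreserving (fun a (s : Slot T) => f a s.1 s.2) μ
      (Measure.pi fun s : Slot T => F s.1)) : MeasurePreserving f μ (inputLaw F T) :=
  (measurePreserving_curry_inputLaw F T).comp h

lemma measurePreserving_eval_inputLaw (s : Slot T) :
    MeasurePreserving (fun z : Inputs S T => z s.1 s.2) (inputLaw F T) (F s.1) :=
  (measurePreserving_eval (fun s : Slot T => F s.1) s).comp
    (measurePreserving_uncurry_inputLaw F T)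

lemma measurePreserving_sel {J : ∀ s : Slot T, Fin (N s.1)} (hJ : Function.Injective (target J)) :
    MeasurePreserving (sel J) (inputLaw F N) (inputLaw F T) :=
  measurePreserving_of_uncurry F
    ((measurePreserving_pi_comp_injective (fun s : Slot N => F s.1) hJ).comp
      (measurePreserving_uncurry_inputLaw F N))

lemma measurePreserving_mix_inputLaw (A : Slot N → Prop) [DecidablePred A] :
    MeasurePreserving (fun (q : Inputs S N × Inputs S N) p j =>
        if A ⟨p, j⟩ then q.1 p j else q.2 p j)
      ((inputLaw F N).prod (inputLaw F N)) (inputLaw F N) :=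
  measurePreserving_of_uncurry F
    ((measurePreserving_pi_mix (fun s : Slot N => F s.1) A).comp
      ((measurePreserving_uncurry_inputLaw F N).prod (measurePreserving_uncurry_inputLaw F N)))

/-- Redrawing the input of a single slot does not change the law of the inputs. -/
lemma measurePreserving_updateSlot (s : Slot T) :
    MeasurePreserving (fun q : S s.1 × Inputs S T => updateSlot q.2 s q.1)
      ((F s.1).prod (inputLaw F T)) (inputLaw F T) := by
  classical
  have h := ((measurePreserving_eval_inputLaw F s).prod
    (MeasurePreserving.id (inputLaw F T)))
  refine ⟨measurable_updateSlot s, ?_⟩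
  rw [← h.map_eq, Measure.map_map (measurable_updateSlot s) h.measurable]
  refine Eq.trans ?_ (measurePreserving_mix_inputLaw F fun i : Slot T => i = s).map_eq
  congr 1
  funext q p t
  by_cases hp : (⟨p, t⟩ : Slot T) = s
  · subst hp
    simp [Function.comp, updateSlot]
  · simp [Function.comp, updateSlot_apply_of_ne _ _ hp, hp]

/-- The inputs selected by an arbitrary index array have the same law as the inputs of a single
replication in which some inputs are reused. -/
lemma exists_map_sel_eq (J : ∀ s : Slot T, Fin (N s.1)) :
    ∃ I : ∀ p, Fin (T p) → Fin (T p), (inputLaw F N).map (sel J) =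
      (inputLaw F T).map fun z p t => z p (I p t) := by
  classical
  -- both arrays are built in the same way from an independent family indexed by the
  -- distinct values of `J`
  let E := Σ p, {j : Fin (N p) // ∃ t : Fin (T p), J ⟨p, t⟩ = j}
  let sec : ∀ e : E, Fin (T e.1) := fun e => e.2.2.choose
  have hsec : ∀ e : E, J ⟨e.1, sec e⟩ = e.2.1 := fun e => e.2.2.choose_spec
  let q : Slot T → E := fun s => ⟨s.1, ⟨J s, s.2, rfl⟩⟩
  let I : ∀ p, Fin (T p) → Fin (T p) := fun p t => sec (q ⟨p, t⟩)
  refine ⟨I, ?_⟩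
  let f : E → Slot N := fun e => ⟨e.1, e.2.1⟩
  have hf : Function.Injective f := by
    rintro ⟨p, a, ha⟩ ⟨p', a', ha'⟩ h
    obtain ⟨rfl, h2⟩ := Sigma.mk.inj_iff.1 h
    cases h2
    rfl
  let g : E → Slot T := fun e => ⟨e.1, sec e⟩
  have hg : Function.Injective g := by
    intro e e' h
    obtain ⟨p, a⟩ := e
    obtain ⟨p', a'⟩ := e'
    obtain ⟨rfl, h2⟩ := Sigma.mk.inj_iff.1 h
    have h3 : sec ⟨p, a⟩ = sec ⟨p, a'⟩ := eq_of_heq h2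
    have h4 := hsec ⟨p, a⟩
    rw [h3, hsec ⟨p, a'⟩] at h4
    exact congrArg (Sigma.mk p) (Subtype.ext h4.symm)
  have h1 := (measurePreserving_pi_comp_injective (fun s : Slot N => F s.1) hf).comp
    (measurePreserving_uncurry_inputLaw F N)
  have h2 := (measurePreserving_pi_comp_injective (fun s : Slot T => F s.1) hg).comp
    (measurePreserving_uncurry_inputLaw F T)
  let k : (∀ e : E, S e.1) → Inputs S T := fun y p t => y (q ⟨p, t⟩)
  have hk : Measurable k := by
    refine measurable_pi_lambda _ fun p => measurable_pi_lambda _ fun t => ?_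
    exact measurable_pi_apply _
  have e1 : sel J = k ∘ ((fun x e => x (f e)) ∘ fun (z : Inputs S N) (s : Slot N) => z s.1 s.2) :=
    rfl
  have e2 : (fun (z : Inputs S T) p t => z p (I p t)) =
      k ∘ ((fun x e => x (g e)) ∘ fun (z : Inputs S T) (s : Slot T) => z s.1 s.2) := rfl
  rw [e1, e2, ← Measure.map_map hk h1.measurable, ← Measure.map_map hk h2.measurable,
    h1.map_eq, h2.map_eq]

end Selection

/-! ### Averages over index arrays and the expansion in the weights -/

section Averages

variable {m : ℕ} {S : Fin m → Type*} {T N : Fin m → ℕ}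

/-- The average over all index arrays. -/
noncomputable def avgSel (N : Fin m → ℕ) (φ : (∀ s : Slot T, Fin (N s.1)) → ℝ) : ℝ :=
  (∏ s : Slot T, (N s.1 : ℝ))⁻¹ * ∑ J, φ J

lemma avgSel_add (φ ψ : (∀ s : Slot T, Fin (N s.1)) → ℝ) :
    avgSel N (fun J => φ J + ψ J) = avgSel N φ + avgSel N ψ := by
  simp only [avgSel, Finset.sum_add_distrib, mul_add]

lemma avgSel_sub (φ ψ : (∀ s : Slot T, Fin (N s.1)) → ℝ) :
    avgSel N (fun J => φ J - ψ J) = avgSel N φ - avgSel N ψ := by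
  simp only [avgSel, Finset.sum_sub_distrib, mul_sub]

lemma avgSel_const_mul (c : ℝ) (φ : (∀ s : Slot T, Fin (N s.1)) → ℝ) :
    avgSel N (fun J => c * φ J) = c * avgSel N φ := by
  simp only [avgSel, ← Finset.mul_sum]; ring

lemma avgSel_mul_const (c : ℝ) (φ : (∀ s : Slot T, Fin (N s.1)) → ℝ) :
    avgSel N (fun J => φ J * c) = avgSel N φ * c := by
  simp only [avgSel, ← Finset.sum_mul]; ring

lemma avgSel_sum {ι : Type*} (s : Finset ι) (φ : ι → (∀ s : Slot T, Fin (N s.1)) → ℝ) :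
    avgSel N (fun J => ∑ i ∈ s, φ i J) = ∑ i ∈ s, avgSel N (φ i) := by
  simp only [avgSel]
  rw [Finset.sum_comm, Finset.mul_sum]

lemma avgSel_mono {φ ψ : (∀ s : Slot T, Fin (N s.1)) → ℝ} (h : ∀ J, φ J ≤ ψ J) :
    avgSel N φ ≤ avgSel N ψ := by
  unfold avgSel
  gcongr with J
  exact h J

lemma avgSel_nonneg {φ : (∀ s : Slot T, Fin (N s.1)) → ℝ} (h : ∀ J, 0 ≤ φ J) :
    0 ≤ avgSel N φ := by
  unfold avgSel
  exact mul_nonneg (by positivity) (Finset.sum_nonneg fun J _ => h J)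

lemma avgSel_prod (g : ∀ s : Slot T, Fin (N s.1) → ℝ) :
    avgSel N (fun J => ∏ s, g s (J s)) = ∏ s, ((N s.1 : ℝ)⁻¹ * ∑ j, g s j) := by
  rw [avgSel, Finset.prod_mul_distrib, Finset.prod_univ_sum, Fintype.piFinset_univ,
    Finset.prod_inv_distrib]

lemma avgSel_prod_subset (hN : ∀ p, 0 < N p) (A : Finset (Slot T))
    (g : ∀ s : Slot T, Fin (N s.1) → ℝ) :
    avgSel N (fun J => ∏ s ∈ A, g s (J s)) = ∏ s ∈ A, ((N s.1 : ℝ)⁻¹ * ∑ j, g s j) := by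
  have h := avgSel_prod fun s j => if s ∈ A then g s j else 1
  simp only [Finset.prod_ite_mem, Finset.univ_inter] at h
  rw [h]
  rw [← Finset.prod_subset (Finset.subset_univ A)]
  · refine Finset.prod_congr rfl fun s hs => by simp [hs]
  · intro s _ hs
    have : (N s.1 : ℝ) ≠ 0 := by exact_mod_cast (hN s.1).ne'
    simp [hs, this]

lemma avgSel_const (hN : ∀ p, 0 < N p) (c : ℝ) : avgSel (T := T) N (fun _ => c) = c := by
  have h := avgSel_prod_subset (T := T) hN ∅ fun _ _ => 0
  have h2 := avgSel_mul_const (T := T) (N := N) c fun _ => 1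
  simp only [Finset.prod_empty, one_mul] at h h2
  rw [h2, h, one_mul]

lemma avgSel_apply (hN : ∀ p, 0 < N p) (g : ∀ s : Slot T, Fin (N s.1) → ℝ) (s : Slot T) :
    avgSel N (fun J => g s (J s)) = (N s.1 : ℝ)⁻¹ * ∑ j, g s j := by
  simpa using avgSel_prod_subset hN {s} g

lemma avgSel_apply_mul_apply (hN : ∀ p, 0 < N p) (g : ∀ s : Slot T, Fin (N s.1) → ℝ)
    {s s' : Slot T} (h : s ≠ s') :
    avgSel N (fun J => g s (J s) * g s' (J s')) =
      ((N s.1 : ℝ)⁻¹ * ∑ j, g s j) * ((N s'.1 : ℝ)⁻¹ * ∑ j, g s' j) := by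
  simpa [Finset.prod_pair h] using avgSel_prod_subset hN {s, s'} g

lemma avgSel_mul_sq_le (φ ψ : (∀ s : Slot T, Fin (N s.1)) → ℝ) :
    avgSel N (fun J => φ J * ψ J) ^ 2 ≤
      avgSel N (fun J => φ J ^ 2) * avgSel N (fun J => ψ J ^ 2) := by
  unfold avgSel
  have h := Finset.sum_mul_sq_le_sq_mul_sq Finset.univ φ ψ
  calc _ = ((∏ s : Slot T, (N s.1 : ℝ))⁻¹) ^ 2 * (∑ J, φ J * ψ J) ^ 2 := by ring
    _ ≤ ((∏ s : Slot T, (N s.1 : ℝ))⁻¹) ^ 2 * ((∑ J, φ J ^ 2) * ∑ J, ψ J ^ 2) := by gcongr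
    _ = _ := by ring

/-- For centred perturbations `b` of the uniform weights, the remainder of the first-order
expansion of `∏ (1 + b)` has an explicit mean square, because the slots are independent under
the uniform distribution on index arrays. -/
lemma avgSel_sq_prod_sub (hN : ∀ p, 0 < N p) (b : ∀ p, Fin (N p) → ℝ) (hb : ∀ p, ∑ j, b p j = 0) :
    avgSel N (fun J => (∏ s : Slot T, (1 + b s.1 (J s)) - 1 - ∑ s : Slot T, b s.1 (J s)) ^ 2) =
      ∏ s : Slot T, (1 + (N s.1 : ℝ)⁻¹ * ∑ j, b s.1 j ^ 2) - 1 -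
        ∑ s : Slot T, (N s.1 : ℝ)⁻¹ * ∑ j, b s.1 j ^ 2 := by
  have hN' : ∀ p, (N p : ℝ) ≠ 0 := fun p => by exact_mod_cast (hN p).ne'
  have h1 : avgSel N (fun J => ∏ s : Slot T, (1 + b s.1 (J s)) ^ 2) =
      ∏ s : Slot T, (1 + (N s.1 : ℝ)⁻¹ * ∑ j, b s.1 j ^ 2) := by
    rw [avgSel_prod fun s j => (1 + b s.1 j) ^ 2]
    refine Finset.prod_congr rfl fun s _ => ?_
    have : ∀ j, (1 + b s.1 j) ^ 2 = 1 + 2 * b s.1 j + b s.1 j ^ 2 := fun j => by ring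
    simp only [this, Finset.sum_add_distrib, ← Finset.mul_sum, hb, Finset.sum_const]
    simp [mul_add, hN']
  have h2 : avgSel N (fun J => ∏ s : Slot T, (1 + b s.1 (J s))) = 1 := by
    rw [avgSel_prod fun s j => (1 + b s.1 j)]
    refine Finset.prod_eq_one fun s _ => ?_
    simp [Finset.sum_add_distrib, hb, hN']
  -- every factor other than the one of `s` averages to one
  have h3 : ∀ s : Slot T, avgSel N (fun J => (∏ s : Slot T, (1 + b s.1 (J s))) * b s.1 (J s)) =
      (N s.1 : ℝ)⁻¹ * ∑ j, b s.1 j ^ 2 := by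
    intro s
    have e : ∀ J : ∀ s : Slot T, Fin (N s.1),
        (∏ s : Slot T, (1 + b s.1 (J s))) * b s.1 (J s) =
        ∏ s' : Slot T, (fun (s' : Slot T) j =>
          (1 + b s'.1 j) * if s' = s then b s'.1 j else 1) s' (J s') := by
      intro J
      simp only [Finset.prod_mul_distrib]
      simp
    rw [funext e, avgSel_prod fun (s' : Slot T) j => (1 + b s'.1 j) * if s' = s then b s'.1 j else 1]
    rw [Finset.prod_eq_single s]
    · simp [add_mul, Finset.sum_add_distrib, hb, sq]
    · intro s' _ hs'
      simp [hs', Finset.sum_add_distrib, hb, hN']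
    · simp
  have h4 : ∀ s s' : Slot T, avgSel N (fun J => b s.1 (J s) * b s'.1 (J s')) =
      if s = s' then (N s.1 : ℝ)⁻¹ * ∑ j, b s.1 j ^ 2 else 0 := by
    intro s s'
    split_ifs with h
    · subst h
      simp only [← sq]
      exact avgSel_apply hN (fun s j => b s.1 j ^ 2) s
    · rw [avgSel_apply_mul_apply hN (fun s j => b s.1 j) h]
      simp [hb]
  have h5 : ∀ s : Slot T, avgSel N (fun J => b s.1 (J s)) = 0 := fun s => by
    rw [avgSel_apply hN (fun s j => b s.1 j) s]; simp [hb]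
  have e : ∀ J : ∀ s : Slot T, Fin (N s.1),
      (∏ s : Slot T, (1 + b s.1 (J s)) - 1 - ∑ s : Slot T, b s.1 (J s)) ^ 2 =
      (((∏ s : Slot T, (1 + b s.1 (J s)) ^ 2) - 2 * (∏ s : Slot T, (1 + b s.1 (J s)))
        - 2 * ∑ s, (∏ s : Slot T, (1 + b s.1 (J s))) * b s.1 (J s)) + 1
        + 2 * ∑ s : Slot T, b s.1 (J s)) + ∑ s : Slot T, ∑ s' : Slot T,
          b s.1 (J s) * b s'.1 (J s') := by
    intro J
    rw [← Finset.mul_sum, Finset.prod_pow, ← Finset.sum_mul_sum]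
    ring
  simp only [e]
  rw [avgSel_add, avgSel_add, avgSel_add, avgSel_sub, avgSel_sub, avgSel_const_mul,
    avgSel_const_mul, avgSel_const_mul, avgSel_sum, avgSel_sum, avgSel_sum, h1, h2,
    avgSel_const hN]
  simp only [avgSel_sum, h3, h4, h5]
  simp
  ring

/-- The V-statistic with kernel `φ`: the average of `φ` over all arrays of data points. -/
noncomputable def vstat (φ : Inputs S T → ℝ) (x : Inputs S N) : ℝ :=
  avgSel N fun J => φ (sel J x)

/-- The first-order term of the expansion of the performance measure in the relative
perturbations `b` of the uniform weights. -/
noncomputable def linPart (φ : Inputs S T → ℝ) (x : Inputs S N) (b : ∀ p, Fin (N p) → ℝ) : ℝ :=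
  avgSel N fun J => φ (sel J x) * ∑ s, b s.1 (J s)

lemma vstat_sq_nonneg (φ : Inputs S T → ℝ) (x : Inputs S N) :
    0 ≤ vstat (fun z => φ z ^ 2) x :=
  avgSel_nonneg fun _ => sq_nonneg _

/-- The remainder of the linear expansion of the performance measure in the weights is of second
order, uniformly over weights with `∑ b² ≤ C`. -/
lemma sq_avgSel_sub_linPart_le (hN : ∀ p, 0 < N p) (φ : Inputs S T → ℝ) (x : Inputs S N)
    (b : ∀ p, Fin (N p) → ℝ) (hb : ∀ p, ∑ j, b p j = 0) {C M : ℝ} (hM : 0 < M)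
    (hMN : ∀ p, M ≤ N p) (hC : ∀ p, ∑ j, b p j ^ 2 ≤ C)
    (hsmall : Fintype.card (Slot T) * (C / M) ≤ 1) :
    (avgSel N (fun J => φ (sel J x) * ∏ s : Slot T, (1 + b s.1 (J s))) - vstat φ x -
        linPart φ x b) ^ 2 ≤
      vstat (fun z => φ z ^ 2) x * (Fintype.card (Slot T) * (C / M)) ^ 2 := by
  have e : avgSel N (fun J => φ (sel J x) * ∏ s : Slot T, (1 + b s.1 (J s))) - vstat φ x -
      linPart φ x b = avgSel N fun J => φ (sel J x) *
        (∏ s : Slot T, (1 + b s.1 (J s)) - 1 - ∑ s : Slot T, b s.1 (J s)) := by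
    rw [vstat, linPart, ← avgSel_sub, ← avgSel_sub]
    congr 1
    funext J
    ring
  rw [e]
  refine (avgSel_mul_sq_le _ _).trans ?_
  refine mul_le_mul_of_nonneg_left ?_ (vstat_sq_nonneg φ x)
  rw [avgSel_sq_prod_sub hN b hb]
  set y := ∑ s : Slot T, (N s.1 : ℝ)⁻¹ * ∑ j, b s.1 j ^ 2 with hy
  have hterm : ∀ s : Slot T, 0 ≤ (N s.1 : ℝ)⁻¹ * ∑ j, b s.1 j ^ 2 := fun s =>
    mul_nonneg (by positivity) (Finset.sum_nonneg fun _ _ => sq_nonneg _)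
  have hy0 : 0 ≤ y := Finset.sum_nonneg fun s _ => hterm s
  have hyC : y ≤ Fintype.card (Slot T) * (C / M) := by
    have : ∀ s ∈ (Finset.univ : Finset (Slot T)), (N s.1 : ℝ)⁻¹ * ∑ j, b s.1 j ^ 2 ≤ C / M := by
      intro s _
      rw [inv_mul_eq_div]
      have h1 := hC s.1
      have h0 : 0 ≤ ∑ j, b s.1 j ^ 2 := Finset.sum_nonneg fun _ _ => sq_nonneg _
      gcongr
      · linarith
      · exact hMN _
    simpa using Finset.sum_le_sum this
  have hprod : ∏ s : Slot T, (1 + (N s.1 : ℝ)⁻¹ * ∑ j, b s.1 j ^ 2) ≤ Real.exp y := by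
    rw [hy, Real.exp_sum]
    refine Finset.prod_le_prod (fun s _ => by have := hterm s; linarith) fun s _ => ?_
    rw [add_comm]
    exact Real.add_one_le_exp _
  -- the product is at most `exp y`, and `exp y - 1 - y ≤ y²` for `0 ≤ y ≤ 1`
  have hexp := Real.abs_exp_sub_one_sub_id_le (x := y) (by rw [abs_of_nonneg hy0]; linarith)
  have h2 := le_abs_self (Real.exp y - 1 - y)
  have h3 : y ^ 2 ≤ (Fintype.card (Slot T) * (C / M)) ^ 2 := by gcongr
  linarith

end Averages

/-! ### Partial integration of square integrable functions -/

lemma integral_comp_measurePreserving {α β : Type*} [MeasurableSpace α] [MeasurableSpace β]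
    {μ : Measure α} {ν : Measure β} {f : α → β} (hf : MeasurePreserving f μ ν) {g : β → ℝ}
    (hg : Measurable g) : ∫ a, g (f a) ∂μ = ∫ b, g b ∂ν := by
  rw [← hf.map_eq, integral_map hf.measurable.aemeasurable hg.aestronglyMeasurable]

section Jensen

variable {α β : Type*} [MeasurableSpace α] [MeasurableSpace β] {μ : Measure α} {ν : Measure β}
  [IsProbabilityMeasure μ] [IsProbabilityMeasure ν]

lemma sq_integral_le_integral_sq {f : α → ℝ} (hf : MemLp f 2 μ) :
    (∫ a, f a ∂μ) ^ 2 ≤ ∫ a, f a ^ 2 ∂μ := by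
  have h := variance_nonneg f μ
  rw [variance_eq_sub hf] at h
  simp only [Pi.pow_apply] at h
  linarith

lemma ae_memLp_two_slice {f : α × β → ℝ} (hm : Measurable f) (hf : MemLp f 2 (μ.prod ν)) :
    ∀ᵐ a ∂μ, MemLp (fun b => f (a, b)) 2 ν := by
  filter_upwards [hf.integrable_sq.prod_right_ae] with a ha
  exact (memLp_two_iff_integrable_sq
    (hm.comp measurable_prodMk_left).aestronglyMeasurable).2 ha

lemma memLp_two_integral {f : α × β → ℝ} (hm : Measurable f) (hf : MemLp f 2 (μ.prod ν)) :
    MemLp (fun a => ∫ b, f (a, b) ∂ν) 2 μ := by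
  have hm' : StronglyMeasurable fun a => ∫ b, f (a, b) ∂ν :=
    hm.stronglyMeasurable.integral_prod_right'
  refine (memLp_two_iff_integrable_sq hm'.aestronglyMeasurable).2 ?_
  refine hf.integrable_sq.integral_prod_left.mono' (hm'.pow 2).aestronglyMeasurable ?_
  filter_upwards [ae_memLp_two_slice hm hf] with a ha
  simpa using sq_integral_le_integral_sq ha

lemma memLp_two_sq_integral {f : α × β → ℝ} (hm : Measurable f)
    (hf : MemLp (fun q => f q ^ 2) 2 (μ.prod ν)) :
    MemLp (fun a => (∫ b, f (a, b) ∂ν) ^ 2) 2 μ := by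
  have hm' : StronglyMeasurable fun a => ∫ b, f (a, b) ∂ν :=
    hm.stronglyMeasurable.integral_prod_right'
  have h2 : MemLp f 2 (μ.prod ν) :=
    (memLp_two_iff_integrable_sq hm.aestronglyMeasurable).2 (hf.integrable one_le_two)
  refine (memLp_two_integral (hm.pow_const 2) hf).mono (hm'.pow 2).aestronglyMeasurable ?_
  filter_upwards [ae_memLp_two_slice hm h2] with a ha
  have h3 := sq_integral_le_integral_sq ha
  simp only [norm_pow, Real.norm_eq_abs, sq_abs]
  exact h3.trans (le_abs_self _)

end Jensen

/-! ### First-order projections and degenerate V-statistics -/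

section VStatistics

variable {m : ℕ} {S : Fin m → Type*} [∀ p, MeasurableSpace (S p)]
  (F : ∀ p, Measure (S p)) [∀ p, IsProbabilityMeasure (F p)] {T N : Fin m → ℕ}

/-- The kernel `φ` is square integrable also when some of the inputs are reused. A V-statistic
averages over index arrays with repetitions, so that these moments are needed as well. -/
structure ReuseMemLp (φ : Inputs S T → ℝ) : Prop where
  measurable : Measurable φ
  memLp : ∀ I : ∀ p, Fin (T p) → Fin (T p),
    MemLp (fun z => φ fun p t => z p (I p t)) 2 (inputLaw F T)

/-- The first-order (Hájek) projection of `φ` on the input in slot `s`. -/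
noncomputable def slotProj (φ : Inputs S T → ℝ) (s : Slot T) (ξ : S s.1) : ℝ :=
  ∫ z, φ (updateSlot z s ξ) ∂(inputLaw F T) - ∫ z, φ z ∂(inputLaw F T)

variable {F} {φ ψ : Inputs S T → ℝ}

lemma measurable_reuse (I : ∀ p, Fin (T p) → Fin (T p)) :
    Measurable fun (z : Inputs S T) p t => z p (I p t) := by fun_prop

lemma ReuseMemLp.memLp_self (h : ReuseMemLp F φ) : MemLp φ 2 (inputLaw F T) :=
  h.memLp fun _ => id

lemma ReuseMemLp.memLp_sel (h : ReuseMemLp F φ) (J : ∀ s : Slot T, Fin (N s.1)) :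
    MemLp (fun x => φ (sel J x)) 2 (inputLaw F N) := by
  obtain ⟨I, hI⟩ := exists_map_sel_eq F J
  have h1 : MemLp φ 2 ((inputLaw F N).map (sel J)) := by
    rw [hI]
    exact (memLp_map_measure_iff h.measurable.aestronglyMeasurable
      (measurable_reuse I).aemeasurable).2 (h.memLp I)
  exact (memLp_map_measure_iff h.measurable.aestronglyMeasurable
      (measurable_sel J).aemeasurable).1 h1

lemma ReuseMemLp.exists_integral_sq_le (h : ReuseMemLp F φ) :
    ∃ C : ℝ, 0 ≤ C ∧ ∀ (N : Fin m → ℕ) (J : ∀ s : Slot T, Fin (N s.1)),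
      ∫ x, φ (sel J x) ^ 2 ∂(inputLaw F N) ≤ C := by
  have h0 : ∀ I : ∀ p, Fin (T p) → Fin (T p),
      0 ≤ ∫ z, φ (fun p t => z p (I p t)) ^ 2 ∂(inputLaw F T) :=
    fun I => integral_nonneg fun z => sq_nonneg _
  refine ⟨∑ I : ∀ p, Fin (T p) → Fin (T p), ∫ z, φ (fun p t => z p (I p t)) ^ 2 ∂(inputLaw F T),
    Finset.sum_nonneg fun I _ => h0 I, fun N J => ?_⟩
  obtain ⟨I, hI⟩ := exists_map_sel_eq F J
  have e1 := integral_map (μ := inputLaw F N) (measurable_sel J).aemeasurable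
    (f := fun z => φ z ^ 2) (h.measurable.pow_const 2).aestronglyMeasurable
  have e2 := integral_map (μ := inputLaw F T) (measurable_reuse I).aemeasurable
    (f := fun z => φ z ^ 2) (h.measurable.pow_const 2).aestronglyMeasurable
  rw [← e1, hI, e2]
  exact Finset.single_le_sum
    (f := fun I => ∫ z, φ (fun p t => z p (I p t)) ^ 2 ∂(inputLaw F T))
    (fun I _ => h0 I) (Finset.mem_univ I)

lemma ReuseMemLp.sub (h : ReuseMemLp F φ) (h' : ReuseMemLp F ψ) :
    ReuseMemLp F fun z => φ z - ψ z :=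
  ⟨h.measurable.sub h'.measurable, fun I => (h.memLp I).sub (h'.memLp I)⟩

lemma reuseMemLp_const (c : ℝ) : ReuseMemLp (T := T) F fun _ => c :=
  ⟨measurable_const, fun _ => memLp_const c⟩

lemma reuseMemLp_eval {s : Slot T} {g : S s.1 → ℝ} (hg : Measurable g) (hg2 : MemLp g 2 (F s.1)) :
    ReuseMemLp (T := T) F fun z => g (z s.1 s.2) :=
  ⟨by fun_prop, fun I => hg2.comp_measurePreserving
    (measurePreserving_eval_inputLaw F (⟨s.1, I s.1 s.2⟩ : Slot T))⟩

lemma ReuseMemLp.sum {ι : Type*} (t : Finset ι) {φ : ι → Inputs S T → ℝ}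
    (h : ∀ i ∈ t, ReuseMemLp F (φ i)) : ReuseMemLp F fun z => ∑ i ∈ t, φ i z :=
  ⟨Finset.measurable_fun_sum _ fun i hi => (h i hi).measurable,
    fun I => memLp_finsetSum _ fun i hi => (h i hi).memLp I⟩

lemma memLp_comp_updateSlot (h : MemLp φ 2 (inputLaw F T)) (s : Slot T) :
    MemLp (fun q : S s.1 × Inputs S T => φ (updateSlot q.2 s q.1)) 2
      ((F s.1).prod (inputLaw F T)) :=
  h.comp_measurePreserving (measurePreserving_updateSlot F s)

lemma measurable_slotProj (h : Measurable φ) (s : Slot T) : Measurable (slotProj F φ s) :=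
  (StronglyMeasurable.integral_prod_right'
    (h.comp (measurable_updateSlot s)).stronglyMeasurable).measurable.sub_const _

lemma memLp_slotProj (hm : Measurable φ) (h : MemLp φ 2 (inputLaw F T)) (s : Slot T) :
    MemLp (slotProj F φ s) 2 (F s.1) :=
  (memLp_two_integral (hm.comp (measurable_updateSlot s)) (memLp_comp_updateSlot h s)).sub
    (memLp_const _)

lemma integral_comp_updateSlot (hm : Measurable φ) (h : Integrable φ (inputLaw F T))
    (s : Slot T) :
    ∫ ξ, ∫ z, φ (updateSlot z s ξ) ∂(inputLaw F T) ∂(F s.1) = ∫ z, φ z ∂(inputLaw F T) := by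
  have hp := measurePreserving_updateSlot F s
  rw [← integral_comp_measurePreserving hp hm]
  exact (integral_prod _ (hp.integrable_comp_of_integrable h)).symm

lemma integral_slotProj (hm : Measurable φ) (h : MemLp φ 2 (inputLaw F T)) (s : Slot T) :
    ∫ ξ, slotProj F φ s ξ ∂(F s.1) = 0 := by
  unfold slotProj
  rw [integral_sub, integral_comp_updateSlot hm (h.integrable one_le_two)]
  · simp
  · exact (memLp_two_integral (hm.comp (measurable_updateSlot s))
      (memLp_comp_updateSlot h s)).integrable one_le_two
  · exact integrable_const _

/-- If the conditional mean of `φ` given any single input vanishes, then the values of `φ` at two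
arrays of data points that overlap in at most one point of the second array are uncorrelated. -/
lemma integral_sel_mul_sel_eq_zero (h : ReuseMemLp F φ)
    (hdeg : ∀ s : Slot T, ∀ᵐ ξ ∂(F s.1), ∫ z, φ (updateSlot z s ξ) ∂(inputLaw F T) = 0)
    {J J' : ∀ s : Slot T, Fin (N s.1)} (hJ' : Function.Injective (target J')) (b : Slot T)
    (hb : ∀ s, s ≠ b → ∀ a, target J a ≠ target J' s) :
    ∫ x, φ (sel J x) * φ (sel J' x) ∂(inputLaw F N) = 0 := by
  classical
  -- redraw all data points of the second array except the shared one
  let A : Slot N → Prop := fun i => ∀ s, s ≠ b → target J' s ≠ i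
  have hp := measurePreserving_mix_inputLaw F A
  have hint : Integrable (fun x => φ (sel J x) * φ (sel J' x)) (inputLaw F N) :=
    (h.memLp_sel J).integrable_mul (h.memLp_sel J')
  have hmeas : Measurable fun x : Inputs S N => φ (sel J x) * φ (sel J' x) :=
    (h.measurable.comp (measurable_sel J)).mul (h.measurable.comp (measurable_sel J'))
  rw [← integral_comp_measurePreserving hp hmeas]
  refine (integral_prod _ (hp.integrable_comp_of_integrable hint)).trans ?_
  simp only [Function.comp]
  have e1 : ∀ x y : Inputs S N, sel J (fun p j => if A ⟨p, j⟩ then x p j else y p j) =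
      sel J x := by
    intro x y
    funext p t
    have : A ⟨p, J ⟨p, t⟩⟩ := fun s hs he => hb s hs ⟨p, t⟩ he.symm
    simp only [sel, if_pos this]
  have e2 : ∀ x y : Inputs S N, sel J' (fun p j => if A ⟨p, j⟩ then x p j else y p j) =
      updateSlot (sel J' y) b (x b.1 (J' b)) := by
    intro x y
    funext p t
    by_cases hs : (⟨p, t⟩ : Slot T) = b
    · subst hs
      rw [updateSlot_apply_self]
      have : A ⟨p, J' ⟨p, t⟩⟩ := fun s hs he => hs (hJ' he)
      simp only [sel, if_pos this]
    · rw [updateSlot_apply_of_ne _ _ hs]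
      have : ¬ A ⟨p, J' ⟨p, t⟩⟩ := fun hA => hA ⟨p, t⟩ hs rfl
      simp only [sel, if_neg this]
  simp only [e1, e2, integral_const_mul]
  refine integral_eq_zero_of_ae ?_
  have hb' := (measurePreserving_eval_inputLaw F (⟨b.1, J' b⟩ : Slot N)).quasiMeasurePreserving.ae
    (hdeg b)
  filter_upwards [hb'] with x hx
  have hs := measurePreserving_sel F hJ'
  have e3 : ∫ y, φ (updateSlot (sel J' y) b (x b.1 (J' b))) ∂(inputLaw F N) =
      ∫ z, φ (updateSlot z b (x b.1 (J' b))) ∂(inputLaw F T) := by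
    refine integral_comp_measurePreserving hs (g := fun z => φ (updateSlot z b (x b.1 (J' b)))) ?_
    exact h.measurable.comp ((measurable_updateSlot b).comp measurable_prodMk_left)
  rw [e3, hx]
  simp

lemma avgSel_target_eq_le {M : ℝ} (hM : 0 < M) (hMN : ∀ p, M ≤ N p) (hN : ∀ p, 0 < N p)
    {a a' : Slot T} (h : a ≠ a') [DecidableEq (Slot N)] :
    avgSel N (fun J => if target J a = target J a' then (1 : ℝ) else 0) ≤ 1 / M := by
  let g : Fin (N a.1) → ∀ s : Slot T, Fin (N s.1) → ℝ := fun i s j =>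
    if (⟨s.1, j⟩ : Slot N) = ⟨a.1, i⟩ then 1 else 0
  have hg1 : ∀ i s, ∑ j, g i s j ≤ 1 := by
    intro i s
    rw [Finset.sum_boole]
    have : (Finset.univ.filter fun j : Fin (N s.1) => (⟨s.1, j⟩ : Slot N) = ⟨a.1, i⟩).card ≤ 1 := by
      refine Finset.card_le_one.2 fun j hj j' hj' => ?_
      have h1 := (Finset.mem_filter.1 hj).2.trans (Finset.mem_filter.1 hj').2.symm
      exact eq_of_heq (Sigma.mk.inj_iff.1 h1).2
    exact_mod_cast this
  have e : ∀ J : ∀ s : Slot T, Fin (N s.1), (if target J a = target J a' then (1 : ℝ) else 0) =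
      ∑ i, g i a (J a) * g i a' (J a') := by
    intro J
    have e0 : ∀ i, g i a (J a) = if i = J a then 1 else 0 := fun i => by
      simp only [g, Sigma.mk.inj_iff, heq_eq_eq, true_and, eq_comm]
    simp only [e0, ite_mul, one_mul, zero_mul, Finset.sum_ite_eq', Finset.mem_univ, if_true]
    exact if_congr eq_comm rfl rfl
  simp only [e]
  rw [avgSel_sum]
  have hterm : ∀ i ∈ (Finset.univ : Finset (Fin (N a.1))),
      avgSel N (fun J => g i a (J a) * g i a' (J a')) ≤ (N a.1 : ℝ)⁻¹ * (1 / M) := by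
    intro i _
    rw [avgSel_apply_mul_apply hN (g i) h]
    have hn : (0 : ℝ) < N a.1 := by exact_mod_cast hN _
    have h0 : ∀ s, 0 ≤ ∑ j, g i s j := fun s =>
      Finset.sum_nonneg fun j _ => by simp only [g]; split_ifs <;> norm_num
    have h1 : (N a.1 : ℝ)⁻¹ * ∑ j, g i a j ≤ (N a.1 : ℝ)⁻¹ :=
      mul_le_of_le_one_right (by positivity) (hg1 i a)
    have h2 : (N a'.1 : ℝ)⁻¹ * ∑ j, g i a' j ≤ 1 / M := by
      have := hMN a'.1
      calc (N a'.1 : ℝ)⁻¹ * ∑ j, g i a' j ≤ (N a'.1 : ℝ)⁻¹ :=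
            mul_le_of_le_one_right (by positivity) (hg1 i a')
        _ ≤ M⁻¹ := by gcongr
        _ = 1 / M := by simp
    exact mul_le_mul h1 h2 (mul_nonneg (by positivity) (h0 _)) (by positivity)
  refine (Finset.sum_le_sum hterm).trans (le_of_eq ?_)
  have hn : (N a.1 : ℝ) ≠ 0 := by exact_mod_cast (hN _).ne'
  simp [hn]

/-- Most index arrays have no repetitions. -/
lemma avgSel_not_injective_le {M : ℝ} (hM : 0 < M) (hMN : ∀ p, M ≤ N p) (hN : ∀ p, 0 < N p)
    [∀ J : ∀ s : Slot T, Fin (N s.1), Decidable (Function.Injective (target J))] :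
    avgSel N (fun J : ∀ s : Slot T, Fin (N s.1) =>
      if Function.Injective (target J) then (0 : ℝ) else 1) ≤
      Fintype.card (Slot T) ^ 2 / M := by
  classical
  have h1 : ∀ J : ∀ s : Slot T, Fin (N s.1),
      (if Function.Injective (target J) then (0 : ℝ) else 1) ≤ ∑ a : Slot T, ∑ a' : Slot T,
        if a = a' then 0 else if target J a = target J a' then (1 : ℝ) else 0 := by
    intro J
    have h0 : ∀ a a' : Slot T,
        0 ≤ if a = a' then 0 else if target J a = target J a' then (1 : ℝ) else 0 := by
      intro a a'; split_ifs <;> norm_num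
    split_ifs with hJ
    · exact Finset.sum_nonneg fun a _ => Finset.sum_nonneg fun a' _ => h0 a a'
    · simp only [Function.Injective] at hJ
      push Not at hJ
      obtain ⟨a, a', he, hne⟩ := hJ
      have h2 := Finset.single_le_sum (fun a' _ => h0 a a') (Finset.mem_univ a')
      have h3 := Finset.single_le_sum
        (f := fun a => ∑ a' : Slot T, if a = a' then 0 else
          if target J a = target J a' then (1 : ℝ) else 0)
        (fun a _ => Finset.sum_nonneg fun a' _ => h0 a a') (Finset.mem_univ a)
      rw [if_neg hne, if_pos he] at h2
      exact h2.trans h3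
  refine (avgSel_mono h1).trans ?_
  simp only [avgSel_sum]
  have h2 : ∀ a ∈ (Finset.univ : Finset (Slot T)), ∀ a' ∈ (Finset.univ : Finset (Slot T)),
      avgSel N (fun J => if a = a' then 0 else if target J a = target J a' then (1 : ℝ) else 0) ≤
        1 / M := by
    intro a _ a' _
    by_cases h : a = a'
    · simp only [h, if_true, avgSel_const hN]
      positivity
    · simp only [h, if_false]
      exact avgSel_target_eq_le hM hMN hN h
  refine (Finset.sum_le_sum fun a ha => Finset.sum_le_sum (h2 a ha)).trans (le_of_eq ?_)
  simp
  ring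

/-- Two independent index arrays rarely have two points in common. -/
lemma avgSel_overlap_le {M : ℝ} (hM : 0 < M) (hMN : ∀ p, M ≤ N p) (hN : ∀ p, 0 < N p)
    (J : ∀ s : Slot T, Fin (N s.1))
    [DecidablePred fun J' : ∀ s : Slot T, Fin (N s.1) =>
      ∃ b, ∀ s, s ≠ b → ∀ a, target J a ≠ target J' s] [Nonempty (Slot T)] :
    avgSel N (fun J' : ∀ s : Slot T, Fin (N s.1) =>
      if ∃ b, ∀ s, s ≠ b → ∀ a, target J a ≠ target J' s then (0 : ℝ) else 1) ≤
      Fintype.card (Slot T) ^ 4 / M ^ 2 := by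
  classical
  let g : ∀ s : Slot T, Fin (N s.1) → ℝ := fun s j =>
    ∑ a : Slot T, if target J a = ⟨s.1, j⟩ then (1 : ℝ) else 0
  have hg0 : ∀ s j, 0 ≤ g s j := fun s j =>
    Finset.sum_nonneg fun a _ => by split_ifs <;> norm_num
  have hg1 : ∀ (J' : ∀ s : Slot T, Fin (N s.1)) (s a : Slot T), target J a = target J' s →
      1 ≤ g s (J' s) := by
    intro J' s a h
    have h0 := Finset.single_le_sum (s := Finset.univ)
      (f := fun a : Slot T => if target J a = ⟨s.1, J' s⟩ then (1 : ℝ) else 0)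
      (fun a _ => by split_ifs <;> norm_num) (Finset.mem_univ a)
    rw [if_pos (show target J a = ⟨s.1, J' s⟩ from h)] at h0
    exact h0
  have hgsum : ∀ s, ∑ j, g s j ≤ Fintype.card (Slot T) := by
    intro s
    simp only [g]
    rw [Finset.sum_comm]
    have : ∀ a ∈ (Finset.univ : Finset (Slot T)),
        ∑ j, (if target J a = (⟨s.1, j⟩ : Slot N) then (1 : ℝ) else 0) ≤ 1 := by
      intro a _
      rw [Finset.sum_boole]
      have : (Finset.univ.filter fun j : Fin (N s.1) => target J a = ⟨s.1, j⟩).card ≤ 1 := by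
        refine Finset.card_le_one.2 fun j hj j' hj' => ?_
        have h1 := (Finset.mem_filter.1 hj).2.symm.trans (Finset.mem_filter.1 hj').2
        exact eq_of_heq (Sigma.mk.inj_iff.1 h1).2
      exact_mod_cast this
    simpa using Finset.sum_le_sum this
  have h1 : ∀ J' : ∀ s : Slot T, Fin (N s.1),
      (if ∃ b, ∀ s, s ≠ b → ∀ a, target J a ≠ target J' s then (0 : ℝ) else 1) ≤
      ∑ s : Slot T, ∑ s' : Slot T, if s = s' then 0 else g s (J' s) * g s' (J' s') := by
    intro J'
    have h0 : ∀ s s' : Slot T, 0 ≤ if s = s' then 0 else g s (J' s) * g s' (J' s') := by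
      intro s s'
      split_ifs
      · exact le_rfl
      · exact mul_nonneg (hg0 _ _) (hg0 _ _)
    split_ifs with hJ
    · exact Finset.sum_nonneg fun a _ => Finset.sum_nonneg fun a' _ => h0 a a'
    · push Not at hJ
      obtain ⟨s, -, a, ha⟩ := hJ (Classical.arbitrary _)
      obtain ⟨s', hne, a', ha'⟩ := hJ s
      have h2 := Finset.single_le_sum (fun s' _ => h0 s s') (Finset.mem_univ s')
      have h3 := Finset.single_le_sum
        (f := fun s => ∑ s' : Slot T, if s = s' then 0 else g s (J' s) * g s' (J' s'))
        (fun a _ => Finset.sum_nonneg fun a' _ => h0 a a') (Finset.mem_univ s)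
      rw [if_neg hne.symm] at h2
      have h4 : 1 ≤ g s (J' s) * g s' (J' s') :=
        one_le_mul_of_one_le_of_one_le (hg1 J' s a ha) (hg1 J' s' a' ha')
      exact h4.trans (h2.trans h3)
  refine (avgSel_mono h1).trans ?_
  simp only [avgSel_sum]
  have hK : ∀ s : Slot T, (N s.1 : ℝ)⁻¹ * ∑ j, g s j ≤ Fintype.card (Slot T) / M := by
    intro s
    have h2 := hMN s.1
    have h3 : 0 ≤ ∑ j, g s j := Finset.sum_nonneg fun j _ => hg0 s j
    rw [inv_mul_eq_div]
    gcongr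
    exact hgsum s
  have h2 : ∀ s ∈ (Finset.univ : Finset (Slot T)), ∀ s' ∈ (Finset.univ : Finset (Slot T)),
      avgSel N (fun J' => if s = s' then 0 else g s (J' s) * g s' (J' s')) ≤
        (Fintype.card (Slot T) / M) ^ 2 := by
    intro s _ s' _
    by_cases h : s = s'
    · simp only [h, if_true, avgSel_const hN]
      positivity
    · simp only [h, if_false]
      rw [avgSel_apply_mul_apply hN g h, sq]
      exact mul_le_mul (hK s) (hK s')
        (mul_nonneg (by positivity) (Finset.sum_nonneg fun j _ => hg0 s' j)) (by positivity)
  refine (Finset.sum_le_sum fun a ha => Finset.sum_le_sum (h2 a ha)).trans (le_of_eq ?_)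
  simp
  ring

lemma integral_avgSel {f : (∀ s : Slot T, Fin (N s.1)) → Inputs S N → ℝ}
    (hf : ∀ J, Integrable (f J) (inputLaw F N)) :
    ∫ x, avgSel N (fun J => f J x) ∂(inputLaw F N) =
      avgSel N fun J => ∫ x, f J x ∂(inputLaw F N) := by
  unfold avgSel
  rw [integral_const_mul, integral_finsetSum _ fun J _ => hf J]

lemma memLp_avgSel {f : (∀ s : Slot T, Fin (N s.1)) → Inputs S N → ℝ}
    (hf : ∀ J, MemLp (f J) 2 (inputLaw F N)) :
    MemLp (fun x => avgSel N (fun J => f J x)) 2 (inputLaw F N) := by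
  unfold avgSel
  exact (memLp_finsetSum _ fun J _ => hf J).const_mul _

lemma integrable_avgSel {f : (∀ s : Slot T, Fin (N s.1)) → Inputs S N → ℝ}
    (hf : ∀ J, Integrable (f J) (inputLaw F N)) :
    Integrable (fun x => avgSel N (fun J => f J x)) (inputLaw F N) := by
  unfold avgSel
  exact (integrable_finsetSum _ fun J _ => hf J).const_mul _

/-- A V-statistic with a kernel whose first-order projections vanish is of second order: its mean
square is at most a constant times `M⁻²` if there are at least `M` data points per source. -/
theorem exists_integral_vstat_sq_le_of_degenerate [Nonempty (Slot T)] (h : ReuseMemLp F φ)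
    (hdeg : ∀ s : Slot T, ∀ᵐ ξ ∂(F s.1), ∫ z, φ (updateSlot z s ξ) ∂(inputLaw F T) = 0) :
    ∃ C : ℝ, 0 ≤ C ∧ ∀ (N : Fin m → ℕ), (∀ p, 0 < N p) → ∀ M : ℝ, 0 < M → (∀ p, M ≤ N p) →
      ∫ x, vstat φ x ^ 2 ∂(inputLaw F N) ≤ C / M ^ 2 := by
  classical
  obtain ⟨C, hC0, hC⟩ := h.exists_integral_sq_le
  let K : ℝ := ((Fintype.card (Slot T) : ℕ) : ℝ)
  refine ⟨4 * C * K ^ 4, by positivity, fun N hN M hM hMN => ?_⟩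
  -- split the average into index arrays without (`V1`) and with (`V2`) repetitions
  let a : (∀ s : Slot T, Fin (N s.1)) → ℝ := fun J => if Function.Injective (target J) then 0 else 1
  let c : (∀ s : Slot T, Fin (N s.1)) → ℝ := fun J => if Function.Injective (target J) then 1 else 0
  have hac : ∀ J, c J + a J = 1 := fun J => by simp only [a, c]; split_ifs <;> norm_num
  let V1 : Inputs S N → ℝ := fun x => avgSel N fun J => c J * φ (sel J x)
  let V2 : Inputs S N → ℝ := fun x => avgSel N fun J => a J * (a J * φ (sel J x))
  have hm := fun J => h.memLp_sel (N := N) J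
  have hV1 : MemLp V1 2 (inputLaw F N) := memLp_avgSel fun J => (hm J).const_mul _
  have hV2 : MemLp V2 2 (inputLaw F N) :=
    memLp_avgSel fun J => ((hm J).const_mul _).const_mul _
  have hV : ∀ x, vstat φ x = V1 x + V2 x := by
    intro x
    simp only [V1, V2, vstat]
    rw [← avgSel_add]
    congr 1
    funext J
    simp only [a, c]
    split_ifs <;> ring
  -- arrays with repetitions contribute little because they are rare
  have hb2 : ∫ x, V2 x ^ 2 ∂(inputLaw F N) ≤ C * K ^ 4 / M ^ 2 := by
    have hpa := avgSel_not_injective_le (T := T) hM hMN hN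
    have hpt : ∀ x, V2 x ^ 2 ≤ avgSel N (fun J => a J ^ 2) *
        avgSel N (fun J => (a J * φ (sel J x)) ^ 2) := fun x => avgSel_mul_sq_le _ _
    have ha2 : ∀ J, a J ^ 2 = a J := fun J => by simp only [a]; split_ifs <;> norm_num
    have hi : ∀ J, Integrable (fun x => (a J * φ (sel J x)) ^ 2) (inputLaw F N) := fun J =>
      ((hm J).const_mul _).integrable_sq
    calc ∫ x, V2 x ^ 2 ∂(inputLaw F N)
        ≤ ∫ x, avgSel N (fun J => a J ^ 2) *
          avgSel N (fun J => (a J * φ (sel J x)) ^ 2) ∂(inputLaw F N) :=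
          integral_mono hV2.integrable_sq ((integrable_avgSel hi).const_mul _) hpt
      _ = avgSel N a * avgSel N (fun J => ∫ x, (a J * φ (sel J x)) ^ 2 ∂(inputLaw F N)) := by
          rw [integral_const_mul, integral_avgSel hi]
          simp only [ha2]
      _ ≤ avgSel N a * (avgSel N a * C) := by
          refine mul_le_mul_of_nonneg_left ?_ (avgSel_nonneg fun J => by
            simp only [a]; split_ifs <;> norm_num)
          rw [← avgSel_mul_const]
          refine avgSel_mono fun J => ?_
          simp only [mul_pow, ha2, integral_const_mul]
          refine mul_le_mul_of_nonneg_left (hC N J) ?_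
          simp only [a]; split_ifs <;> norm_num
      _ ≤ K ^ 2 / M * (K ^ 2 / M * C) := by
          have h0 : 0 ≤ avgSel N a := avgSel_nonneg fun J => by
            simp only [a]; split_ifs <;> norm_num
          gcongr
      _ = C * K ^ 4 / M ^ 2 := by field_simp
  -- arrays without repetitions are uncorrelated unless they overlap in two points
  have hb1 : ∫ x, V1 x ^ 2 ∂(inputLaw F N) ≤ C * K ^ 4 / M ^ 2 := by
    have e : ∀ x, V1 x ^ 2 = avgSel N fun J => avgSel N fun J' =>
        c J * c J' * (φ (sel J x) * φ (sel J' x)) := by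
      intro x
      simp only [V1, sq]
      rw [← avgSel_mul_const]
      congr 1
      funext J
      rw [← avgSel_const_mul]
      congr 1
      funext J'
      ring
    have hi : ∀ J J', Integrable (fun x => c J * c J' * (φ (sel J x) * φ (sel J' x)))
        (inputLaw F N) := fun J J' => ((hm J).integrable_mul (hm J')).const_mul _
    simp only [e]
    rw [integral_avgSel fun J => integrable_avgSel fun J' => hi J J']
    have hJ : ∀ J, ∫ x, avgSel N (fun J' => c J * c J' * (φ (sel J x) * φ (sel J' x)))
        ∂(inputLaw F N) ≤ C * (K ^ 4 / M ^ 2) := by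
      intro J
      rw [integral_avgSel fun J' => hi J J']
      refine le_trans ?_ (mul_le_mul_of_nonneg_left (avgSel_overlap_le hM hMN hN J) hC0)
      rw [← avgSel_const_mul]
      refine avgSel_mono fun J' => ?_
      rw [integral_const_mul]
      by_cases hov : ∃ b, ∀ s, s ≠ b → ∀ a, target J a ≠ target J' s
      · rw [if_pos hov, mul_zero]
        by_cases hinj : Function.Injective (target J')
        · obtain ⟨b, hb⟩ := hov
          rw [integral_sel_mul_sel_eq_zero h hdeg hinj b hb, mul_zero]
        · simp [c, hinj]
      · rw [if_neg hov, mul_one]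
        have hcc : 0 ≤ c J * c J' ∧ c J * c J' ≤ 1 := by
          simp only [c]; split_ifs <;> norm_num
        have h2 : ∫ x, φ (sel J x) * φ (sel J' x) ∂(inputLaw F N) ≤ C := by
          calc ∫ x, φ (sel J x) * φ (sel J' x) ∂(inputLaw F N)
              ≤ ∫ x, (φ (sel J x) ^ 2 / 2 + φ (sel J' x) ^ 2 / 2) ∂(inputLaw F N) := by
                refine integral_mono ((hm J).integrable_mul (hm J'))
                  (((hm J).integrable_sq.div_const 2).add ((hm J').integrable_sq.div_const 2))
                  fun x => ?_
                have := sq_nonneg (φ (sel J x) - φ (sel J' x))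
                simp only
                linarith
            _ = (∫ x, φ (sel J x) ^ 2 ∂(inputLaw F N)) / 2 +
                (∫ x, φ (sel J' x) ^ 2 ∂(inputLaw F N)) / 2 := by
                rw [integral_add ((hm J).integrable_sq.div_const 2)
                  ((hm J').integrable_sq.div_const 2), integral_div, integral_div]
            _ ≤ C := by
                have h3 := hC N J
                have h4 := hC N J'
                linarith
        nlinarith [hcc.1, hcc.2]
    calc _ ≤ avgSel (T := T) N fun _ => C * (K ^ 4 / M ^ 2) := avgSel_mono hJ
      _ = C * K ^ 4 / M ^ 2 := by rw [avgSel_const hN]; ring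
  calc ∫ x, vstat φ x ^ 2 ∂(inputLaw F N)
      ≤ ∫ x, (2 * V1 x ^ 2 + 2 * V2 x ^ 2) ∂(inputLaw F N) := by
        have hVm : MemLp (fun x => vstat φ x) 2 (inputLaw F N) := memLp_avgSel hm
        refine integral_mono hVm.integrable_sq
          ((hV1.integrable_sq.const_mul 2).add (hV2.integrable_sq.const_mul 2)) fun x => ?_
        have := sq_nonneg (V1 x - V2 x)
        simp only [hV]
        linarith
    _ = 2 * ∫ x, V1 x ^ 2 ∂(inputLaw F N) + 2 * ∫ x, V2 x ^ 2 ∂(inputLaw F N) := by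
        rw [integral_add (hV1.integrable_sq.const_mul 2) (hV2.integrable_sq.const_mul 2),
          integral_const_mul, integral_const_mul]
    _ ≤ 4 * C * K ^ 4 / M ^ 2 := by
        have : 4 * C * K ^ 4 / M ^ 2 = 2 * (C * K ^ 4 / M ^ 2) + 2 * (C * K ^ 4 / M ^ 2) := by ring
        linarith

end VStatistics

/-! ### The Hájek projection of a V-statistic -/

section HajekProjection

variable {m : ℕ} {S : Fin m → Type*} [∀ p, MeasurableSpace (S p)]
  {F : ∀ p, Measure (S p)} [∀ p, IsProbabilityMeasure (F p)] {T : Fin m → ℕ}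
  {φ : Inputs S T → ℝ}

lemma reuseMemLp_slotProj_sum (h : ReuseMemLp F φ) :
    ReuseMemLp F fun z => φ z - (∫ z, φ z ∂(inputLaw F T)) -
      ∑ s : Slot T, slotProj F φ s (z s.1 s.2) :=
  (h.sub (reuseMemLp_const _)).sub (ReuseMemLp.sum _ fun s _ =>
    reuseMemLp_eval (measurable_slotProj h.measurable s)
      (memLp_slotProj h.measurable h.memLp_self s))

lemma vstat_sub_slotProj {N : Fin m → ℕ} (hN : ∀ p, 0 < N p) (c : ℝ)
    (g : ∀ s : Slot T, S s.1 → ℝ) (x : Inputs S N) :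
    vstat (fun z => φ z - c - ∑ s : Slot T, g s (z s.1 s.2)) x =
      vstat φ x - c - ∑ s : Slot T, (N s.1 : ℝ)⁻¹ * ∑ j, g s (x s.1 j) := by
  unfold vstat
  rw [avgSel_sub, avgSel_sub, avgSel_const hN, avgSel_sum]
  congr 1
  refine Finset.sum_congr rfl fun s _ => ?_
  exact avgSel_apply hN (fun s j => g s (x s.1 j)) s

/-- The Hájek projection approximates a V-statistic up to an error of second order. -/
theorem exists_integral_vstat_sub_proj_sq_le [Nonempty (Slot T)] (h : ReuseMemLp F φ) :
    ∃ C : ℝ, 0 ≤ C ∧ ∀ (N : Fin m → ℕ), (∀ p, 0 < N p) → ∀ M : ℝ, 0 < M → (∀ p, M ≤ N p) →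
      ∫ x, (vstat φ x - (∫ z, φ z ∂(inputLaw F T)) -
        ∑ s : Slot T, (N s.1 : ℝ)⁻¹ * ∑ j, slotProj F φ s (x s.1 j)) ^ 2 ∂(inputLaw F N) ≤
        C / M ^ 2 := by
  have h' := reuseMemLp_slotProj_sum h
  have hφ := h.memLp_self
  have hm := h.measurable
  obtain ⟨C, hC, hC'⟩ := exists_integral_vstat_sq_le_of_degenerate h' fun s => by
    filter_upwards [ae_memLp_two_slice (hm.comp (measurable_updateSlot s))
      (memLp_comp_updateSlot hφ s)] with ξ hξ
    have hi : ∀ s' : Slot T, Integrable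
        (fun z : Inputs S T => slotProj F φ s' (updateSlot z s ξ s'.1 s'.2)) (inputLaw F T) ∧
        ∫ z, slotProj F φ s' (updateSlot z s ξ s'.1 s'.2) ∂(inputLaw F T) =
          if s' = s then slotProj F φ s ξ else 0 := by
      intro s'
      by_cases hs : s' = s
      · subst hs
        simp [updateSlot_apply_self]
      · have e : ∀ z : Inputs S T, updateSlot z s ξ s'.1 s'.2 = z s'.1 s'.2 := fun z =>
          updateSlot_apply_of_ne z ξ hs
        simp only [e, if_neg hs]
        have hp := measurePreserving_eval_inputLaw (T := T) F s'
        have hL := memLp_slotProj hm hφ s'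
        refine ⟨(hL.comp_measurePreserving hp).integrable one_le_two, ?_⟩
        rw [integral_comp_measurePreserving hp (measurable_slotProj hm s'),
          integral_slotProj hm hφ s']
    have hξi : Integrable (fun z => φ (updateSlot z s ξ)) (inputLaw F T) :=
      hξ.integrable one_le_two
    have hξi' : Integrable (fun z => φ (updateSlot z s ξ) - ∫ z, φ z ∂(inputLaw F T))
        (inputLaw F T) := hξi.sub (integrable_const _)
    rw [integral_sub hξi' (integrable_finsetSum _ fun s' _ => (hi s').1),
      integral_sub hξi (integrable_const _), integral_finsetSum _ fun s' _ => (hi s').1]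
    simp only [(hi _).2]
    simp [slotProj]
  refine ⟨C, hC, fun N hN M hM hMN => ?_⟩
  have := hC' N hN M hM hMN
  simpa only [vstat_sub_slotProj hN] using this

lemma integral_sq_mean_inputLaw_le {N : Fin m → ℕ} {p : Fin m} (hN : 0 < N p) {g : S p → ℝ}
    (hm : Measurable g) (hg : MemLp g 2 (F p)) :
    ∫ x, ((N p : ℝ)⁻¹ * ∑ j, g (x p j) - ∫ ξ, g ξ ∂(F p)) ^ 2 ∂(inputLaw F N) ≤
      (∫ ξ, g ξ ^ 2 ∂(F p)) / N p := by
  have h := integral_sq_mean_sub_le (κ := Fin (N p)) (F p) hg (by simpa using hN)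
  simp only [Fintype.card_fin] at h
  refine le_trans (le_of_eq ?_) h
  have hp : MeasurePreserving (fun x : Inputs S N => x p) (inputLaw F N)
      (Measure.pi fun _ : Fin (N p) => F p) :=
    measurePreserving_eval (fun p => Measure.pi fun _ : Fin (N p) => F p) p
  exact integral_comp_measurePreserving hp
    (g := fun y => ((N p : ℝ)⁻¹ * ∑ j, g (y j) - ∫ ξ, g ξ ∂(F p)) ^ 2) (by fun_prop)

end HajekProjection

/-! ### Asymptotics of V-statistics -/

section VStatisticAsymptotics

variable {m : ℕ} {S : Fin m → Type*} [∀ p, MeasurableSpace (S p)]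
  {F : ∀ p, Measure (S p)} [∀ p, IsProbabilityMeasure (F p)] {T : Fin m → ℕ}
  {φ : Inputs S T → ℝ} {N : ℕ → Fin m → ℕ} {n : ℕ → ℝ} {c : ℝ}

lemma memLp_mean {N : Fin m → ℕ} {p : Fin m} {g : S p → ℝ} (hg : MemLp g 2 (F p)) :
    MemLp (fun x : Inputs S N => (N p : ℝ)⁻¹ * ∑ j, g (x p j)) 2 (inputLaw F N) :=
  (memLp_finsetSum _ fun j _ => hg.comp_measurePreserving
    (measurePreserving_eval_inputLaw F (⟨p, j⟩ : Slot N))).const_mul _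

/-- The weak law of large numbers for the data of one source. -/
lemma isSmallOP_mean (hN : ∀ ν p, 0 < N ν p) (hn : Tendsto n atTop atTop) (hc : 0 < c)
    (hcN : ∀ᶠ ν in atTop, ∀ p, c * n ν ≤ N ν p) {p : Fin m} {g : S p → ℝ}
    (hm : Measurable g) (hg : MemLp g 2 (F p)) :
    IsSmallOP (fun ν => inputLaw F (N ν)) fun ν x =>
      (N ν p : ℝ)⁻¹ * ∑ j, g (x p j) - ∫ ξ, g ξ ∂(F p) := by
  have hr : Tendsto (fun ν => (∫ ξ, g ξ ^ 2 ∂(F p)) / (c * n ν)) atTop (𝓝 0) :=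
    (hn.const_mul_atTop hc).const_div_atTop _
  refine isSmallOP_of_integral_sq (fun ν => (memLp_mean hg).sub (memLp_const _)) hr ?_
  filter_upwards [hcN, hn.eventually_gt_atTop 0] with ν h1 h2
  refine (integral_sq_mean_inputLaw_le (hN ν p) hm hg).trans ?_
  have h3 : 0 ≤ ∫ ξ, g ξ ^ 2 ∂(F p) := integral_nonneg fun _ => sq_nonneg _
  have h4 := h1 p
  gcongr

lemma memLp_vstat {N : Fin m → ℕ} (h : ReuseMemLp F φ) :
    MemLp (fun x : Inputs S N => vstat φ x) 2 (inputLaw F N) :=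
  memLp_avgSel fun J => h.memLp_sel J

lemma memLp_vstat_sub_proj {N : Fin m → ℕ} (h : ReuseMemLp F φ) :
    MemLp (fun x : Inputs S N => vstat φ x - (∫ z, φ z ∂(inputLaw F T)) -
        ∑ s : Slot T, (N s.1 : ℝ)⁻¹ * ∑ j, slotProj F φ s (x s.1 j)) 2 (inputLaw F N) :=
  ((memLp_vstat h).sub (memLp_const _)).sub (memLp_finsetSum _ fun s _ =>
    memLp_mean (memLp_slotProj h.measurable h.memLp_self s))

/-- First-order asymptotics of V-statistics: the error of the Hájek projection is `o_P(n^{-1/2})`. -/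
theorem isSmallOP_sqrt_mul_vstat_sub_proj [Nonempty (Slot T)] (h : ReuseMemLp F φ)
    (hN : ∀ ν p, 0 < N ν p) (hn : Tendsto n atTop atTop) (hc : 0 < c)
    (hcN : ∀ᶠ ν in atTop, ∀ p, c * n ν ≤ N ν p) :
    IsSmallOP (fun ν => inputLaw F (N ν)) fun ν x =>
      √(n ν) * (vstat φ x - (∫ z, φ z ∂(inputLaw F T)) -
        ∑ s : Slot T, (N ν s.1 : ℝ)⁻¹ * ∑ j, slotProj F φ s (x s.1 j)) := by
  obtain ⟨C, hC, hC'⟩ := exists_integral_vstat_sub_proj_sq_le h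
  have hr : Tendsto (fun ν => C / c ^ 2 / n ν) atTop (𝓝 0) := hn.const_div_atTop _
  refine isSmallOP_of_integral_sq (fun ν => (memLp_vstat_sub_proj h).const_mul _) hr ?_
  filter_upwards [hcN, hn.eventually_gt_atTop 0] with ν h1 h2
  simp only [mul_pow, integral_const_mul, Real.sq_sqrt h2.le]
  calc _ ≤ n ν * (C / (c * n ν) ^ 2) :=
        mul_le_mul_of_nonneg_left (hC' (N ν) (hN ν) (c * n ν) (by positivity) h1) h2.le
    _ = _ := by field_simp

/-- The weak law of large numbers for V-statistics. -/
theorem isSmallOP_vstat_sub [Nonempty (Slot T)] (h : ReuseMemLp F φ)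
    (hN : ∀ ν p, 0 < N ν p) (hn : Tendsto n atTop atTop) (hc : 0 < c)
    (hcN : ∀ᶠ ν in atTop, ∀ p, c * n ν ≤ N ν p) :
    IsSmallOP (fun ν => inputLaw F (N ν)) fun _ x =>
      vstat φ x - ∫ z, φ z ∂(inputLaw F T) := by
  have h1 := isSmallOP_sqrt_mul_vstat_sub_proj h hN hn hc hcN
  have h2 := IsSmallOP.sum (P := fun ν => inputLaw F (N ν)) Finset.univ
    fun (s : Slot T) (_ : s ∈ Finset.univ) =>
    isSmallOP_mean hN hn hc hcN (measurable_slotProj h.measurable s)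
      (memLp_slotProj h.measurable h.memLp_self s)
  simp only [integral_slotProj h.measurable h.memLp_self, sub_zero] at h2
  have h3 : IsSmallOP (fun ν => inputLaw F (N ν)) fun ν x =>
      vstat φ x - (∫ z, φ z ∂(inputLaw F T)) -
        ∑ s : Slot T, (N ν s.1 : ℝ)⁻¹ * ∑ j, slotProj F φ s (x s.1 j) := by
    refine h1.mono ?_
    filter_upwards [hn.eventually_ge_atTop 1] with ν hν
    refine .of_forall fun x => ?_
    rw [abs_mul, abs_of_nonneg (Real.sqrt_nonneg _)]
    exact le_mul_of_one_le_left (abs_nonneg _) (Real.one_le_sqrt.2 hν)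
  refine (h3.add h2).mono (.of_forall fun ν => .of_forall fun x => le_of_eq ?_)
  congr 1
  ring

lemma isBigOP_vstat_sq (h : ReuseMemLp F φ) (hN : ∀ ν p, 0 < N ν p) :
    IsBigOP (fun ν => inputLaw F (N ν)) fun _ x => vstat (fun z => φ z ^ 2) x := by
  obtain ⟨C, hC, hC'⟩ := h.exists_integral_sq_le
  refine isBigOP_of_integral (C := C)
    (fun ν => integrable_avgSel fun J => (h.memLp_sel J).integrable_sq)
    (fun ν x => vstat_sq_nonneg φ x) fun ν => ?_
  unfold vstat
  rw [integral_avgSel fun J => (h.memLp_sel J).integrable_sq, ← avgSel_const (hN ν) C]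
  exact avgSel_mono fun J => hC' (N ν) J

end VStatisticAsymptotics

/-! ### Influence functions -/

section Influence

variable {m : ℕ} {S : Fin m → Type*} [∀ p, MeasurableSpace (S p)]
  {F : ∀ p, Measure (S p)} [∀ p, IsProbabilityMeasure (F p)] {T : Fin m → ℕ}
  {h : Inputs S T → ℝ}

/-- The inputs `z` in which those inputs from source `p` that are marked by `J` are replaced by
the point `x`. -/
def markedInputs (p : Fin m) (x : S p) (J : Slot T → Bool) (z : Inputs S T) : Inputs S T :=
  fun q t => bif J ⟨q, t⟩ then
    Function.update (fun q (y : S q) => y) p (fun _ => x) q (z q t) else z q t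

lemma markedInputs_of_forall {p : Fin m} {x : S p} {J : Slot T → Bool}
    (hJ : ∀ t, J ⟨p, t⟩ = false) (z : Inputs S T) : markedInputs p x J z = z := by
  funext q t
  unfold markedInputs
  rcases eq_or_ne q p with rfl | hq
  · simp [hJ]
  · simp [hq]

lemma markedInputs_none {p : Fin m} {x : S p} (z : Inputs S T) :
    markedInputs p x (fun _ => false) z = z :=
  markedInputs_of_forall (fun _ => rfl) z

lemma markedInputs_apply {p : Fin m} {x : S p} {J : Slot T → Bool} (z : Inputs S T)
    (t : Fin (T p)) : markedInputs p x J z p t = bif J ⟨p, t⟩ then x else z p t := by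
  simp [markedInputs]

lemma markedInputs_apply_of_ne {p q : Fin m} (hq : q ≠ p) {x : S p} {J : Slot T → Bool}
    (z : Inputs S T) (t : Fin (T q)) : markedInputs p x J z q t = z q t := by
  simp [markedInputs, hq]

lemma markedInputs_single {p : Fin m} {x : S p} (t : Fin (T p)) (z : Inputs S T) :
    markedInputs p x (fun s => decide (s = ⟨p, t⟩)) z = updateSlot z ⟨p, t⟩ x := by
  funext q t'
  rcases eq_or_ne q p with rfl | hq
  · rw [markedInputs_apply]
    by_cases ht : t' = t
    · subst ht
      simp [updateSlot]
    · simp [ht, updateSlot]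
  · rw [markedInputs_apply_of_ne hq, updateSlot_apply_of_ne]
    intro h
    exact hq (Sigma.mk.inj_iff.1 h).1

instance isProbabilityMeasure_update_dirac (p : Fin m) (x : S p) (q : Fin m) :
    IsProbabilityMeasure (Function.update F p (Measure.dirac x) q) := by
  rcases eq_or_ne q p with rfl | hq
  · rw [Function.update_self]; infer_instance
  · rw [Function.update_of_ne hq]; infer_instance

lemma measurePreserving_markedInputs (p : Fin m) (x : S p) (J : Slot T → Bool) :
    MeasurePreserving (fun z (s : Slot T) => markedInputs p x J z s.1 s.2) (inputLaw F T)
      (Measure.pi fun s : Slot T =>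
        bif J s then Function.update F p (Measure.dirac x) s.1 else F s.1) := by
  let f : ∀ s : Slot T, S s.1 → S s.1 := fun s y =>
    bif J s then Function.update (fun q (y : S q) => y) p (fun _ => x) s.1 y else y
  have hf : ∀ s, MeasurePreserving (f s) (F s.1)
      (bif J s then Function.update F p (Measure.dirac x) s.1 else F s.1) := by
    rintro ⟨q, t⟩
    simp only [f]
    cases J ⟨q, t⟩
    · exact MeasurePreserving.id _
    · simp only [cond_true]
      rcases eq_or_ne q p with rfl | hq
      · rw [Function.update_self, Function.update_self]
        exact ⟨measurable_const, by simp [Measure.map_const]⟩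
      · rw [Function.update_of_ne hq, Function.update_of_ne hq]
        exact MeasurePreserving.id _
  have : ∀ s : Slot T, IsProbabilityMeasure
      (bif J s then Function.update F p (Measure.dirac x) s.1 else F s.1) := by
    intro s
    cases J s <;> simp only [cond_true, cond_false] <;> infer_instance
  exact (measurePreserving_pi _ _ hf).comp (measurePreserving_uncurry_inputLaw F T)

/-- For almost every `x`, the output remains integrable when any of the inputs of source `p` are
fixed at `x`: this is integrability over a slice of the law of the inputs with reuse. -/
lemma ae_integrable_markedInputs (hh : ReuseMemLp F h) (p : Fin m) (J : Slot T → Bool) :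
    ∀ᵐ x ∂(F p), Integrable (fun z => h (markedInputs p x J z)) (inputLaw F T) := by
  by_cases hJ : ∀ t, J ⟨p, t⟩ = false
  · simp only [markedInputs_of_forall hJ]
    exact .of_forall fun _ => hh.memLp_self.integrable one_le_two
  -- all marked slots reuse the input of one of them
  push Not at hJ
  obtain ⟨t₀, ht₀⟩ := hJ
  replace ht₀ : J ⟨p, t₀⟩ = true := by simpa using ht₀
  let I : ∀ q, Fin (T q) → Fin (T q) :=
    Function.update (fun _ => id) p fun t => bif J ⟨p, t⟩ then t₀ else t
  have hm : Measurable fun z : Inputs S T => h fun q t => z q (I q t) :=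
    hh.measurable.comp (measurable_reuse I)
  have hL := memLp_comp_updateSlot (hh.memLp I) ⟨p, t₀⟩
  filter_upwards [ae_memLp_two_slice (hm.comp (measurable_updateSlot ⟨p, t₀⟩)) hL] with x hx
  refine (hx.integrable one_le_two).congr (.of_forall fun z => ?_)
  simp only [Function.comp]
  congr 1
  funext q t
  rcases eq_or_ne q p with rfl | hq
  · rw [markedInputs_apply]
    simp only [I, Function.update_self]
    cases hJt : J ⟨q, t⟩
    · have : t ≠ t₀ := fun h => by rw [h, ht₀] at hJt; cases hJt
      simp [updateSlot, this]
    · simp [updateSlot]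
  · rw [markedInputs_apply_of_ne hq, updateSlot_apply_of_ne]
    · simp [I, hq]
    · intro h
      exact hq (Sigma.mk.inj_iff.1 h).1

lemma isProbabilityMeasure_contaminate (p : Fin m) (x : S p) {ε : ℝ} (h0 : 0 ≤ ε) (h1 : ε ≤ 1)
    (q : Fin m) : IsProbabilityMeasure (contaminate F p x ε q) := by
  unfold contaminate
  rcases eq_or_ne q p with rfl | hq
  · rw [Function.update_self]
    constructor
    simp only [Measure.add_apply, Measure.smul_apply, measure_univ, smul_eq_mul, mul_one]
    rw [← ENNReal.ofReal_add (by linarith) h0]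
    simp
  · rw [Function.update_of_ne hq]; infer_instance

/-- Under the contaminated input model each input of source `p` is replaced by `x` with
probability `ε`, independently of the others. -/
lemma perf_contaminate (hm : Measurable h) (p : Fin m) (x : S p)
    (hi : ∀ J : Slot T → Bool, Integrable (fun z => h (markedInputs p x J z)) (inputLaw F T))
    {ε : ℝ} (h0 : 0 ≤ ε) (h1 : ε ≤ 1) :
    perf h (contaminate F p x ε) = ∑ J : Slot T → Bool,
      (∏ s, bif J s then ε else 1 - ε) * ∫ z, h (markedInputs p x J z) ∂(inputLaw F T) := by
  have := isProbabilityMeasure_contaminate (F := F) p x h0 h1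
  let μ : ∀ s : Slot T, Bool → Measure (S s.1) := fun s a =>
    bif a then Function.update F p (Measure.dirac x) s.1 else F s.1
  have hμ : ∀ s a, IsProbabilityMeasure (μ s a) := by
    intro s a
    simp only [μ]
    cases a <;> simp only [cond_true, cond_false] <;> infer_instance
  let c : Bool → ℝ≥0 := fun a => bif a then ε.toNNReal else (1 - ε).toNNReal
  have hF : ∀ s : Slot T, contaminate F p x ε s.1 = ∑ a, (c a • μ s a) := by
    rintro ⟨q, t⟩
    simp only [Fintype.univ_bool, Finset.mem_singleton, Bool.true_eq_false, not_false_eq_true,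
      Finset.sum_insert, Finset.sum_singleton, c, μ, cond_true, cond_false, contaminate]
    rcases eq_or_ne q p with rfl | hq
    · rw [Function.update_self, Function.update_self, add_comm]
      rfl
    · rw [Function.update_of_ne hq, Function.update_of_ne hq, ← add_smul,
        ← Real.toNNReal_add h0 (by linarith)]
      simp
  have hpi : Measure.pi (fun s : Slot T => contaminate F p x ε s.1) =
      ∑ J : Slot T → Bool, (∏ s, c (J s)) • Measure.pi fun s => μ s (J s) := by
    rw [show (fun s : Slot T => contaminate F p x ε s.1) = fun s => ∑ a, (c a • μ s a) from
      funext hF, pi_finset_sum]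
    refine Finset.sum_congr rfl fun J _ => ?_
    refine Measure.pi_eq fun s _ => ?_
    simp only [Measure.smul_apply, Measure.pi_pi]
    simp only [ENNReal.smul_def, smul_eq_mul, Finset.prod_mul_distrib, ENNReal.ofNNReal_finsetProd]
  have hcur := measurePreserving_curry_inputLaw (contaminate F p x ε) T
  have hJ : ∀ J : Slot T → Bool, MeasurePreserving (markedInputs p x J) (inputLaw F T)
      ((Measure.pi fun s => μ s (J s)).map
        (MeasurableEquiv.piCurry fun p (_ : Fin (T p)) => S p)) := by
    intro J
    exact ((MeasurableEquiv.piCurry fun p (_ : Fin (T p)) => S p).measurable.measurePreserving _).comp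
      (measurePreserving_markedInputs (F := F) p x J)
  unfold perf
  rw [← hcur.map_eq, hpi, ← Measure.mapₗ_apply_of_measurable (MeasurableEquiv.measurable _),
    map_sum, integral_finsetSum_measure]
  · refine Finset.sum_congr rfl fun J _ => ?_
    rw [Measure.mapₗ_apply_of_measurable (MeasurableEquiv.measurable _), Measure.map_smul,
      integral_smul_nnreal_measure, NNReal.smul_def, smul_eq_mul,
      integral_comp_measurePreserving (hJ J) hm]
    congr 1
    rw [NNReal.coe_prod]
    refine Finset.prod_congr rfl fun s _ => ?_
    simp only [c]
    cases J s
    · simp [h1]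
    · simp [h0]
  · intro J _
    rw [Measure.mapₗ_apply_of_measurable (MeasurableEquiv.measurable _), Measure.map_smul]
    refine Integrable.smul_measure_nnreal ?_
    rw [← (hJ J).map_eq]
    exact (integrable_map_measure hm.aestronglyMeasurable (hJ J).measurable.aemeasurable).2 (hi J)

/-- Derivative at zero of the expectation of `I` over independent marks with probability `ε`: the
sum of the effects of a single mark. -/
lemma hasDerivAt_sum_prod_cond {ι : Type*} [Fintype ι] [DecidableEq ι] (I : (ι → Bool) → ℝ) :
    HasDerivAt (fun ε : ℝ => ∑ J : ι → Bool, (∏ s, bif J s then ε else 1 - ε) * I J)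
      (∑ s, (I (fun s' => decide (s' = s)) - I fun _ => false)) 0 := by
  let v : Bool → ℝ := fun a => bif a then 0 else 1
  let d : Bool → ℝ := fun a => bif a then 1 else -1
  have hc : ∀ a : Bool, HasDerivAt (fun ε : ℝ => bif a then ε else 1 - ε) (d a) 0 := by
    intro a
    cases a
    · simpa [d] using (hasDerivAt_id (0 : ℝ)).const_sub 1
    · simpa [d] using hasDerivAt_id' (0 : ℝ)
  have hp : ∀ J : ι → Bool, HasDerivAt (fun ε : ℝ => (∏ s, bif J s then ε else 1 - ε) * I J)
      ((∑ s, (∏ s' ∈ Finset.univ.erase s, v (J s')) * d (J s)) * I J) 0 := by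
    intro J
    have h := HasDerivAt.fun_finsetProd (u := Finset.univ) fun s _ => hc (J s)
    refine (h.mul_const (I J)).congr_deriv ?_
    congr 1
    refine Finset.sum_congr rfl fun s _ => ?_
    rw [smul_eq_mul]
    congr 1
    refine Finset.prod_congr rfl fun s' _ => ?_
    simp only [v]
    cases J s' <;> simp
  refine (HasDerivAt.fun_sum fun J _ => hp J).congr_deriv ?_
  simp only [Finset.sum_mul]
  rw [Finset.sum_comm]
  refine Finset.sum_congr rfl fun s _ => ?_
  -- only the arrays that mark at most the slot `s` contribute to the derivative in slot `s`
  rw [Fintype.sum_eq_add (fun s' => decide (s' = s)) (fun _ => false)]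
  · have h1 : ∏ s' ∈ Finset.univ.erase s, v (decide (s' = s)) = 1 :=
      Finset.prod_eq_one fun s' hs' => by simp [v, Finset.ne_of_mem_erase hs']
    simp [h1, v, d]
    ring
  · intro h
    simpa using congrFun h s
  · rintro J ⟨hJ1, hJ2⟩
    have : ∃ s', s' ≠ s ∧ J s' = true := by
      by_contra hc
      push Not at hc
      cases hs : J s
      · refine hJ2 (funext fun s' => ?_)
        by_cases h : s' = s
        · rw [h, hs]
        · simpa using hc s' h
      · refine hJ1 (funext fun s' => ?_)
        by_cases h : s' = s
        · simp [h, hs]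
        · simpa [h] using hc s' h
    obtain ⟨s', hs', hJs'⟩ := this
    rw [Finset.prod_eq_zero (Finset.mem_erase.2 ⟨hs', Finset.mem_univ _⟩) (by simp [v, hJs'])]
    simp

/-- The influence function is the sum of the first-order projections over the slots of the
source. The reuse of inputs matters because the contaminating point may occur several times. -/
theorem influence_ae_eq (hh : ReuseMemLp F h) (p : Fin m) :
    influence h F p =ᵐ[F p] fun x => ∑ t, slotProj F h ⟨p, t⟩ x := by
  have hi : ∀ᵐ x ∂(F p), ∀ J : Slot T → Bool,
      Integrable (fun z => h (markedInputs p x J z)) (inputLaw F T) :=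
    ae_all_iff.2 fun J => ae_integrable_markedInputs hh p J
  filter_upwards [hi] with x hx
  let I : (Slot T → Bool) → ℝ := fun J => ∫ z, h (markedInputs p x J z) ∂(inputLaw F T)
  have hI0 : I (fun _ => false) = perf h F := by
    simp only [I, markedInputs_none, perf]
  have hd := hasDerivAt_sum_prod_cond I
  have hval : ∑ s, (I (fun s' => decide (s' = s)) - I fun _ => false) =
      ∑ t, slotProj F h ⟨p, t⟩ x := by
    rw [Fintype.sum_sigma, Finset.sum_eq_single p]
    · refine Finset.sum_congr rfl fun t _ => ?_
      simp only [I, markedInputs_single, markedInputs_none, slotProj]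
    · intro q _ hq
      refine Finset.sum_eq_zero fun t _ => ?_
      have : ∀ z, markedInputs p x (fun s' : Slot T => decide (s' = ⟨q, t⟩)) z = z := fun z =>
        markedInputs_of_forall (fun t' => by simp [hq.symm]) z
      simp only [I, markedInputs_none, this, sub_self]
    · simp
  rw [hval] at hd
  unfold influence
  refine Tendsto.limUnder_eq ?_
  have h1 := (hasDerivAt_iff_tendsto_slope_zero.1 hd).mono_left
    (nhdsWithin_mono (0 : ℝ) fun y (hy : 0 < y) => hy.ne')
  refine h1.congr' ?_
  filter_upwards [Ioc_mem_nhdsGT (zero_lt_one' ℝ)] with ε hε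
  have e0 := perf_contaminate hh.measurable p x hx (ε := 0) le_rfl zero_le_one
  have e00 : contaminate F p x 0 = F := by simp [contaminate]
  rw [e00] at e0
  rw [perf_contaminate hh.measurable p x hx hε.1.le hε.2, e0, zero_add, smul_eq_mul,
    inv_mul_eq_div]

end Influence

/-! ### Weighted empirical input models -/

instance isFiniteMeasure_coe_smul {α : Type*} [MeasurableSpace α] (c : ℝ≥0) (μ : Measure α)
    [IsFiniteMeasure μ] : IsFiniteMeasure ((c : ℝ≥0∞) • μ) :=
  inferInstanceAs (IsFiniteMeasure (c • μ))

section Discrete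

variable {m : ℕ} {S : Fin m → Type*} [∀ p, MeasurableSpace (S p)] {T N : Fin m → ℕ}

/-- Nonnegative weights on the data points that sum to one for every source. -/
def IsWeight (w : ∀ p, Fin (N p) → ℝ) : Prop :=
  (∀ p j, 0 ≤ w p j) ∧ ∀ p, ∑ j, w p j = 1

/-- The expectation of `φ` under the input model with weights `w` on the data `x`, as an explicit
finite sum. -/
noncomputable def wsum (φ : Inputs S T → ℝ) (x : Inputs S N) (w : ∀ p, Fin (N p) → ℝ) : ℝ :=
  ∑ J : ∀ s : Slot T, Fin (N s.1), (∏ s, w s.1 (J s)) * φ (sel J x)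

lemma IsWeight.isProbabilityMeasure {w : ∀ p, Fin (N p) → ℝ} (hw : IsWeight w)
    (x : Inputs S N) (p : Fin m) : IsProbabilityMeasure (weightedEmpirical x w p) := by
  constructor
  simp only [weightedEmpirical, Measure.finsetSum_apply, Measure.smul_apply, measure_univ,
    smul_eq_mul, mul_one]
  rw [← ENNReal.ofReal_sum_of_nonneg fun j _ => hw.1 p j, hw.2 p, ENNReal.ofReal_one]

lemma isWeight_uniform (hN : ∀ p, 0 < N p) : IsWeight fun p (_ : Fin (N p)) => (N p : ℝ)⁻¹ := by
  refine ⟨fun p j => by positivity, fun p => ?_⟩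
  have : (N p : ℝ) ≠ 0 := by exact_mod_cast (hN p).ne'
  simp [this]

/-- The inputs under a weighted empirical model are selected from the data by a random index array. -/
lemma inputLaw_weightedEmpirical {w : ∀ p, Fin (N p) → ℝ} (hw : IsWeight w) (x : Inputs S N) :
    inputLaw (weightedEmpirical x w) T =
      ∑ J : ∀ s : Slot T, Fin (N s.1),
        ENNReal.ofReal (∏ s, w s.1 (J s)) • Measure.dirac (sel J x) := by
  have := hw.isProbabilityMeasure x
  have hpi : Measure.pi (fun s : Slot T => weightedEmpirical x w s.1) =
      ∑ J : ∀ s : Slot T, Fin (N s.1), ENNReal.ofReal (∏ s, w s.1 (J s)) •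
        Measure.dirac (fun s => x s.1 (J s)) := by
    have h := pi_finset_sum fun (s : Slot T) (j : Fin (N s.1)) =>
      ((w s.1 j).toNNReal : ℝ≥0∞) • Measure.dirac (x s.1 j)
    refine h.trans (Finset.sum_congr rfl fun J _ => ?_)
    rw [pi_smul_dirac (fun s => (w s.1 (J s)).toNNReal) fun s => x s.1 (J s)]
    congr 1
    rw [← Real.toNNReal_prod_of_nonneg fun s _ => hw.1 s.1 (J s)]
    rfl
  have hcur := measurePreserving_curry_inputLaw (weightedEmpirical x w) T
  rw [← hcur.map_eq, hpi, ← Measure.mapₗ_apply_of_measurable (MeasurableEquiv.measurable _),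
    map_sum]
  refine Finset.sum_congr rfl fun J _ => ?_
  rw [Measure.mapₗ_apply_of_measurable (MeasurableEquiv.measurable _), Measure.map_smul,
    Measure.map_dirac' (MeasurableEquiv.measurable _)]
  rfl

lemma pi_inputLaw_weightedEmpirical {w : ∀ p, Fin (N p) → ℝ} (hw : IsWeight w)
    (x : Inputs S N) (R : ℕ) :
    Measure.pi (fun _ : Fin R => inputLaw (weightedEmpirical x w) T) =
      ∑ J : Fin R → ∀ s : Slot T, Fin (N s.1),
        ENNReal.ofReal (∏ r, ∏ s, w s.1 (J r s)) • Measure.dirac fun r => sel (J r) x := by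
  simp only [inputLaw_weightedEmpirical hw]
  have h := pi_finset_sum (X := fun _ : Fin R => Inputs S T) fun (_ : Fin R) (J : ∀ s : Slot T, Fin (N s.1)) =>
      ((∏ s, w s.1 (J s)).toNNReal : ℝ≥0∞) • Measure.dirac (sel J x)
  refine h.trans (Finset.sum_congr rfl fun J _ => ?_)
  rw [pi_smul_dirac (fun r => (∏ s, w s.1 (J r s)).toNNReal) fun r => sel (J r) x]
  congr 1
  rw [← Real.toNNReal_prod_of_nonneg fun r _ => Finset.prod_nonneg fun s _ => hw.1 s.1 (J r s)]
  rfl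

lemma integrable_inputLaw_weightedEmpirical {w : ∀ p, Fin (N p) → ℝ} (hw : IsWeight w)
    (x : Inputs S N) {φ : Inputs S T → ℝ} (hφ : Measurable φ) :
    Integrable φ (inputLaw (weightedEmpirical x w) T) := by
  rw [inputLaw_weightedEmpirical hw, integrable_finsetSum_measure]
  intro J _
  refine Integrable.smul_measure ?_ ENNReal.ofReal_ne_top
  refine ⟨hφ.aestronglyMeasurable, ?_⟩
  rw [HasFiniteIntegral, lintegral_dirac' _ hφ.enorm]
  exact enorm_lt_top

lemma integral_inputLaw_weightedEmpirical {w : ∀ p, Fin (N p) → ℝ} (hw : IsWeight w)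
    (x : Inputs S N) {φ : Inputs S T → ℝ} (hφ : Measurable φ) :
    ∫ z, φ z ∂(inputLaw (weightedEmpirical x w) T) = wsum φ x w := by
  have hi := integrable_inputLaw_weightedEmpirical (T := T) hw x hφ
  rw [inputLaw_weightedEmpirical hw, integrable_finsetSum_measure] at hi
  rw [inputLaw_weightedEmpirical hw, integral_finsetSum_measure hi]
  refine Finset.sum_congr rfl fun J _ => ?_
  rw [integral_smul_measure, integral_dirac' _ _ hφ.stronglyMeasurable,
    ENNReal.toReal_ofReal (Finset.prod_nonneg fun _ _ => hw.1 _ _), smul_eq_mul]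

lemma memLp_inputLaw_weightedEmpirical {w : ∀ p, Fin (N p) → ℝ} (hw : IsWeight w)
    (x : Inputs S N) {φ : Inputs S T → ℝ} (hφ : Measurable φ) :
    MemLp φ 2 (inputLaw (weightedEmpirical x w) T) :=
  (memLp_two_iff_integrable_sq hφ.aestronglyMeasurable).2
    (integrable_inputLaw_weightedEmpirical hw x (hφ.pow_const 2))

lemma wsum_eq_avgSel (hN : ∀ p, 0 < N p) (φ : Inputs S T → ℝ) (x : Inputs S N)
    (w : ∀ p, Fin (N p) → ℝ) :
    wsum φ x w = avgSel N fun J => φ (sel J x) * ∏ s : Slot T, (N s.1 * w s.1 (J s)) := by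
  have hn : ∏ s : Slot T, (N s.1 : ℝ) ≠ 0 :=
    Finset.prod_ne_zero_iff.2 fun s _ => Nat.cast_ne_zero.2 (hN s.1).ne'
  rw [wsum, avgSel, Finset.mul_sum]
  refine Finset.sum_congr rfl fun J _ => ?_
  rw [Finset.prod_mul_distrib]
  field_simp

lemma wsum_uniform (hN : ∀ p, 0 < N p) (φ : Inputs S T → ℝ) (x : Inputs S N) :
    wsum φ x (fun p _ => (N p : ℝ)⁻¹) = vstat φ x := by
  rw [wsum_eq_avgSel hN, vstat]
  congr 1
  funext J
  rw [Finset.prod_eq_one, mul_one]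
  intro s _
  exact mul_inv_cancel₀ (by exact_mod_cast (hN s.1).ne')

lemma wsum_mono {φ ψ : Inputs S T → ℝ} {w : ∀ p, Fin (N p) → ℝ} (hw : IsWeight w)
    (x : Inputs S N) (h : ∀ J, φ (sel J x) ≤ ψ (sel J x)) :
    wsum φ x w ≤ wsum ψ x w :=
  Finset.sum_le_sum fun J _ =>
    mul_le_mul_of_nonneg_left (h J) (Finset.prod_nonneg fun _ _ => hw.1 _ _)

lemma wsum_nonneg {φ : Inputs S T → ℝ} {w : ∀ p, Fin (N p) → ℝ} (hw : IsWeight w)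
    (x : Inputs S N) (h : ∀ z, 0 ≤ φ z) : 0 ≤ wsum φ x w :=
  Finset.sum_nonneg fun _ _ =>
    mul_nonneg (Finset.prod_nonneg fun _ _ => hw.1 _ _) (h _)

lemma wsum_finset_sum {κ : Type*} (t : Finset κ) (f : κ → Inputs S T → ℝ) (x : Inputs S N)
    (w : ∀ p, Fin (N p) → ℝ) :
    wsum (fun z => ∑ k ∈ t, f k z) x w = ∑ k ∈ t, wsum (f k) x w := by
  simp only [wsum, Finset.mul_sum]
  rw [Finset.sum_comm]

lemma measurable_wsum {α : Type*} [MeasurableSpace α] {φ : α → Inputs S T → ℝ}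
    (hφ : Measurable fun q : α × Inputs S T => φ q.1 q.2) {X : α → Inputs S N}
    (hX : Measurable X) {W : α → ∀ p, Fin (N p) → ℝ} (hW : Measurable W) :
    Measurable fun a => wsum (φ a) (X a) (W a) := by
  unfold wsum
  refine Finset.measurable_fun_sum _ fun J _ => ?_
  refine (Finset.measurable_fun_prod _ fun s _ => ?_).mul ?_
  · exact (measurable_pi_apply (J s)).comp ((measurable_pi_apply s.1).comp hW)
  · exact hφ.comp (measurable_id.prodMk ((measurable_sel J).comp hX))

end Discrete

/-! ### Conditionally i.i.d. replications -/

section Conditional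

variable {m : ℕ} {S : Fin m → Type*} [∀ p, MeasurableSpace (S p)] {T N : Fin m → ℕ} {R : ℕ}
  {Ω : Type*} {𝒢 : MeasurableSpace Ω} [mΩ : MeasurableSpace Ω] {P : Measure Ω} [IsProbabilityMeasure P]

/-- Conditional expectations of functions of the conditioning variables and the replications are
computed by integrating over the conditional law of the replications. -/
theorem IsCondReplication.lintegral_eq (h𝒢 : 𝒢 ≤ mΩ)
    {X : Ω → Inputs S N} {W : Ω → ∀ p, Fin (N p) → ℝ} {Z : Ω → Fin R → Inputs S T}
    (h : IsCondReplication P 𝒢 (fun ω => weightedEmpirical (X ω) (W ω)) Z)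
    (hX : Measurable[𝒢] X) (hW : Measurable[𝒢] W) (hZ : Measurable Z)
    (hw : ∀ᵐ ω ∂P, IsWeight (W ω))
    {Φ : (Inputs S N × (∀ p, Fin (N p) → ℝ)) × (Fin R → Inputs S T) → ℝ≥0∞}
    (hΦ : Measurable Φ) :
    ∫⁻ ω, Φ ((X ω, W ω), Z ω) ∂P = ∫⁻ ω, ∫⁻ z, Φ ((X ω, W ω), z)
      ∂(Measure.pi fun _ : Fin R => inputLaw (weightedEmpirical (X ω) (W ω)) T) ∂P := by
  let Y : Ω → Inputs S N × (∀ p, Fin (N p) → ℝ) := fun ω => (X ω, W ω)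
  have hX' : Measurable X := hX.mono h𝒢 le_rfl
  have hW' : Measurable W := hW.mono h𝒢 le_rfl
  have hY : Measurable Y := hX'.prodMk hW'
  have hY𝒢 : Measurable[𝒢] Y := hX.prodMk hW
  -- the conditional law of all variables, as an explicitly measurable finite mixture of point masses
  let f : Ω → Measure ((Inputs S N × (∀ p, Fin (N p) → ℝ)) × (Fin R → Inputs S T)) := fun ω =>
    ∑ J : Fin R → ∀ s : Slot T, Fin (N s.1),
      ENNReal.ofReal (∏ r, ∏ s, W ω s.1 (J r s)) •
        Measure.dirac (Y ω, fun r => sel (J r) (X ω))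
  have hf : Measurable f := by
    refine Measure.measurable_of_measurable_coe _ fun B hB => ?_
    simp only [f, Measure.finsetSum_apply, Measure.smul_apply, smul_eq_mul,
      Measure.dirac_apply' _ hB]
    refine Finset.measurable_fun_sum _ fun J _ => ?_
    refine Measurable.mul ?_ ?_
    · refine Measurable.ennreal_ofReal ?_
      refine Finset.measurable_fun_prod _ fun r _ => Finset.measurable_fun_prod _ fun s _ => ?_
      exact (measurable_pi_apply (J r s)).comp ((measurable_pi_apply s.1).comp hW')
    · refine (measurable_one.indicator hB).comp (hY.prodMk ?_)
      exact measurable_pi_lambda _ fun r => (measurable_sel (J r)).comp hX'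
  have hfω : ∀ᵐ ω ∂P, f ω = (Measure.pi fun _ : Fin R =>
      inputLaw (weightedEmpirical (X ω) (W ω)) T).map (Prod.mk (Y ω)) := by
    filter_upwards [hw] with ω hω
    rw [pi_inputLaw_weightedEmpirical hω,
      ← Measure.mapₗ_apply_of_measurable measurable_prodMk_left, map_sum]
    refine Finset.sum_congr rfl fun J _ => ?_
    rw [Measure.mapₗ_apply_of_measurable measurable_prodMk_left, Measure.map_smul,
      Measure.map_dirac' measurable_prodMk_left]
  have hYZ : Measurable fun ω => (Y ω, Z ω) := hY.prodMk hZ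
  -- both sides agree on rectangles, by the definition of conditional replications
  have key : P.map (fun ω => (Y ω, Z ω)) = P.bind f := by
    have hrect : ∀ A : Set (Inputs S N × (∀ p, Fin (N p) → ℝ)), MeasurableSet A →
        ∀ B : Set (Fin R → Inputs S T), MeasurableSet B →
        P.map (fun ω => (Y ω, Z ω)) (A ×ˢ B) = P.bind f (A ×ˢ B) := by
      intro A hA B hB
      rw [Measure.map_apply hYZ (hA.prod hB), Measure.bind_apply (hA.prod hB) hf.aemeasurable]
      have e1 : (fun ω => (Y ω, Z ω)) ⁻¹' (A ×ˢ B) = Y ⁻¹' A ∩ Z ⁻¹' B := rfl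
      rw [e1, h _ (hY𝒢 hA) B hB, ← lintegral_indicator (hY hA)]
      refine lintegral_congr_ae ?_
      filter_upwards [hfω] with ω hω
      rw [hω, Measure.map_apply measurable_prodMk_left (hA.prod hB)]
      by_cases hA' : Y ω ∈ A
      · rw [Set.indicator_of_mem (show ω ∈ Y ⁻¹' A from hA'), Set.mk_preimage_prod_right hA']
      · rw [Set.indicator_of_notMem (show ω ∉ Y ⁻¹' A from hA'),
          Set.mk_preimage_prod_right_eq_empty hA', measure_empty]
    have : IsProbabilityMeasure (P.map fun ω => (Y ω, Z ω)) :=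
      Measure.isProbabilityMeasure_map hYZ.aemeasurable
    refine MeasureTheory.ext_of_generate_finite _ generateFrom_prod.symm isPiSystem_prod ?_ ?_
    · rintro _ ⟨A, hA, B, hB, rfl⟩
      exact hrect A hA B hB
    · rw [← Set.univ_prod_univ]
      exact hrect _ .univ _ .univ
  have e2 : ∫⁻ ω, Φ (Y ω, Z ω) ∂P = ∫⁻ y, Φ y ∂(P.map fun ω => (Y ω, Z ω)) :=
    (lintegral_map hΦ hYZ).symm
  refine e2.trans ?_
  rw [key, Measure.lintegral_bind hf.aemeasurable hΦ.aemeasurable]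
  refine lintegral_congr_ae ?_
  filter_upwards [hfω] with ω hω
  rw [hω, lintegral_map hΦ measurable_prodMk_left]

lemma measurable_normalized_sq_error {κ : Type*} [Fintype κ]
    {f : κ → Inputs S N → Inputs S T → ℝ}
    (hf : ∀ k, Measurable fun q : Inputs S N × Inputs S T => f k q.1 q.2)
    {g : Inputs S T → ℝ} (hg : Measurable g) (c : ℝ) :
    Measurable fun y : (Inputs S N × (∀ p, Fin (N p) → ℝ)) × (Fin R → Inputs S T) =>
      c * (∑ k, ((R : ℝ)⁻¹ * ∑ r, f k y.1.1 (y.2 r) -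
        wsum (f k y.1.1) y.1.1 y.1.2) ^ 2) / (1 + wsum g y.1.1 y.1.2) := by
  refine Measurable.div (Measurable.const_mul (Finset.measurable_fun_sum _ fun k _ => ?_) _) ?_
  · refine Measurable.pow_const (Measurable.sub (Measurable.const_mul
      (Finset.measurable_fun_sum _ fun r _ => ?_) _) ?_) 2
    · exact (hf k).comp ((measurable_fst.fst).prodMk
        ((measurable_pi_apply r).comp measurable_snd))
    · refine measurable_wsum (φ := fun y : (Inputs S N × (∀ p, Fin (N p) → ℝ)) ×
        (Fin R → Inputs S T) => f k y.1.1) ?_ measurable_fst.fst measurable_fst.snd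
      exact (hf k).comp (measurable_fst.fst.fst.prodMk measurable_snd)
  · exact (measurable_wsum (φ := fun _ : (Inputs S N × (∀ p, Fin (N p) → ℝ)) ×
      (Fin R → Inputs S T) => g) (hg.comp measurable_snd) measurable_fst.fst
      measurable_fst.snd).const_add 1

/-- Conditional mean squared error of the averages over the replications, normalized by their
conditional second moments. The normalization makes the expectation finite even though the second
moments, as functions of the data, are only bounded in probability. -/
theorem IsCondReplication.lintegral_sq_error_le (h𝒢 : 𝒢 ≤ mΩ)
    {X : Ω → Inputs S N} {W : Ω → ∀ p, Fin (N p) → ℝ} {Z : Ω → Fin R → Inputs S T}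
    (h : IsCondReplication P 𝒢 (fun ω => weightedEmpirical (X ω) (W ω)) Z)
    (hX : Measurable[𝒢] X) (hW : Measurable[𝒢] W) (hZ : Measurable Z)
    (hw : ∀ᵐ ω ∂P, IsWeight (W ω)) {κ : Type*} [Fintype κ]
    {f : κ → Inputs S N → Inputs S T → ℝ}
    (hf : ∀ k, Measurable fun q : Inputs S N × Inputs S T => f k q.1 q.2)
    {g : Inputs S T → ℝ} (hg : Measurable g) (hg0 : ∀ z, 0 ≤ g z)
    (hfg : ∀ᵐ ω ∂P, ∀ J : ∀ s : Slot T, Fin (N s.1),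
      ∑ k, f k (X ω) (sel J (X ω)) ^ 2 ≤ g (sel J (X ω)))
    (hR : 0 < R) {c : ℝ} (hc : 0 ≤ c) :
    ∫⁻ ω, ENNReal.ofReal (c * (∑ k, ((R : ℝ)⁻¹ * ∑ r, f k (X ω) (Z ω r) -
        wsum (f k (X ω)) (X ω) (W ω)) ^ 2) / (1 + wsum g (X ω) (W ω))) ∂P ≤
      ENNReal.ofReal (c / R) := by
  let Φ : (Inputs S N × (∀ p, Fin (N p) → ℝ)) × (Fin R → Inputs S T) → ℝ≥0∞ := fun y =>
    ENNReal.ofReal (c * (∑ k, ((R : ℝ)⁻¹ * ∑ r, f k y.1.1 (y.2 r) -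
        wsum (f k y.1.1) y.1.1 y.1.2) ^ 2) / (1 + wsum g y.1.1 y.1.2))
  have hΦ : Measurable Φ := (measurable_normalized_sq_error hf hg c).ennreal_ofReal
  refine (h.lintegral_eq h𝒢 hX hW hZ hw hΦ).trans_le ?_
  have hle : ∀ᵐ ω ∂P, ∫⁻ z, Φ ((X ω, W ω), z)
      ∂(Measure.pi fun _ : Fin R => inputLaw (weightedEmpirical (X ω) (W ω)) T) ≤
        ENNReal.ofReal (c / R) := by
    filter_upwards [hw, hfg] with ω hω hfgω
    have := hω.isProbabilityMeasure (X ω)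
    set Q := inputLaw (weightedEmpirical (X ω) (W ω)) T with hQ
    have hfm : ∀ k, Measurable (f k (X ω)) := fun k => (hf k).comp measurable_prodMk_left
    have hL : ∀ k, MemLp (f k (X ω)) 2 Q := fun k => memLp_inputLaw_weightedEmpirical hω _ (hfm k)
    have hLr : ∀ k, MemLp (fun z : Fin R → Inputs S T => (R : ℝ)⁻¹ * ∑ r, f k (X ω) (z r) -
        wsum (f k (X ω)) (X ω) (W ω)) 2 (Measure.pi fun _ : Fin R => Q) := fun k =>
      ((memLp_finsetSum _ fun r _ => (hL k).comp_measurePreserving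
        (measurePreserving_eval (fun _ : Fin R => Q) r)).const_mul _).sub (memLp_const _)
    have hd : 0 < 1 + wsum g (X ω) (W ω) := by
      have := wsum_nonneg hω (X ω) hg0
      linarith
    have hint : Integrable (fun z : Fin R → Inputs S T => c * (∑ k, ((R : ℝ)⁻¹ *
        ∑ r, f k (X ω) (z r) - wsum (f k (X ω)) (X ω) (W ω)) ^ 2) / (1 + wsum g (X ω) (W ω)))
        (Measure.pi fun _ : Fin R => Q) :=
      ((integrable_finsetSum _ fun k _ => (hLr k).integrable_sq).const_mul c).div_const _
    simp only [Φ]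
    rw [← ofReal_integral_eq_lintegral_ofReal hint (.of_forall fun z => by
      simp only [Pi.zero_apply]; positivity)]
    refine ENNReal.ofReal_le_ofReal ?_
    rw [integral_div, integral_const_mul, integral_finsetSum _ fun k _ => (hLr k).integrable_sq]
    have hk : ∀ k ∈ (Finset.univ : Finset κ), ∫ z : Fin R → Inputs S T, ((R : ℝ)⁻¹ *
        ∑ r, f k (X ω) (z r) - wsum (f k (X ω)) (X ω) (W ω)) ^ 2
          ∂(Measure.pi fun _ : Fin R => Q) ≤
        wsum (fun z => f k (X ω) z ^ 2) (X ω) (W ω) / R := by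
      intro k _
      have h1 := integral_sq_mean_sub_le (κ := Fin R) Q (hL k) (by simpa using hR)
      simp only [Fintype.card_fin] at h1
      rw [hQ, integral_inputLaw_weightedEmpirical hω _ (hfm k),
        integral_inputLaw_weightedEmpirical hω _ ((hfm k).pow_const 2)] at h1
      exact h1
    have h2 := Finset.sum_le_sum hk
    rw [← Finset.sum_div, ← wsum_finset_sum] at h2
    have h3 := wsum_mono (φ := fun z => ∑ k, f k (X ω) z ^ 2) (ψ := g) hω (X ω) hfgω
    have hR' : (0 : ℝ) < R := by exact_mod_cast hR
    rw [div_le_div_iff₀ hd hR']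
    rw [le_div_iff₀ hR'] at h2
    have h4 := mul_le_mul_of_nonneg_left (h2.trans h3) hc
    have h5 : 0 ≤ c := hc
    nlinarith
  calc _ ≤ ∫⁻ _, ENNReal.ofReal (c / R) ∂P := lintegral_mono_ae hle
    _ = _ := by simp

end Conditional

/-! ### The estimated linear objective -/

section Linear

variable {m : ℕ} {S : Fin m → Type*} {T N : Fin m → ℕ} {R : ℕ}

open Classical in
/-- The number of inputs in `z` that are equal to the data point `x_k`. -/
noncomputable def pointCount (k : Slot N) (x : Inputs S N) (z : Inputs S T) : ℝ :=
  ∑ t, if z k.1 t = x k.1 k.2 then 1 else 0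

lemma pointCount_nonneg (k : Slot N) (x : Inputs S N) (z : Inputs S T) :
    0 ≤ pointCount k x z := by
  classical
  exact Finset.sum_nonneg fun t _ => by split_ifs <;> norm_num

lemma pointCount_sel {x : Inputs S N} (hx : ∀ p, Function.Injective (x p))
    (J : ∀ s : Slot T, Fin (N s.1)) (p : Fin m) (j : Fin (N p)) :
    pointCount ⟨p, j⟩ x (sel J x) = ∑ t, if J ⟨p, t⟩ = j then 1 else 0 := by
  classical
  unfold pointCount
  refine Finset.sum_congr rfl fun t _ => ?_
  exact if_congr (hx p).eq_iff rfl rfl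

lemma sum_mul_pointCount_sel {x : Inputs S N} (hx : ∀ p, Function.Injective (x p))
    (J : ∀ s : Slot T, Fin (N s.1)) (b : ∀ p, Fin (N p) → ℝ) :
    ∑ k : Slot N, b k.1 k.2 * pointCount k x (sel J x) = ∑ s : Slot T, b s.1 (J s) := by
  rw [Fintype.sum_sigma, Fintype.sum_sigma]
  refine Finset.sum_congr rfl fun p _ => ?_
  simp only [pointCount_sel hx, Finset.mul_sum]
  rw [Finset.sum_comm]
  refine Finset.sum_congr rfl fun t _ => ?_
  simp

lemma sum_pointCount_sel {x : Inputs S N} (hx : ∀ p, Function.Injective (x p))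
    (J : ∀ s : Slot T, Fin (N s.1)) :
    ∑ k : Slot N, pointCount k x (sel J x) = Fintype.card (Slot T) := by
  simpa using sum_mul_pointCount_sel hx J fun _ _ => 1

lemma sum_sq_pointCount_sel_le {x : Inputs S N} (hx : ∀ p, Function.Injective (x p))
    (J : ∀ s : Slot T, Fin (N s.1)) :
    ∑ k : Slot N, pointCount k x (sel J x) ^ 2 ≤ (Fintype.card (Slot T) : ℝ) ^ 2 := by
  rw [← sum_pointCount_sel hx J]
  exact Finset.sum_sq_le_sq_sum_of_nonneg fun k _ => pointCount_nonneg k x _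

/-- The estimated linear objective in terms of the relative perturbations `b` of the uniform
weights. -/
noncomputable def linEst (h : Inputs S T → ℝ) (x : Inputs S N) (z : Fin R → Inputs S T)
    (b : ∀ p, Fin (N p) → ℝ) : ℝ :=
  ∑ p, ∑ j, influenceEst h x z p j * (b p j / N p)

variable [∀ p, MeasurableSpace (S p)]

/-- The simulation error of the joint empirical moments of outputs and point counts. -/
noncomputable def momentError (f : Inputs S T → ℝ) (x : Inputs S N) (z : Fin R → Inputs S T) : ℝ :=
  ∑ k : Slot N, ((R : ℝ)⁻¹ * ∑ r, f (z r) * pointCount k x (z r) -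
    vstat (fun y => f y * pointCount k x y) x) ^ 2

lemma linPart_eq_sum {x : Inputs S N} (hx : ∀ p, Function.Injective (x p))
    (h : Inputs S T → ℝ) (b : ∀ p, Fin (N p) → ℝ) :
    linPart h x b = ∑ k : Slot N, b k.1 k.2 * vstat (fun y => h y * pointCount k x y) x := by
  simp only [linPart, vstat, ← avgSel_const_mul, ← avgSel_sum]
  congr 1
  funext J
  rw [← sum_mul_pointCount_sel hx J b, Finset.mul_sum]
  refine Finset.sum_congr rfl fun k _ => by ring

lemma linEst_eq_sum (hN : ∀ p, 0 < N p) (h : Inputs S T → ℝ) (x : Inputs S N)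
    (z : Fin R → Inputs S T) {b : ∀ p, Fin (N p) → ℝ} (hb : ∀ p, ∑ j, b p j = 0) :
    linEst h x z b = ∑ k : Slot N, b k.1 k.2 * ((R : ℝ)⁻¹ * ∑ r, h (z r) * pointCount k x (z r)) -
      ((R : ℝ)⁻¹ * ∑ r, h (z r)) *
        ∑ k : Slot N, b k.1 k.2 * ((R : ℝ)⁻¹ * ∑ r, 1 * pointCount k x (z r)) := by
  rw [Fintype.sum_sigma, Fintype.sum_sigma, Finset.mul_sum, ← Finset.sum_sub_distrib]
  unfold linEst
  refine Finset.sum_congr rfl fun p _ => ?_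
  have hn : (N p : ℝ) ≠ 0 := Nat.cast_ne_zero.2 (hN p).ne'
  set hbar := (R : ℝ)⁻¹ * ∑ r, h (z r) with hhbar
  have e : ∀ j, influenceEst h x z p j * (b p j / N p) =
      b p j * ((R : ℝ)⁻¹ * ∑ r, h (z r) * pointCount ⟨p, j⟩ x (z r)) -
        hbar * (b p j * ((R : ℝ)⁻¹ * ∑ r, 1 * pointCount ⟨p, j⟩ x (z r))) -
        b p j * ((R : ℝ)⁻¹ * (∑ r, (h (z r) - hbar)) * T p / N p) := by
    intro j
    have e1 : influenceEst h x z p j = (R : ℝ)⁻¹ * ∑ r, (h (z r) - hbar) *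
        (N p * pointCount ⟨p, j⟩ x (z r) - T p) := rfl
    have e2 : ∀ r, (h (z r) - hbar) * (N p * pointCount ⟨p, j⟩ x (z r) - T p) =
        N p * (h (z r) * pointCount ⟨p, j⟩ x (z r)) -
          (N p * hbar) * (1 * pointCount ⟨p, j⟩ x (z r)) - T p * (h (z r) - hbar) := fun r => by
      ring
    rw [e1]
    simp only [e2, Finset.sum_sub_distrib, ← Finset.mul_sum]
    field_simp
  simp only [e, Finset.sum_sub_distrib, ← Finset.mul_sum, ← Finset.sum_mul, hb]
  ring

/-- The simulation error of the estimated linear objective, uniformly over perturbations `b` of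
bounded Euclidean norm. -/
theorem sq_linEst_sub_linPart_le (hN : ∀ p, 0 < N p) {x : Inputs S N}
    (hx : ∀ p, Function.Injective (x p)) (h : Inputs S T → ℝ) (z : Fin R → Inputs S T)
    {b : ∀ p, Fin (N p) → ℝ} (hb : ∀ p, ∑ j, b p j = 0) :
    (linEst h x z b - linPart h x b) ^ 2 ≤ 2 * (∑ k : Slot N, b k.1 k.2 ^ 2) *
      (momentError h x z + ((R : ℝ)⁻¹ * ∑ r, h (z r)) ^ 2 * momentError (fun _ : Inputs S T => 1) x z) := by
  -- the mean output multiplies a linear objective that vanishes, so that only its simulation error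
  -- remains
  have h1 : linPart (fun _ : Inputs S T => 1) x b = 0 := by
    simp only [linPart, one_mul]
    rw [avgSel_sum]
    refine Finset.sum_eq_zero fun s _ => ?_
    rw [avgSel_apply hN (fun s j => b s.1 j) s, hb, mul_zero]
  rw [linPart_eq_sum hx] at h1
  rw [linEst_eq_sum hN h x z hb, linPart_eq_sum hx]
  set hbar := (R : ℝ)⁻¹ * ∑ r, h (z r)
  have e : ∑ k : Slot N, b k.1 k.2 * ((R : ℝ)⁻¹ * ∑ r, h (z r) * pointCount k x (z r)) -
      hbar * ∑ k : Slot N, b k.1 k.2 * ((R : ℝ)⁻¹ * ∑ r, 1 * pointCount k x (z r)) -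
      ∑ k : Slot N, b k.1 k.2 * vstat (fun y => h y * pointCount k x y) x =
      (∑ k : Slot N, b k.1 k.2 * ((R : ℝ)⁻¹ * ∑ r, h (z r) * pointCount k x (z r) -
        vstat (fun y => h y * pointCount k x y) x)) -
      hbar * ∑ k : Slot N, b k.1 k.2 * ((R : ℝ)⁻¹ * ∑ r, 1 * pointCount k x (z r) -
        vstat (fun y : Inputs S T => 1 * pointCount k x y) x) := by
    simp only [mul_sub, Finset.sum_sub_distrib, h1]
    ring
  rw [e]
  have c1 := Finset.sum_mul_sq_le_sq_mul_sq Finset.univ (fun k : Slot N => b k.1 k.2)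
    fun k => (R : ℝ)⁻¹ * ∑ r, h (z r) * pointCount k x (z r) -
        vstat (fun y => h y * pointCount k x y) x
  have c2 := Finset.sum_mul_sq_le_sq_mul_sq Finset.univ (fun k : Slot N => b k.1 k.2)
    fun k => (R : ℝ)⁻¹ * ∑ r, 1 * pointCount k x (z r) -
        vstat (fun y : Inputs S T => 1 * pointCount k x y) x
  unfold momentError
  set A := ∑ k : Slot N, b k.1 k.2 * ((R : ℝ)⁻¹ * ∑ r, h (z r) * pointCount k x (z r) -
        vstat (fun y => h y * pointCount k x y) x)
  set B := ∑ k : Slot N, b k.1 k.2 * ((R : ℝ)⁻¹ * ∑ r, 1 * pointCount k x (z r) -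
        vstat (fun y : Inputs S T => 1 * pointCount k x y) x)
  have c3 : (A - hbar * B) ^ 2 ≤ 2 * A ^ 2 + 2 * (hbar ^ 2 * B ^ 2) := by
    nlinarith [sq_nonneg (A + hbar * B)]
  have c4 := mul_le_mul_of_nonneg_left c2 (sq_nonneg hbar)
  linarith

lemma measurable_pointCount [∀ p, MeasurableEq (S p)] (k : Slot N) :
    Measurable fun q : Inputs S N × Inputs S T => pointCount k q.1 q.2 := by
  classical
  unfold pointCount
  refine Finset.measurable_fun_sum _ fun t _ => ?_
  refine Measurable.ite ?_ measurable_const measurable_const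
  exact measurableSet_eq_fun (by fun_prop) (by fun_prop)

end Linear

/-! ### Simulation errors -/

section Asymptotics

variable {m : ℕ} {S : Fin m → Type*} [∀ p, MeasurableSpace (S p)] {T : Fin m → ℕ}
  {Ω : ℕ → Type*} {𝒢 : ∀ ν, MeasurableSpace (Ω ν)} [mΩ : ∀ ν, MeasurableSpace (Ω ν)]
  {P : ∀ ν, Measure (Ω ν)} [∀ ν, IsProbabilityMeasure (P ν)]
  {N : ℕ → Fin m → ℕ} {R : ℕ → ℕ} {n : ℕ → ℝ}
  {X : ∀ ν, Ω ν → Inputs S (N ν)} {W : ∀ ν, Ω ν → ∀ p, Fin (N ν p) → ℝ}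
  {Z : ∀ ν, Ω ν → Fin (R ν) → Inputs S T}

/-- Averages over replications are close to their conditional means when the number of
replications is of larger order than `n`. -/
theorem isSmallOP_mul_sq_error (h𝒢 : ∀ ν, 𝒢 ν ≤ mΩ ν)
    (h : ∀ ν, IsCondReplication (P ν) (𝒢 ν)
      (fun ω => weightedEmpirical (X ν ω) (W ν ω)) (Z ν))
    (hX : ∀ ν, Measurable[𝒢 ν] (X ν)) (hW : ∀ ν, Measurable[𝒢 ν] (W ν))
    (hZ : ∀ ν, Measurable (Z ν)) (hw : ∀ ν, ∀ᵐ ω ∂(P ν), IsWeight (W ν ω))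
    (hn : Tendsto n atTop atTop) (hR : Tendsto (fun ν => (R ν : ℝ) / n ν) atTop atTop)
    {κ : ℕ → Type*} [∀ ν, Fintype (κ ν)] {f : ∀ ν, κ ν → Inputs S (N ν) → Inputs S T → ℝ}
    (hf : ∀ ν k, Measurable fun q : Inputs S (N ν) × Inputs S T => f ν k q.1 q.2)
    {g : Inputs S T → ℝ} (hg : Measurable g) (hg0 : ∀ z, 0 ≤ g z)
    (hfg : ∀ ν, ∀ᵐ ω ∂(P ν), ∀ J : ∀ s : Slot T, Fin (N ν s.1),
      ∑ k, f ν k (X ν ω) (sel J (X ν ω)) ^ 2 ≤ g (sel J (X ν ω)))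
    (hb : IsBigOP P fun ν ω => wsum g (X ν ω) (W ν ω)) :
    IsSmallOP P fun ν ω => n ν * ∑ k, ((R ν : ℝ)⁻¹ * ∑ r, f ν k (X ν ω) (Z ν ω r) -
        wsum (f ν k (X ν ω)) (X ν ω) (W ν ω)) ^ 2 := by
  have hX' : ∀ ν, Measurable (X ν) := fun ν => (hX ν).mono (h𝒢 ν) le_rfl
  have hW' : ∀ ν, Measurable (W ν) := fun ν => (hW ν).mono (h𝒢 ν) le_rfl
  have h1 : IsSmallOP P fun ν ω => n ν * (∑ k, ((R ν : ℝ)⁻¹ * ∑ r, f ν k (X ν ω) (Z ν ω r) -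
        wsum (f ν k (X ν ω)) (X ν ω) (W ν ω)) ^ 2) / (1 + wsum g (X ν ω) (W ν ω)) := by
    refine isSmallOP_of_lintegral (fun ν => ((measurable_normalized_sq_error (hf ν) hg (n ν)).comp
      (((hX' ν).prodMk (hW' ν)).prodMk (hZ ν))).aemeasurable) ?_
    have h0 : Tendsto (fun ν => ENNReal.ofReal (n ν / R ν)) atTop (𝓝 0) := by
      have h2 := ENNReal.tendsto_ofReal hR.inv_tendsto_atTop
      simpa [inv_div] using h2
    refine tendsto_of_tendsto_of_tendsto_of_le_of_le' tendsto_const_nhds h0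
      (.of_forall fun _ => zero_le) ?_
    filter_upwards [hn.eventually_gt_atTop 0, hR.eventually_gt_atTop 0] with ν hν hRν
    have hRpos : 0 < R ν := by
      rcases Nat.eq_zero_or_pos (R ν) with h0 | h0
      · simp [h0] at hRν
      · exact h0
    refine le_trans (le_of_eq (lintegral_congr_ae ?_)) ((h ν).lintegral_sq_error_le (h𝒢 ν) (hX ν)
      (hW ν) (hZ ν) (hw ν) (hf ν) hg hg0 (hfg ν) hRpos hν.le)
    filter_upwards [hw ν] with ω hω
    have := wsum_nonneg hω (X ν ω) hg0
    rw [abs_of_nonneg (by positivity)]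
  have hb1 : IsBigOP P fun ν ω => 1 + wsum g (X ν ω) (W ν ω) :=
    (isBigOP_of_tendsto (P := P) (tendsto_const_nhds (x := (1 : ℝ)))).add hb
  refine (h1.mul_isBigOP hb1).mono (.of_forall fun ν => ?_)
  filter_upwards [hw ν] with ω hω
  have := wsum_nonneg hω (X ν ω) hg0
  rw [div_mul_cancel₀ _ (by positivity)]

/-- The error of the second simulation stage is `o_P(n^{-1/2})`. -/
theorem isSmallOP_sqrt_mul_error (h𝒢 : ∀ ν, 𝒢 ν ≤ mΩ ν)
    (h : ∀ ν, IsCondReplication (P ν) (𝒢 ν)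
      (fun ω => weightedEmpirical (X ν ω) (W ν ω)) (Z ν))
    (hX : ∀ ν, Measurable[𝒢 ν] (X ν)) (hW : ∀ ν, Measurable[𝒢 ν] (W ν))
    (hZ : ∀ ν, Measurable (Z ν)) (hw : ∀ ν, ∀ᵐ ω ∂(P ν), IsWeight (W ν ω))
    (hn : Tendsto n atTop atTop) (hR : Tendsto (fun ν => (R ν : ℝ) / n ν) atTop atTop)
    {φ : Inputs S T → ℝ} (hφ : Measurable φ)
    (hb : IsBigOP P fun ν ω => wsum (fun z => φ z ^ 2) (X ν ω) (W ν ω)) :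
    IsSmallOP P fun ν ω => √(n ν) * ((R ν : ℝ)⁻¹ * ∑ r, φ (Z ν ω r) -
        wsum φ (X ν ω) (W ν ω)) := by
  have h1 := isSmallOP_mul_sq_error (κ := fun _ => Unit) (f := fun _ _ _ z => φ z) h𝒢 h hX hW hZ
    hw hn hR (fun ν _ => hφ.comp measurable_snd) (hφ.pow_const 2) (fun z => sq_nonneg _)
    (fun ν => .of_forall fun ω J => by simp) hb
  refine IsSmallOP.of_sq (h1.mono ?_)
  filter_upwards [hn.eventually_ge_atTop 0] with ν hν
  refine .of_forall fun ω => le_of_eq ?_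
  rw [mul_pow, Real.sq_sqrt hν]
  simp

end Asymptotics

section StageOne

variable {m : ℕ} {S : Fin m → Type*} [∀ p, MeasurableSpace (S p)] [∀ p, MeasurableEq (S p)]
  {T : Fin m → ℕ}
  {Ω : ℕ → Type*} {𝒢 : ∀ ν, MeasurableSpace (Ω ν)} [mΩ : ∀ ν, MeasurableSpace (Ω ν)]
  {P : ∀ ν, Measure (Ω ν)} [∀ ν, IsProbabilityMeasure (P ν)]
  {N : ℕ → Fin m → ℕ} {R : ℕ → ℕ} {n : ℕ → ℝ}
  {X : ∀ ν, Ω ν → Inputs S (N ν)} {Z : ∀ ν, Ω ν → Fin (R ν) → Inputs S T}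

/-- The error of the first simulation stage: the squared simulation errors are summed over all data
points, but each replication hits at most as many data points as it has slots, so that the sum is
of the same order as for a single average. -/
theorem isSmallOP_momentError (h𝒢 : ∀ ν, 𝒢 ν ≤ mΩ ν)
    (h : ∀ ν, IsCondReplication (P ν) (𝒢 ν) (fun ω => empirical (X ν ω)) (Z ν))
    (hX : ∀ ν, Measurable[𝒢 ν] (X ν)) (hN : ∀ ν p, 0 < N ν p)
    (hinj : ∀ ν, ∀ᵐ ω ∂(P ν), ∀ p, Function.Injective (X ν ω p))
    (hZ : ∀ ν, Measurable (Z ν))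
    (hn : Tendsto n atTop atTop) (hR : Tendsto (fun ν => (R ν : ℝ) / n ν) atTop atTop)
    {φ : Inputs S T → ℝ} (hφ : Measurable φ)
    (hb : IsBigOP P fun ν ω => vstat (fun z => φ z ^ 2) (X ν ω)) :
    IsSmallOP P fun ν ω => n ν * momentError φ (X ν ω) (Z ν ω) := by
  have hw : ∀ ν, ∀ᵐ _ω ∂(P ν), IsWeight fun p (_ : Fin (N ν p)) => (N ν p : ℝ)⁻¹ :=
    fun ν => .of_forall fun _ => isWeight_uniform (hN ν)
  have h1 := isSmallOP_mul_sq_error (κ := fun ν => Slot (N ν))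
    (W := fun ν _ p (_ : Fin (N ν p)) => (N ν p : ℝ)⁻¹)
    (f := fun _ k x z => φ z * pointCount k x z)
    (g := fun z => (Fintype.card (Slot T) : ℝ) ^ 2 * φ z ^ 2) h𝒢 h hX
    (fun ν => measurable_const) hZ hw hn hR
    (fun ν k => (hφ.comp measurable_snd).mul (measurable_pointCount k))
    ((hφ.pow_const 2).const_mul _) (fun z => by positivity) (fun ν => ?_) ?_
  · refine h1.mono (.of_forall fun ν => .of_forall fun ω => le_of_eq ?_)
    simp only [momentError, wsum_uniform (hN ν)]
  · filter_upwards [hinj ν] with ω hω J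
    simp only [mul_pow, ← Finset.mul_sum]
    rw [mul_comm]
    exact mul_le_mul_of_nonneg_right (sum_sq_pointCount_sel_le hω J) (sq_nonneg _)
  · refine (hb.const_mul ((Fintype.card (Slot T) : ℝ) ^ 2)).mono
      (.of_forall fun ν => .of_forall fun ω => le_of_eq ?_)
    rw [wsum_uniform (hN ν)]
    simp only [vstat, avgSel_const_mul]

end StageOne

/-! ### The empirical likelihood ambiguity set -/

section AmbiguitySet

variable {m : ℕ} {N : Fin m → ℕ} {q : ℝ} {w : ∀ p, Fin (N p) → ℝ}

/-- The relative perturbations `N_p w_{pj} - 1` of the uniform weights that lead to the weights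
`w`. -/
def relDev (w : ∀ p, Fin (N p) → ℝ) : ∀ p, Fin (N p) → ℝ := fun p j => N p * w p j - 1

lemma isWeight_of_mem_ambiguitySet (hw : w ∈ ambiguitySet N q) : IsWeight w :=
  ⟨fun p j => (hw.1 p j).le, hw.2.1⟩

lemma IsWeight.sum_relDev (hw : IsWeight w) (p : Fin m) : ∑ j, relDev w p j = 0 := by
  simp [relDev, Finset.sum_sub_distrib, ← Finset.mul_sum, hw.2 p]

lemma sq_sqrt_sub_one_le {u : ℝ} (hu : 0 < u) : (√u - 1) ^ 2 ≤ u - 1 - Real.log u := by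
  have h1 := Real.log_le_sub_one_of_pos (Real.sqrt_pos.2 hu)
  rw [Real.log_sqrt hu.le] at h1
  nlinarith [Real.sq_sqrt hu.le]

/-- The likelihood ratio bounds the squared Hellinger-type distance to the uniform weights. -/
lemma sum_sq_sqrt_sub_one_le (hN : ∀ p, 0 < N p) (hw : w ∈ ambiguitySet N q) :
    ∑ k : Slot N, (√(N k.1 * w k.1 k.2) - 1) ^ 2 ≤ q / 2 := by
  have h1 : ∑ k : Slot N, (√(N k.1 * w k.1 k.2) - 1) ^ 2 ≤
      ∑ k : Slot N, (relDev w k.1 k.2 - Real.log (N k.1 * w k.1 k.2)) :=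
    Finset.sum_le_sum fun k _ => sq_sqrt_sub_one_le
      (mul_pos (Nat.cast_pos.2 (hN k.1)) (hw.1 k.1 k.2))
  have h2 := hw.2.2
  rw [Fintype.sum_sigma] at h1
  rw [Fintype.sum_sigma]
  simp only [Fintype.sum_sigma, Finset.sum_sub_distrib,
    (isWeight_of_mem_ambiguitySet hw).sum_relDev, Finset.sum_const_zero] at h1
  linarith

lemma sqrt_mul_weight_sub_one_le (hN : ∀ p, 0 < N p) (hw : w ∈ ambiguitySet N q) (p : Fin m)
    (j : Fin (N p)) : √(N p * w p j) ≤ 1 + √(q / 2) := by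
  have h1 := (Finset.single_le_sum (f := fun k : Slot N => (√(N k.1 * w k.1 k.2) - 1) ^ 2)
    (fun k _ => sq_nonneg _) (Finset.mem_univ ⟨p, j⟩)).trans (sum_sq_sqrt_sub_one_le hN hw)
  have h2 := Real.le_sqrt_of_sq_le h1
  simp only at h2
  linarith

lemma mul_weight_le (hN : ∀ p, 0 < N p) (hw : w ∈ ambiguitySet N q) (p : Fin m)
    (j : Fin (N p)) : N p * w p j ≤ (1 + √(q / 2)) ^ 2 := by
  have h0 : 0 ≤ N p * w p j := mul_nonneg (Nat.cast_nonneg _) (hw.1 p j).le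
  rw [← Real.sq_sqrt h0]
  exact pow_le_pow_left₀ (Real.sqrt_nonneg _) (sqrt_mul_weight_sub_one_le hN hw p j) 2

/-- The ambiguity set lies within a fixed Euclidean distance, on the scale of relative
perturbations, of the uniform weights. -/
lemma sum_sq_relDev_le (hN : ∀ p, 0 < N p) (hw : w ∈ ambiguitySet N q) :
    ∑ k : Slot N, relDev w k.1 k.2 ^ 2 ≤ (2 + √(q / 2)) ^ 2 * (q / 2) := by
  refine le_trans ?_ (mul_le_mul_of_nonneg_left (sum_sq_sqrt_sub_one_le hN hw) (sq_nonneg _))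
  rw [Finset.mul_sum]
  refine Finset.sum_le_sum fun k _ => ?_
  have h0 : 0 ≤ N k.1 * w k.1 k.2 := mul_nonneg (Nat.cast_nonneg _) (hw.1 k.1 k.2).le
  have e : relDev w k.1 k.2 ^ 2 =
      (√(N k.1 * w k.1 k.2) + 1) ^ 2 * (√(N k.1 * w k.1 k.2) - 1) ^ 2 := by
    rw [← mul_pow, relDev]
    congr 1
    nlinarith [Real.sq_sqrt h0]
  rw [e]
  refine mul_le_mul_of_nonneg_right ?_ (sq_nonneg _)
  refine pow_le_pow_left₀ (by positivity) ?_ 2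
  linarith [sqrt_mul_weight_sub_one_le hN hw k.1 k.2]

lemma neg_two_mul_log_one_add_le {b τ : ℝ} (hb : |b| ≤ τ) (hτ : τ ≤ 1 / 2) :
    -2 * Real.log (1 + b) ≤ -2 * b + b ^ 2 * (1 + 4 * τ) := by
  have h1 := Real.abs_log_sub_add_sum_range_le (x := -b) (by rw [abs_neg]; linarith) 2
  rw [abs_neg, sub_neg_eq_add] at h1
  have h2 : |b| ^ (2 + 1) / (1 - |b|) ≤ 2 * τ * b ^ 2 := by
    rw [div_le_iff₀ (by linarith), pow_succ, sq_abs]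
    nlinarith [mul_nonneg (sq_nonneg b) (abs_nonneg b), mul_nonneg (sq_nonneg b)
      (sub_nonneg.2 hb), mul_nonneg (mul_nonneg (sq_nonneg b) ((abs_nonneg b).trans hb))
      (show 0 ≤ 1 / 2 - |b| by linarith)]
  have h3 := (abs_le.1 (h1.trans h2)).1
  norm_num [Finset.sum_range_succ] at h3
  linarith

/-- Small perturbations of the uniform weights belong to the ambiguity set if, up to a factor
close to one, their Euclidean norm does not exceed the threshold. -/
lemma mem_ambiguitySet_of_small (hN : ∀ p, 0 < N p) {b : ∀ p, Fin (N p) → ℝ}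
    (hb : ∀ p, ∑ j, b p j = 0) {τ : ℝ} (hτ : τ ≤ 1 / 2) (hbτ : ∀ p j, |b p j| ≤ τ)
    (hsum : (∑ k : Slot N, b k.1 k.2 ^ 2) * (1 + 4 * τ) ≤ q) :
    (fun p j => (1 + b p j) / N p) ∈ ambiguitySet N q := by
  have hN' : ∀ p, (0 : ℝ) < N p := fun p => Nat.cast_pos.2 (hN p)
  refine ⟨fun p j => ?_, fun p => ?_, ?_⟩
  · have := (abs_le.1 (hbτ p j)).1
    have := hN' p
    have : 0 < 1 + b p j := by linarith
    positivity
  · rw [← Finset.sum_div, Finset.sum_add_distrib, hb p]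
    simp [(hN' p).ne']
  · refine le_trans ?_ hsum
    rw [Fintype.sum_sigma, Finset.mul_sum, Finset.sum_mul]
    refine Finset.sum_le_sum fun p _ => ?_
    have h1 : ∑ j, (-2 * Real.log (N p * ((1 + b p j) / N p))) ≤
        ∑ j, (-2 * b p j + b p j ^ 2 * (1 + 4 * τ)) := by
      refine Finset.sum_le_sum fun j _ => ?_
      rw [mul_div_cancel₀ _ (hN' p).ne']
      exact neg_two_mul_log_one_add_le (hbτ p j) hτ
    rw [← Finset.mul_sum, Finset.sum_add_distrib, ← Finset.mul_sum, hb p, ← Finset.sum_mul] at h1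
    simpa using h1

end AmbiguitySet

section Weighted

variable {m : ℕ} {S : Fin m → Type*} {T N : Fin m → ℕ}

lemma relDev_one_add_div (hN : ∀ p, 0 < N p) (b : ∀ p, Fin (N p) → ℝ) :
    relDev (fun p j => (1 + b p j) / N p) = b := by
  funext p j
  have : (N p : ℝ) ≠ 0 := Nat.cast_ne_zero.2 (hN p).ne'
  simp only [relDev]
  field_simp
  ring

/-- Second moments under weights in the ambiguity set are bounded by a fixed multiple of those under
the uniform weights, because each relative weight `N_p w_{pj}` is bounded. -/
lemma wsum_sq_le [∀ p, MeasurableSpace (S p)] (hN : ∀ p, 0 < N p) {q : ℝ}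
    {w : ∀ p, Fin (N p) → ℝ} (hw : w ∈ ambiguitySet N q) (φ : Inputs S T → ℝ) (x : Inputs S N) :
    wsum (fun z => φ z ^ 2) x w ≤
      ((1 + √(q / 2)) ^ 2) ^ Fintype.card (Slot T) * vstat (fun z => φ z ^ 2) x := by
  rw [wsum_eq_avgSel hN, vstat, ← avgSel_const_mul]
  refine avgSel_mono fun J => ?_
  rw [mul_comm]
  refine mul_le_mul_of_nonneg_right ?_ (sq_nonneg _)
  refine (Finset.prod_le_prod (fun s _ => mul_nonneg (Nat.cast_nonneg _) (hw.1 s.1 (J s)).le)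
    fun s _ => mul_weight_le hN hw s.1 (J s)).trans (le_of_eq ?_)
  rw [Finset.prod_const, Finset.card_univ]

/-- The estimated objective differs from the difference of the two linear objectives only by its
value at the uniform weights. -/
lemma objective_eq [∀ p, MeasurableSpace (S p)] {k R₁ R₂ : ℕ} {T : Fin k → Fin m → ℕ} {Ω : Type*}
    (hN : ∀ p, 0 < N p) (ρ : Run S T N R₁ R₂ Ω) (h : ∀ i, Inputs S (T i) → ℝ) (i ℓ : Fin k)
    (ω : Ω) (w : ∀ p, Fin (N p) → ℝ) :
    ρ.objective h i ℓ ω w =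
      ∑ p, ∑ j, (influenceEst (h i) (ρ.data ω) (ρ.sim₁ i ω) p j -
        influenceEst (h ℓ) (ρ.data ω) (ρ.sim₁ ℓ ω) p j) / N p +
      (linEst (h i) (ρ.data ω) (ρ.sim₁ i ω) (relDev w) -
        linEst (h ℓ) (ρ.data ω) (ρ.sim₁ ℓ ω) (relDev w)) := by
  simp only [Run.objective, linEst, ← Finset.sum_add_distrib, ← Finset.sum_sub_distrib]
  refine Finset.sum_congr rfl fun p _ => Finset.sum_congr rfl fun j _ => ?_
  have : (N p : ℝ) ≠ 0 := Nat.cast_ne_zero.2 (hN p).ne'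
  simp only [relDev]
  field_simp
  ring

end Weighted

/-! ### Kernels with fourth moments -/

section FourthMoments

lemma memLp_sq_two_iff {α : Type*} [MeasurableSpace α] {μ : Measure α} {f : α → ℝ}
    (hf : Measurable f) : MemLp (fun a => f a ^ 2) 2 μ ↔ MemLp f 4 μ := by
  have h := memLp_norm_rpow_iff (p := 4) (q := 2) hf.aestronglyMeasurable (μ := μ) (by simp)
    (by simp)
  have h2 : (4 : ℝ≥0∞) / 2 = 2 := by
    rw [show (4 : ℝ≥0∞) = 2 * 2 by norm_num, ENNReal.mul_div_cancel_right (by simp) (by simp)]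
  rw [h2] at h
  simpa using h

variable {m : ℕ} {S : Fin m → Type*} [∀ p, MeasurableSpace (S p)]
  {F : ∀ p, Measure (S p)} [∀ p, IsProbabilityMeasure (F p)] {T : Fin m → ℕ}
  {φ : Inputs S T → ℝ}

lemma memLp_four_slotProj (hm : Measurable φ) (h : MemLp (fun z => φ z ^ 2) 2 (inputLaw F T))
    (s : Slot T) : MemLp (slotProj F φ s) 4 (F s.1) := by
  refine MemLp.sub ?_ (memLp_const _)
  refine (memLp_sq_two_iff ?_).1 (memLp_two_sq_integral (hm.comp (measurable_updateSlot s))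
    (memLp_comp_updateSlot h s))
  exact (StronglyMeasurable.integral_prod_right'
    (hm.comp (measurable_updateSlot s)).stronglyMeasurable).measurable

/-- By `|φ g| ≤ φ² + g²`, fourth moments make the product kernel square integrable. -/
lemma ReuseMemLp.mul_eval (hm : Measurable φ) (h : ReuseMemLp F fun z => φ z ^ 2) {s : Slot T}
    {g : S s.1 → ℝ} (hg : Measurable g) (hg4 : MemLp g 4 (F s.1)) :
    ReuseMemLp F fun z => φ z * g (z s.1 s.2) := by
  have hm' : Measurable fun z : Inputs S T => φ z * g (z s.1 s.2) := by fun_prop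
  have h2 := reuseMemLp_eval (T := T) (s := s) (hg.pow_const 2) ((memLp_sq_two_iff hg).2 hg4)
  refine ⟨hm', fun I => ?_⟩
  refine ((h.memLp I).add (h2.memLp I)).mono
    (hm'.comp (measurable_reuse I)).aestronglyMeasurable (.of_forall fun z => ?_)
  simp only [Pi.add_apply, Real.norm_eq_abs]
  set a := φ fun p t => z p (I p t)
  set b := g (z s.1 (I s.1 s.2))
  rw [abs_of_nonneg (a := a ^ 2 + b ^ 2) (by positivity), abs_le]
  constructor <;> nlinarith [sq_nonneg (a + b), sq_nonneg (a - b)]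

lemma integral_mul_eval_eq (hm : Measurable φ) {s : Slot T} {g : S s.1 → ℝ}
    (hg : Measurable g) (hgi : Integrable g (F s.1)) (hg0 : ∫ ξ, g ξ ∂(F s.1) = 0)
    (hi : Integrable (fun z => φ z * g (z s.1 s.2)) (inputLaw F T)) :
    ∫ z, φ z * g (z s.1 s.2) ∂(inputLaw F T) = ∫ ξ, slotProj F φ s ξ * g ξ ∂(F s.1) := by
  have hm' : Measurable fun z : Inputs S T => φ z * g (z s.1 s.2) := by fun_prop
  have h1 := integral_comp_updateSlot hm' hi s
  simp only [updateSlot_apply_self, integral_mul_const] at h1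
  have h2 : Integrable (fun ξ => (∫ z, φ (updateSlot z s ξ) ∂(inputLaw F T)) * g ξ) (F s.1) := by
    have h3 := ((measurePreserving_updateSlot F s).integrable_comp_of_integrable hi).integral_prod_left
    simpa only [Function.comp_def, updateSlot_apply_self, integral_mul_const] using h3
  simp only [slotProj, sub_mul]
  rw [integral_sub h2 (hgi.const_mul _), integral_const_mul, hg0, mul_zero, sub_zero, h1]

end FourthMoments

/-! ### Tilted weights -/

section Tilt

variable {m : ℕ} {S : Fin m → Type*} {T N : Fin m → ℕ}

/-- The mean of `f` over the data of source `p`. -/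
noncomputable def dataMean {p : Fin m} (f : S p → ℝ) (x : Inputs S N) : ℝ :=
  (N p : ℝ)⁻¹ * ∑ j, f (x p j)

/-- The relative perturbation of the uniform weights in the direction of the centred values of `g`,
with factor `c / N_p` for source `p`. -/
noncomputable def tilt (c : ℝ) (g : ∀ p, S p → ℝ) (x : Inputs S N) (p : Fin m) (j : Fin (N p)) : ℝ :=
  c / N p * (g p (x p j) - dataMean (g p) x)

lemma sum_tilt (hN : ∀ p, 0 < N p) (c : ℝ) (g : ∀ p, S p → ℝ) (x : Inputs S N) (p : Fin m) :
    ∑ j, tilt c g x p j = 0 := by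
  have : (N p : ℝ) ≠ 0 := Nat.cast_ne_zero.2 (hN p).ne'
  simp only [tilt, ← Finset.mul_sum, Finset.sum_sub_distrib, dataMean]
  simp [this]

lemma sum_sq_tilt (hN : ∀ p, 0 < N p) (c : ℝ) (g : ∀ p, S p → ℝ) (x : Inputs S N) (p : Fin m) :
    ∑ j, tilt c g x p j ^ 2 =
      c ^ 2 / N p * (dataMean (fun ξ => g p ξ ^ 2) x - dataMean (g p) x ^ 2) := by
  have hn : (N p : ℝ) ≠ 0 := Nat.cast_ne_zero.2 (hN p).ne'
  have e : ∑ j, g p (x p j) = N p * dataMean (g p) x := by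
    rw [dataMean, mul_inv_cancel_left₀ hn]
  have e2 : ∑ j, g p (x p j) ^ 2 = N p * dataMean (fun ξ => g p ξ ^ 2) x := by
    rw [dataMean, mul_inv_cancel_left₀ hn]
  simp only [tilt, mul_pow, sub_sq, ← Finset.mul_sum, Finset.sum_add_distrib,
    Finset.sum_sub_distrib, ← Finset.sum_mul, e, e2, Finset.sum_const, Finset.card_univ,
    Fintype.card_fin, nsmul_eq_mul]
  field_simp
  ring

lemma sum_pow_four_tilt_le (hN : ∀ p, 0 < N p) (c : ℝ) (g : ∀ p, S p → ℝ) (x : Inputs S N)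
    (p : Fin m) : ∑ j, tilt c g x p j ^ 4 ≤
      c ^ 4 / N p ^ 3 * (8 * dataMean (fun ξ => g p ξ ^ 4) x + 8 * dataMean (g p) x ^ 4) := by
  have hn : (N p : ℝ) ≠ 0 := Nat.cast_ne_zero.2 (hN p).ne'
  have e2 : ∑ j, g p (x p j) ^ 4 = N p * dataMean (fun ξ => g p ξ ^ 4) x := by
    rw [dataMean, mul_inv_cancel_left₀ hn]
  have h1 : ∀ j, tilt c g x p j ^ 4 ≤
      (c / N p) ^ 4 * (8 * g p (x p j) ^ 4 + 8 * dataMean (g p) x ^ 4) := fun j => by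
    rw [tilt, mul_pow]
    refine mul_le_mul_of_nonneg_left ?_ (by positivity)
    set a := g p (x p j)
    set b := dataMean (g p) x
    have h2 : (a - b) ^ 2 ≤ 2 * a ^ 2 + 2 * b ^ 2 := by nlinarith [sq_nonneg (a + b)]
    have h3 := pow_le_pow_left₀ (sq_nonneg (a - b)) h2 2
    nlinarith [sq_nonneg (a ^ 2 - b ^ 2)]
  refine (Finset.sum_le_sum fun j _ => h1 j).trans (le_of_eq ?_)
  rw [← Finset.mul_sum, Finset.sum_add_distrib, ← Finset.mul_sum, e2]
  simp only [Finset.sum_const, Finset.card_univ, Fintype.card_fin, nsmul_eq_mul]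
  field_simp

lemma linPart_tilt (φ : Inputs S T → ℝ) (c : ℝ) (g : ∀ p, S p → ℝ)
    (x : Inputs S N) :
    linPart φ x (tilt c g x) = ∑ s : Slot T, c / N s.1 *
      (vstat (fun z => φ z * g s.1 (z s.1 s.2)) x - dataMean (g s.1) x * vstat φ x) := by
  simp only [linPart, vstat, ← avgSel_const_mul, ← avgSel_sum, ← avgSel_sub]
  congr 1
  funext J
  rw [Finset.mul_sum]
  refine Finset.sum_congr rfl fun s _ => ?_
  simp only [tilt, sel]
  ring

end Tilt

section TiltAsymptotics

variable {m : ℕ} {S : Fin m → Type*} [∀ p, MeasurableSpace (S p)]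
  {F : ∀ p, Measure (S p)} [∀ p, IsProbabilityMeasure (F p)] {T : Fin m → ℕ}
  {φ : Inputs S T → ℝ} {g : ∀ p, S p → ℝ} {N : ℕ → Fin m → ℕ} {n : ℕ → ℝ} {c : ℝ}
  {β : Fin m → ℝ}

lemma tendsto_mul_div (hβ : ∀ p, 0 < β p)
    (hNβ : ∀ p, Tendsto (fun ν => (N ν p : ℝ) / n ν) atTop (𝓝 (β p))) (a : ℝ) (p : Fin m) :
    Tendsto (fun ν => a * n ν / N ν p) atTop (𝓝 (a / β p)) := by
  have h := ((hNβ p).inv₀ (hβ p).ne').const_mul a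
  refine h.congr fun ν => ?_
  rw [inv_div, mul_div_assoc]

/-- The squared norm of the tilt converges in probability. -/
theorem isSmallOP_sum_sq_tilt (hN : ∀ ν p, 0 < N ν p) (hn : Tendsto n atTop atTop) (hc : 0 < c)
    (hcN : ∀ᶠ ν in atTop, ∀ p, c * n ν ≤ N ν p) (hβ : ∀ p, 0 < β p)
    (hNβ : ∀ p, Tendsto (fun ν => (N ν p : ℝ) / n ν) atTop (𝓝 (β p)))
    (hg : ∀ p, Measurable (g p)) (hg4 : ∀ p, MemLp (g p) 4 (F p))
    (hg0 : ∀ p, ∫ ξ, g p ξ ∂(F p) = 0) (a : ℝ) :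
    IsSmallOP (fun ν => inputLaw F (N ν)) fun ν x =>
      ∑ k : Slot (N ν), tilt (a * √(n ν)) g x k.1 k.2 ^ 2 -
        a ^ 2 * ∑ p, (∫ ξ, g p ξ ^ 2 ∂(F p)) / β p := by
  have h1 : ∀ p, IsSmallOP (fun ν => inputLaw F (N ν)) fun ν x =>
      a ^ 2 * n ν / N ν p * (dataMean (fun ξ => g p ξ ^ 2) x - dataMean (g p) x ^ 2) -
        a ^ 2 / β p * ∫ ξ, g p ξ ^ 2 ∂(F p) := fun p => by
    refine isSmallOP_mul_sub (tendsto_mul_div hβ hNβ _ p) ?_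
    have h2 := isSmallOP_mean (F := F) hN hn hc hcN ((hg p).pow_const 2)
      ((memLp_sq_two_iff (hg p)).2 (hg4 p))
    have h3 := isSmallOP_mean (F := F) hN hn hc hcN (hg p)
      ((hg4 p).mono_exponent (by norm_num))
    simp only [hg0, sub_zero] at h3
    refine (h2.sub (h3.mul_isBigOP h3.isBigOP)).mono (.of_forall fun ν => .of_forall fun x => le_of_eq ?_)
    congr 1
    simp only [dataMean]
    ring
  refine (IsSmallOP.sum Finset.univ fun p _ => h1 p).mono ?_
  filter_upwards [hn.eventually_ge_atTop 0] with ν hν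
  refine .of_forall fun x => le_of_eq ?_
  congr 1
  rw [Fintype.sum_sigma, Finset.mul_sum, ← Finset.sum_sub_distrib]
  refine Finset.sum_congr rfl fun p _ => ?_
  rw [sum_sq_tilt (hN ν), mul_pow, Real.sq_sqrt hν]
  ring

/-- The tilt is small in the fourth-power norm, hence uniformly small. -/
theorem isSmallOP_sum_pow_four_tilt (hN : ∀ ν p, 0 < N ν p) (hn : Tendsto n atTop atTop)
    (hc : 0 < c) (hcN : ∀ᶠ ν in atTop, ∀ p, c * n ν ≤ N ν p) (hβ : ∀ p, 0 < β p)
    (hNβ : ∀ p, Tendsto (fun ν => (N ν p : ℝ) / n ν) atTop (𝓝 (β p)))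
    (hg : ∀ p, Measurable (g p)) (hg4 : ∀ p, MemLp (g p) 4 (F p)) (a : ℝ) :
    IsSmallOP (fun ν => inputLaw F (N ν)) fun ν x =>
      ∑ k : Slot (N ν), tilt (a * √(n ν)) g x k.1 k.2 ^ 4 := by
  have h1 : ∀ p, IsSmallOP (fun ν => inputLaw F (N ν)) fun ν x =>
      (a ^ 2 * n ν / N ν p) * (a ^ 2 * n ν / N ν p) * (1 / N ν p) *
        (8 * dataMean (fun ξ => g p ξ ^ 4) x + 8 * dataMean (g p) x ^ 4) := fun p => by
    have hi : Integrable (fun ξ => g p ξ ^ 4) (F p) := by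
      have := ((memLp_sq_two_iff (hg p)).2 (hg4 p)).integrable_sq
      simpa only [← pow_mul] using this
    have hmean : ∀ ν, Integrable (fun x : Inputs S (N ν) => dataMean (fun ξ => g p ξ ^ 4) x)
        (inputLaw F (N ν)) := fun ν =>
      (integrable_finsetSum _ fun j _ => (measurePreserving_eval_inputLaw F
        (⟨p, j⟩ : Slot (N ν))).integrable_comp_of_integrable hi).const_mul _
    have h2 : IsBigOP (fun ν => inputLaw F (N ν)) fun ν (x : Inputs S (N ν)) =>
        dataMean (fun ξ => g p ξ ^ 4) x := by
      refine isBigOP_of_integral (C := ∫ ξ, g p ξ ^ 4 ∂(F p)) hmean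
        (fun ν x => mul_nonneg (by positivity) (Finset.sum_nonneg fun _ _ => by positivity))
        fun ν => le_of_eq ?_
      have hν : (N ν p : ℝ) ≠ 0 := Nat.cast_ne_zero.2 (hN ν p).ne'
      have e : ∀ j, ∫ x : Inputs S (N ν), g p (x p j) ^ 4 ∂(inputLaw F (N ν)) =
          ∫ ξ, g p ξ ^ 4 ∂(F p) := fun j =>
        integral_comp_measurePreserving (measurePreserving_eval_inputLaw F (⟨p, j⟩ : Slot (N ν)))
          ((hg p).pow_const 4)
      simp only [dataMean]
      rw [integral_const_mul, integral_finsetSum (Finset.univ : Finset (Fin (N ν p)))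
        (f := fun j (x : Inputs S (N ν)) => g p (x p j) ^ 4) fun j _ =>
        (measurePreserving_eval_inputLaw F (⟨p, j⟩ : Slot (N ν))).integrable_comp_of_integrable hi]
      simp only [e, Finset.sum_const, Finset.card_univ, Fintype.card_fin, nsmul_eq_mul]
      field_simp
    have h3 := (isSmallOP_mean (F := F) hN hn hc hcN (hg p)
      ((hg4 p).mono_exponent (by norm_num))).isBigOP_of_sub
    have h4 : IsSmallOP (fun ν => inputLaw F (N ν)) fun ν (_ : Inputs S (N ν)) =>
        (1 : ℝ) / N ν p := by
      have h5 := (tendsto_mul_div hβ hNβ 1 p).mul hn.inv_tendsto_atTop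
      rw [mul_zero] at h5
      refine isSmallOP_of_tendsto (h5.congr' ?_)
      filter_upwards [hn.eventually_gt_atTop 0] with ν hν
      have : (N ν p : ℝ) ≠ 0 := Nat.cast_ne_zero.2 (hN ν p).ne'
      simp only [Pi.inv_apply]
      field_simp
    have h6 : IsSmallOP (fun ν => inputLaw F (N ν)) fun ν (_ : Inputs S (N ν)) =>
        (a ^ 2 * n ν / N ν p) * (a ^ 2 * n ν / N ν p) * (1 / N ν p) :=
      (isBigOP_of_tendsto ((tendsto_mul_div hβ hNβ (a ^ 2) p).mul
        (tendsto_mul_div hβ hNβ (a ^ 2) p))).mul_isSmallOP h4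
    have h7 : IsBigOP (fun ν => inputLaw F (N ν)) fun ν (x : Inputs S (N ν)) =>
        dataMean (g p) x ^ 4 := by
      have h8 := IsBigOP.mul (IsBigOP.mul h3 h3) (IsBigOP.mul h3 h3)
      refine h8.mono (.of_forall fun ν => .of_forall fun x => le_of_eq ?_)
      congr 1
      simp only [dataMean]
      ring
    exact h6.mul_isBigOP ((h2.const_mul 8).add (h7.const_mul 8))
  refine (IsSmallOP.sum Finset.univ fun p _ => h1 p).mono ?_
  filter_upwards [hn.eventually_ge_atTop 0] with ν hν
  refine .of_forall fun x => ?_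
  rw [Fintype.sum_sigma, abs_of_nonneg (Finset.sum_nonneg fun p _ => Finset.sum_nonneg fun j _ => by
    positivity)]
  refine le_trans (Finset.sum_le_sum fun p _ => ?_) (le_abs_self _)
  refine (sum_pow_four_tilt_le (hN ν) _ g x p).trans (le_of_eq ?_)
  have e : (a * √(n ν)) ^ 4 = a ^ 4 * n ν ^ 2 := by
    rw [mul_pow, show √(n ν) ^ 4 = (√(n ν) ^ 2) ^ 2 by ring, Real.sq_sqrt hν]
  rw [e]
  ring

/-- The linear part of the expansion of the performance measure at the tilted weights. -/
theorem isSmallOP_sqrt_mul_linPart_tilt [Nonempty (Slot T)] (hN : ∀ ν p, 0 < N ν p)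
    (hn : Tendsto n atTop atTop) (hc : 0 < c)
    (hcN : ∀ᶠ ν in atTop, ∀ p, c * n ν ≤ N ν p) (hβ : ∀ p, 0 < β p)
    (hNβ : ∀ p, Tendsto (fun ν => (N ν p : ℝ) / n ν) atTop (𝓝 (β p)))
    (hφ : ReuseMemLp F φ) (hφ2 : ReuseMemLp F fun z => φ z ^ 2)
    (hg : ∀ p, Measurable (g p)) (hg4 : ∀ p, MemLp (g p) 4 (F p))
    (hg0 : ∀ p, ∫ ξ, g p ξ ∂(F p) = 0) (a : ℝ) :
    IsSmallOP (fun ν => inputLaw F (N ν)) fun ν x =>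
      √(n ν) * linPart φ x (tilt (a * √(n ν)) g x) -
        ∑ s : Slot T, a / β s.1 * ∫ ξ, slotProj F φ s ξ * g s.1 ξ ∂(F s.1) := by
  have h1 : ∀ s : Slot T, IsSmallOP (fun ν => inputLaw F (N ν)) fun ν x =>
      a * n ν / N ν s.1 *
        (vstat (fun z => φ z * g s.1 (z s.1 s.2)) x - dataMean (g s.1) x * vstat φ x) -
        a / β s.1 * ∫ ξ, slotProj F φ s ξ * g s.1 ξ ∂(F s.1) := fun s => by
    refine isSmallOP_mul_sub (tendsto_mul_div hβ hNβ _ s.1) ?_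
    have h2 := hφ2.mul_eval hφ.measurable (s := s) (hg s.1) (hg4 s.1)
    have h3 := isSmallOP_vstat_sub h2 hN hn hc hcN
    rw [integral_mul_eval_eq hφ.measurable (hg s.1) ((hg4 s.1).integrable (by norm_num))
      (hg0 s.1) (h2.memLp_self.integrable one_le_two)] at h3
    have h4 := isSmallOP_mean (F := F) hN hn hc hcN (hg s.1)
      ((hg4 s.1).mono_exponent (by norm_num))
    simp only [hg0, sub_zero] at h4
    have h5 := (isSmallOP_vstat_sub hφ hN hn hc hcN).isBigOP_of_sub
    refine (h3.sub (h4.mul_isBigOP h5)).mono (.of_forall fun ν => .of_forall fun x => le_of_eq ?_)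
    congr 1
    simp only [dataMean]
    ring
  refine (IsSmallOP.sum Finset.univ fun s _ => h1 s).mono ?_
  filter_upwards [hn.eventually_ge_atTop 0] with ν hν
  refine .of_forall fun x => le_of_eq ?_
  congr 1
  rw [linPart_tilt, Finset.mul_sum, ← Finset.sum_sub_distrib]
  refine Finset.sum_congr rfl fun s _ => ?_
  have e : a * n ν = a * (√(n ν) * √(n ν)) := by rw [Real.mul_self_sqrt hν]
  rw [e]
  ring

end TiltAsymptotics

/-! ### First-order expansion for one solution -/

section OneSolution

variable {m : ℕ} {S : Fin m → Type*} [∀ p, MeasurableSpace (S p)] [∀ p, MeasurableEq (S p)]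
  {T : Fin m → ℕ} {F : ∀ p, Measure (S p)} [∀ p, IsProbabilityMeasure (F p)]
  {Ω : ℕ → Type*} {𝒢 𝒢₂ : ∀ ν, MeasurableSpace (Ω ν)} [mΩ : ∀ ν, MeasurableSpace (Ω ν)]
  {P : ∀ ν, Measure (Ω ν)} [∀ ν, IsProbabilityMeasure (P ν)]
  {N : ℕ → Fin m → ℕ} {R : ℕ → ℕ} {n : ℕ → ℝ} {c : ℝ}
  {X : ∀ ν, Ω ν → Inputs S (N ν)} {W : ∀ ν, Ω ν → ∀ p, Fin (N ν p) → ℝ}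
  {Z : ∀ ν, Ω ν → Fin (R ν) → Inputs S T} {φ : Inputs S T → ℝ} {q : ℝ}

/-- The sum of the first-order projections over all slots of one source. -/
noncomputable def sourceProj (F : ∀ p, Measure (S p)) (φ : Inputs S T → ℝ) (p : Fin m) (ξ : S p) :
    ℝ :=
  ∑ t, slotProj F φ ⟨p, t⟩ ξ

/-- The estimated linear objective agrees up to `o_P(n^{-1/2})` with the linear part of the
expansion of the performance measure, along bounded perturbations of the uniform weights. -/
theorem isSmallOP_sqrt_mul_linEst_sub_linPart (h𝒢 : ∀ ν, 𝒢 ν ≤ mΩ ν)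
    (h : ∀ ν, IsCondReplication (P ν) (𝒢 ν) (fun ω => empirical (X ν ω)) (Z ν))
    (hX : ∀ ν, Measurable[𝒢 ν] (X ν)) (hlaw : ∀ ν, (P ν).map (X ν) = inputLaw F (N ν))
    (hN : ∀ ν p, 0 < N ν p)
    (hinj : ∀ ν, ∀ᵐ ω ∂(P ν), ∀ p, Function.Injective (X ν ω p))
    (hZ : ∀ ν, Measurable (Z ν)) [Nonempty (Slot T)]
    (hn : Tendsto n atTop atTop) (hc : 0 < c) (hcN : ∀ᶠ ν in atTop, ∀ p, c * n ν ≤ N ν p)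
    (hR : Tendsto (fun ν => (R ν : ℝ) / n ν) atTop atTop) (hφ : ReuseMemLp F φ)
    {b : ∀ ν, Ω ν → ∀ p, Fin (N ν p) → ℝ} (hb0 : ∀ ν, ∀ᵐ ω ∂(P ν), ∀ p, ∑ j, b ν ω p j = 0)
    (hb : IsBigOP P fun ν ω => ∑ k : Slot (N ν), b ν ω k.1 k.2 ^ 2) :
    IsSmallOP P fun ν ω =>
      √(n ν) * (linEst φ (X ν ω) (Z ν ω) (b ν ω) - linPart φ (X ν ω) (b ν ω)) := by
  have hX' : ∀ ν, Measurable (X ν) := fun ν => (hX ν).mono (h𝒢 ν) le_rfl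
  have hv := (isBigOP_vstat_sq hφ hN).comp_of_map_eq hX' hlaw
  have hv1 := (isBigOP_vstat_sq (reuseMemLp_const (F := F) (T := T) 1) hN).comp_of_map_eq hX' hlaw
  have h1 := isSmallOP_momentError h𝒢 h hX hN hinj hZ hn hR hφ.measurable hv
  have h2 := isSmallOP_momentError h𝒢 h hX hN hinj hZ hn hR measurable_const hv1
  have h3 : IsSmallOP P fun ν ω => √(n ν) * ((R ν : ℝ)⁻¹ * ∑ r, φ (Z ν ω r) -
        wsum φ (X ν ω) (fun p (_ : Fin (N ν p)) => (N ν p : ℝ)⁻¹)) := by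
    refine isSmallOP_sqrt_mul_error (W := fun ν _ p (_ : Fin (N ν p)) => (N ν p : ℝ)⁻¹) h𝒢 h hX
      (fun ν => measurable_const) hZ (fun ν => .of_forall fun _ => isWeight_uniform (hN ν))
      hn hR hφ.measurable ?_
    simpa only [wsum_uniform (hN _)] using hv
  have h4 : IsBigOP P fun ν ω => (R ν : ℝ)⁻¹ * ∑ r, φ (Z ν ω r) := by
    have h5 := (isSmallOP_vstat_sub hφ hN hn hc hcN).isBigOP_of_sub.comp_of_map_eq hX' hlaw
    have h6 : IsSmallOP P fun ν ω => (R ν : ℝ)⁻¹ * ∑ r, φ (Z ν ω r) - vstat φ (X ν ω) := by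
      refine h3.mono ?_
      filter_upwards [hn.eventually_ge_atTop 1] with ν hν
      refine .of_forall fun ω => ?_
      rw [wsum_uniform (hN ν), abs_mul, abs_of_nonneg (Real.sqrt_nonneg _)]
      exact le_mul_of_one_le_left (abs_nonneg _) (Real.one_le_sqrt.2 hν)
    exact (h6.isBigOP.add h5).mono (.of_forall fun ν => .of_forall fun ω => by simp)
  have h7 := (hb.const_mul 2).mul_isSmallOP (h1.add ((IsBigOP.mul h4 h4).mul_isSmallOP h2))
  refine IsSmallOP.of_sq (h7.mono ?_)
  filter_upwards [hn.eventually_ge_atTop 0] with ν hν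
  filter_upwards [hinj ν, hb0 ν] with ω hω hω'
  rw [abs_of_nonneg (sq_nonneg _), mul_pow, Real.sq_sqrt hν]
  refine le_trans (mul_le_mul_of_nonneg_left
    (sq_linEst_sub_linPart_le (hN ν) hω φ (Z ν ω) hω') hν) (le_trans (le_of_eq ?_) (le_abs_self _))
  ring

/-- The multilinear remainder of the expansion of the performance measure over the ambiguity set
is of order `o_P(n^{-1/2})`. -/
theorem isSmallOP_sqrt_mul_wsum_sub_linPart (hX : ∀ ν, Measurable (X ν))
    (hlaw : ∀ ν, (P ν).map (X ν) = inputLaw F (N ν)) (hN : ∀ ν p, 0 < N ν p)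
    (hn : Tendsto n atTop atTop) (hc : 0 < c) (hcN : ∀ᶠ ν in atTop, ∀ p, c * n ν ≤ N ν p)
    (hφ : ReuseMemLp F φ) (hW : ∀ ν, ∀ᵐ ω ∂(P ν), W ν ω ∈ ambiguitySet (N ν) q) :
    IsSmallOP P fun ν ω => √(n ν) * (wsum φ (X ν ω) (W ν ω) - vstat φ (X ν ω) -
      linPart φ (X ν ω) (relDev (W ν ω))) := by
  set C := (2 + √(q / 2)) ^ 2 * (q / 2) with hC
  set K := (Fintype.card (Slot T) : ℝ) with hK
  have hv := (isBigOP_vstat_sq hφ hN).comp_of_map_eq hX hlaw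
  have h0 : Tendsto (fun ν => K * (C / c) / n ν) atTop (𝓝 0) := hn.const_div_atTop _
  have h1 : Tendsto (fun ν => (K * (C / c)) * (K * (C / c) / n ν)) atTop (𝓝 0) := by
    simpa using h0.const_mul (K * (C / c))
  have h2 := hv.mul_isSmallOP (isSmallOP_of_tendsto (P := P) h1)
  refine IsSmallOP.of_sq (h2.mono ?_)
  filter_upwards [hn.eventually_gt_atTop 0, hcN, h0.eventually (gt_mem_nhds one_pos)]
    with ν hν hν2 hν3
  filter_upwards [hW ν] with ω hω
  have hw := isWeight_of_mem_ambiguitySet hω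
  have e : ∀ s : ∀ s : Slot T, Fin (N ν s.1), ∏ i : Slot T, (N ν i.1 * W ν ω i.1 (s i)) =
      ∏ i : Slot T, (1 + relDev (W ν ω) i.1 (s i)) := fun s => by simp [relDev]
  have h3 := sq_avgSel_sub_linPart_le (hN ν) φ (X ν ω) (relDev (W ν ω)) hw.sum_relDev
    (C := C) (M := c * n ν) (by positivity) hν2 (fun p => ?_) (by
      refine le_trans (le_of_eq ?_) hν3.le
      rw [hK]
      field_simp)
  · rw [wsum_eq_avgSel (hN ν)]
    simp only [e]
    rw [abs_of_nonneg (sq_nonneg _), mul_pow, Real.sq_sqrt hν.le]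
    refine le_trans (mul_le_mul_of_nonneg_left h3 hν.le) (le_trans (le_of_eq ?_) (le_abs_self _))
    rw [hK]
    field_simp
  · have h4 := sum_sq_relDev_le (hN ν) hω
    rw [Fintype.sum_sigma] at h4
    exact (Finset.single_le_sum (f := fun p => ∑ j, relDev (W ν ω) p j ^ 2)
      (fun p _ => Finset.sum_nonneg fun _ _ => sq_nonneg _) (Finset.mem_univ p)).trans h4

lemma isBigOP_sum_sq_relDev (hN : ∀ ν p, 0 < N ν p)
    (hW : ∀ ν, ∀ᵐ ω ∂(P ν), W ν ω ∈ ambiguitySet (N ν) q) :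
    IsBigOP P fun ν ω => ∑ k : Slot (N ν), relDev (W ν ω) k.1 k.2 ^ 2 := by
  refine (isBigOP_of_tendsto (P := P)
    (tendsto_const_nhds (x := (2 + √(q / 2)) ^ 2 * (q / 2)))).mono (.of_forall fun ν => ?_)
  filter_upwards [hW ν] with ω hω
  rw [abs_of_nonneg (Finset.sum_nonneg fun _ _ => sq_nonneg _)]
  exact (sum_sq_relDev_le (hN ν) hω).trans (le_abs_self _)

/-- First-order expansion of the simulated performance of one solution at the weights `W`. -/
theorem isSmallOP_sqrt_mul_mean_sub_proj_sub_linEst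
    {R₂ : ℕ → ℕ} {Z₂ : ∀ ν, Ω ν → Fin (R₂ ν) → Inputs S T}
    (h𝒢 : ∀ ν, 𝒢 ν ≤ mΩ ν)
    (h : ∀ ν, IsCondReplication (P ν) (𝒢 ν) (fun ω => empirical (X ν ω)) (Z ν))
    (hX : ∀ ν, Measurable[𝒢 ν] (X ν)) (hZ : ∀ ν, Measurable (Z ν))
    (hR : Tendsto (fun ν => (R ν : ℝ) / n ν) atTop atTop)
    (h𝒢₂ : ∀ ν, 𝒢₂ ν ≤ mΩ ν)
    (h₂ : ∀ ν, IsCondReplication (P ν) (𝒢₂ ν) (fun ω => weightedEmpirical (X ν ω) (W ν ω)) (Z₂ ν))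
    (hX₂ : ∀ ν, Measurable[𝒢₂ ν] (X ν)) (hW₂ : ∀ ν, Measurable[𝒢₂ ν] (W ν))
    (hZ₂ : ∀ ν, Measurable (Z₂ ν))
    (hR₂ : Tendsto (fun ν => (R₂ ν : ℝ) / n ν) atTop atTop)
    (hW : ∀ ν, ∀ᵐ ω ∂(P ν), W ν ω ∈ ambiguitySet (N ν) q)
    (hlaw : ∀ ν, (P ν).map (X ν) = inputLaw F (N ν)) (hN : ∀ ν p, 0 < N ν p)
    (hinj : ∀ ν, ∀ᵐ ω ∂(P ν), ∀ p, Function.Injective (X ν ω p)) [Nonempty (Slot T)]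
    (hn : Tendsto n atTop atTop) (hc : 0 < c) (hcN : ∀ᶠ ν in atTop, ∀ p, c * n ν ≤ N ν p)
    (hφ : ReuseMemLp F φ) :
    IsSmallOP P fun ν ω => √(n ν) * ((R₂ ν : ℝ)⁻¹ * ∑ r, φ (Z₂ ν ω r) - perf φ F -
      ∑ p, dataMean (sourceProj F φ p) (X ν ω) -
      linEst φ (X ν ω) (Z ν ω) (relDev (W ν ω))) := by
  have hX' : ∀ ν, Measurable (X ν) := fun ν => (hX ν).mono (h𝒢 ν) le_rfl
  have hw : ∀ ν, ∀ᵐ ω ∂(P ν), IsWeight (W ν ω) := fun ν => by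
    filter_upwards [hW ν] with ω hω using isWeight_of_mem_ambiguitySet hω
  have hv := (isBigOP_vstat_sq hφ hN).comp_of_map_eq hX' hlaw
  have h1 := isSmallOP_sqrt_mul_error h𝒢₂ h₂ hX₂ hW₂ hZ₂ hw hn hR₂ hφ.measurable
    ((hv.const_mul (((1 + √(q / 2)) ^ 2) ^ Fintype.card (Slot T))).mono (.of_forall fun ν => by
      filter_upwards [hW ν] with ω hω
      rw [abs_of_nonneg (wsum_nonneg (isWeight_of_mem_ambiguitySet hω) _ fun _ => sq_nonneg _)]
      exact (wsum_sq_le (hN ν) hω φ _).trans (le_abs_self _)))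
  have h2 := isSmallOP_sqrt_mul_wsum_sub_linPart hX' hlaw hN hn hc hcN hφ hW
  have h3 := isSmallOP_sqrt_mul_linEst_sub_linPart h𝒢 h hX hlaw hN hinj hZ hn hc hcN hR hφ
    (b := fun ν ω => relDev (W ν ω))
    (fun ν => by filter_upwards [hw ν] with ω hω using hω.sum_relDev) (isBigOP_sum_sq_relDev hN hW)
  have h4 := (isSmallOP_sqrt_mul_vstat_sub_proj hφ hN hn hc hcN).comp_of_map_eq hX' hlaw
  refine (((h1.add h2).sub h3).add h4).mono (.of_forall fun ν => .of_forall fun ω => le_of_eq ?_)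
  have e : ∑ s : Slot T, (N ν s.1 : ℝ)⁻¹ * ∑ j, slotProj F φ s (X ν ω s.1 j) =
      ∑ p, dataMean (sourceProj F φ p) (X ν ω) := by
    rw [Fintype.sum_sigma]
    refine Finset.sum_congr rfl fun p _ => ?_
    simp only [dataMean, sourceProj, ← Finset.mul_sum]
    rw [Finset.sum_comm]
  congr 1
  rw [e, perf]
  ring

/-- The estimated linear objective of one solution at the tilted weights. -/
theorem isSmallOP_sqrt_mul_linEst_tilt (h𝒢 : ∀ ν, 𝒢 ν ≤ mΩ ν)
    (h : ∀ ν, IsCondReplication (P ν) (𝒢 ν) (fun ω => empirical (X ν ω)) (Z ν))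
    (hX : ∀ ν, Measurable[𝒢 ν] (X ν)) (hZ : ∀ ν, Measurable (Z ν))
    (hR : Tendsto (fun ν => (R ν : ℝ) / n ν) atTop atTop)
    (hlaw : ∀ ν, (P ν).map (X ν) = inputLaw F (N ν)) (hN : ∀ ν p, 0 < N ν p)
    (hinj : ∀ ν, ∀ᵐ ω ∂(P ν), ∀ p, Function.Injective (X ν ω p)) [Nonempty (Slot T)]
    (hn : Tendsto n atTop atTop) (hc : 0 < c) (hcN : ∀ᶠ ν in atTop, ∀ p, c * n ν ≤ N ν p)
    {β : Fin m → ℝ} (hβ : ∀ p, 0 < β p)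
    (hNβ : ∀ p, Tendsto (fun ν => (N ν p : ℝ) / n ν) atTop (𝓝 (β p)))
    (hφ : ReuseMemLp F φ) (hφ2 : ReuseMemLp F fun z => φ z ^ 2)
    {g : ∀ p, S p → ℝ} (hg : ∀ p, Measurable (g p)) (hg4 : ∀ p, MemLp (g p) 4 (F p))
    (hg0 : ∀ p, ∫ ξ, g p ξ ∂(F p) = 0) (a : ℝ) :
    IsSmallOP P fun ν ω =>
      √(n ν) * linEst φ (X ν ω) (Z ν ω) (tilt (a * √(n ν)) g (X ν ω)) -
        ∑ p, a / β p * ∫ ξ, sourceProj F φ p ξ * g p ξ ∂(F p) := by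
  have hX' : ∀ ν, Measurable (X ν) := fun ν => (hX ν).mono (h𝒢 ν) le_rfl
  have h1 := isSmallOP_sqrt_mul_linEst_sub_linPart h𝒢 h hX hlaw hN hinj hZ hn hc hcN hR hφ
    (b := fun ν ω => tilt (a * √(n ν)) g (X ν ω))
    (fun ν => .of_forall fun ω => sum_tilt (hN ν) _ g _)
    ((isSmallOP_sum_sq_tilt hN hn hc hcN hβ hNβ hg hg4 hg0 a).isBigOP_of_sub.comp_of_map_eq
      hX' hlaw)
  have h2 := (isSmallOP_sqrt_mul_linPart_tilt hN hn hc hcN hβ hNβ hφ hφ2 hg hg4 hg0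
    a).comp_of_map_eq hX' hlaw
  refine (h1.add h2).mono (.of_forall fun ν => .of_forall fun ω => le_of_eq ?_)
  have e : ∑ s : Slot T, a / β s.1 * ∫ ξ, slotProj F φ s ξ * g s.1 ξ ∂(F s.1) =
      ∑ p, a / β p * ∫ ξ, sourceProj F φ p ξ * g p ξ ∂(F p) := by
    rw [Fintype.sum_sigma]
    refine Finset.sum_congr rfl fun p _ => ?_
    simp only [sourceProj, Finset.sum_mul]
    rw [integral_finsetSum _ fun t _ => ?_, Finset.mul_sum]
    exact (memLp_slotProj hφ.measurable hφ.memLp_self ⟨p, t⟩).integrable_mul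
      ((hg4 p).mono_exponent (p := 2) (by norm_num))
  congr 1
  rw [e]
  ring

end OneSolution

section SourceProj

variable {m : ℕ} {S : Fin m → Type*} [∀ p, MeasurableSpace (S p)]
  {T : Fin m → ℕ} {F : ∀ p, Measure (S p)} [∀ p, IsProbabilityMeasure (F p)]
  {φ : Inputs S T → ℝ}

lemma measurable_sourceProj (h : Measurable φ) (p : Fin m) : Measurable (sourceProj F φ p) :=
  Finset.measurable_fun_sum _ fun _ _ => measurable_slotProj h _

lemma memLp_four_sourceProj (hm : Measurable φ) (h : MemLp (fun z => φ z ^ 2) 2 (inputLaw F T))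
    (p : Fin m) : MemLp (sourceProj F φ p) 4 (F p) :=
  memLp_finsetSum _ fun t _ => memLp_four_slotProj hm h ⟨p, t⟩

lemma integral_sourceProj (hm : Measurable φ) (h : MemLp φ 2 (inputLaw F T)) (p : Fin m) :
    ∫ ξ, sourceProj F φ p ξ ∂(F p) = 0 := by
  unfold sourceProj
  rw [integral_finsetSum _ fun t _ => (memLp_slotProj hm h ⟨p, t⟩).integrable one_le_two]
  exact Finset.sum_eq_zero fun t _ => integral_slotProj hm h ⟨p, t⟩

end SourceProj

/-! ### Tilted weights in the ambiguity set -/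

section Tilt

variable {m : ℕ} {S : Fin m → Type*} [∀ p, MeasurableSpace (S p)]
  {F : ∀ p, Measure (S p)} [∀ p, IsProbabilityMeasure (F p)]
  {g : ∀ p, S p → ℝ} {N : ℕ → Fin m → ℕ} {n : ℕ → ℝ} {c q : ℝ}
  {β : Fin m → ℝ}

/-- The tilted weights belong to the ambiguity set with probability tending to one. -/
theorem tendsto_tilt_notMem_ambiguitySet (hN : ∀ ν p, 0 < N ν p) (hn : Tendsto n atTop atTop)
    (hc : 0 < c)
    (hcN : ∀ᶠ ν in atTop, ∀ p, c * n ν ≤ N ν p) (hβ : ∀ p, 0 < β p)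
    (hNβ : ∀ p, Tendsto (fun ν => (N ν p : ℝ) / n ν) atTop (𝓝 (β p)))
    (hg : ∀ p, Measurable (g p)) (hg4 : ∀ p, MemLp (g p) 4 (F p))
    (hg0 : ∀ p, ∫ ξ, g p ξ ∂(F p) = 0) {a : ℝ}
    (ha : a ^ 2 * ∑ p, (∫ ξ, g p ξ ^ 2 ∂(F p)) / β p < q) :
    Tendsto (fun ν => inputLaw F (N ν) {x | (fun p j => (1 + tilt (a * √(n ν)) g x p j) / N ν p) ∉
      ambiguitySet (N ν) q}) atTop (𝓝 0) := by
  set A := a ^ 2 * ∑ p, (∫ ξ, g p ξ ^ 2 ∂(F p)) / β p with hA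
  have hA0 : 0 ≤ A := mul_nonneg (sq_nonneg _) (Finset.sum_nonneg fun p _ =>
    div_nonneg (integral_nonneg fun _ => sq_nonneg _) (hβ p).le)
  -- `η` is half of the slack, and `τ` is so small that the factor `1 + 4 τ` consumes the other half
  set η := (q - A) / 2 with hη
  have hη0 : 0 < η := by linarith
  set τ := min (1 / 2) (η / (4 * (A + η))) with hτ
  have hτ0 : 0 < τ := lt_min (by norm_num) (by positivity)
  have hτ1 : (A + η) * (1 + 4 * τ) ≤ q := by
    have h1 : τ ≤ η / (4 * (A + η)) := min_le_right _ _
    have h2 : (A + η) * (4 * τ) ≤ η := by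
      rw [le_div_iff₀ (by positivity)] at h1
      linarith
    linarith
  have h1 := isSmallOP_sum_sq_tilt hN hn hc hcN hβ hNβ hg hg4 hg0 a η hη0
  have h2 := isSmallOP_sum_pow_four_tilt hN hn hc hcN hβ hNβ hg hg4 a (τ ^ 4) (by positivity)
  have h3 := h1.add h2
  rw [add_zero] at h3
  refine tendsto_of_tendsto_of_tendsto_of_le_of_le tendsto_const_nhds h3
    (fun _ => zero_le) fun ν => ?_
  refine (measure_mono fun x hx => ?_).trans (measure_union_le _ _)
  by_contra hcon
  simp only [Set.mem_union, Set.mem_ofPred_eq, not_or, not_le] at hcon hx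
  refine hx (mem_ambiguitySet_of_small (hN ν) (sum_tilt (hN ν) _ g x) (min_le_left _ _)
    (fun p j => ?_) ((mul_le_mul_of_nonneg_right ?_ (by positivity)).trans hτ1))
  -- the fourth-power norm bounds every coordinate
  · have h4 := (Finset.single_le_sum
      (f := fun k : Slot (N ν) => tilt (a * √(n ν)) g x k.1 k.2 ^ 4)
      (fun k _ => by positivity) (Finset.mem_univ ⟨p, j⟩)).trans
      ((le_abs_self _).trans hcon.2.le)
    refine le_of_pow_le_pow_left₀ (n := 4) (by norm_num) hτ0.le ?_
    simp only at h4
    rwa [Even.pow_abs ⟨2, rfl⟩]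
  · have := (le_abs_self _).trans hcon.1.le
    linarith

end Tilt

/-! ### The estimated bound for a pair of solutions -/

section TwoSolutions

variable {k m : ℕ} {S : Fin m → Type*} [∀ p, MeasurableSpace (S p)] [∀ p, MeasurableEq (S p)]
  {F : ∀ p, Measure (S p)} [∀ p, IsProbabilityMeasure (F p)] {T : Fin k → Fin m → ℕ}
  {h : ∀ i, Inputs S (T i) → ℝ} {N : ℕ → Fin m → ℕ} {R₁ R₂ : ℕ → ℕ} {n : ℕ → ℝ} {c α : ℝ}
  {β : Fin m → ℝ} {Ω : ℕ → Type*} [∀ ν, MeasurableSpace (Ω ν)] {P : ∀ ν, Measure (Ω ν)}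
  [∀ ν, IsProbabilityMeasure (P ν)] {ρ : ∀ ν, Run S T (N ν) (R₁ ν) (R₂ ν) (Ω ν)}

/-- The difference of the first-order projections of solutions `i` and `ℓ`. -/
noncomputable def projDiff (F : ∀ p, Measure (S p)) (h : ∀ i, Inputs S (T i) → ℝ) (i ℓ : Fin k)
    (p : Fin m) (ξ : S p) : ℝ :=
  sourceProj F (h i) p ξ - sourceProj F (h ℓ) p ξ

/-- The estimated bound `Û_{iℓ}` exceeds the empirical version of `η_i - η_ℓ`, asymptotically and
up to `o_P(n^{-1/2})`, by at least the increment of its linear part at the tilted weights. -/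
theorem isSmallOP_min_bound (hρ : ∀ ν, (ρ ν).IsNIOUC (P ν) F h α)
    (hh : ∀ i, ReuseMemLp F (h i)) (hh2 : ∀ i, ReuseMemLp F fun z => h i z ^ 2)
    (hT : ∀ i, Nonempty (Slot (T i)))
    (hinj : ∀ ν, ∀ᵐ ω ∂(P ν), ∀ p, Function.Injective ((ρ ν).data ω p))
    (hN : ∀ ν p, 0 < N ν p) (hn : Tendsto n atTop atTop) (hc : 0 < c)
    (hcN : ∀ᶠ ν in atTop, ∀ p, c * n ν ≤ N ν p) (hβ : ∀ p, 0 < β p)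
    (hNβ : ∀ p, Tendsto (fun ν => (N ν p : ℝ) / n ν) atTop (𝓝 (β p)))
    (hR₁ : Tendsto (fun ν => (R₁ ν : ℝ) / n ν) atTop atTop)
    (hR₂ : Tendsto (fun ν => (R₂ ν : ℝ) / n ν) atTop atTop) {i ℓ : Fin k} (hiℓ : i ≠ ℓ) {a : ℝ}
    (ha : a ^ 2 * ∑ p, (∫ ξ, projDiff F h i ℓ p ξ ^ 2 ∂(F p)) / β p <
      chiSquaredQuantile (k - 1) (1 - α)) :
    IsSmallOP P fun ν ω => min 0 (√(n ν) * ((ρ ν).bound h ω i ℓ - (perf (h i) F - perf (h ℓ) F)) -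
      √(n ν) * ∑ p, dataMean (projDiff F h i ℓ p) ((ρ ν).data ω) -
      a * ∑ p, (∫ ξ, projDiff F h i ℓ p ξ ^ 2 ∂(F p)) / β p) := by
  have := hT i
  have := hT ℓ
  have hX : ∀ ν, Measurable[(ρ ν).dataAlgebra] (ρ ν).data := fun ν => comap_measurable _
  have h𝒢 : ∀ ν, (ρ ν).dataAlgebra ≤ _ := fun ν => (hρ ν).measurable_data.comap_le
  have h𝒢₂ : ∀ ν, (ρ ν).stageOneAlgebra ≤ _ := fun ν =>
    sup_le (sup_le (h𝒢 ν) (iSup_le fun i => ((hρ ν).measurable_sim₁ i).comap_le))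
      (iSup_le fun i => iSup_le fun ℓ => ((hρ ν).measurable_weights i ℓ).comap_le)
  have hX₂ : ∀ ν, Measurable[(ρ ν).stageOneAlgebra] (ρ ν).data := fun ν =>
    (hX ν).mono (le_sup_left.trans le_sup_left) le_rfl
  have hW₂ : ∀ ν, Measurable[(ρ ν).stageOneAlgebra] ((ρ ν).weights i ℓ) := fun ν =>
    (comap_measurable _).mono (le_trans (le_iSup₂ (f := fun i ℓ =>
      MeasurableSpace.comap ((ρ ν).weights i ℓ) inferInstance) i ℓ) le_sup_right) le_rfl
  have hW : ∀ ν, ∀ᵐ ω ∂(P ν), (ρ ν).weights i ℓ ω ∈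
      ambiguitySet (N ν) (chiSquaredQuantile (k - 1) (1 - α)) := fun ν =>
    ((hρ ν).optimal i ℓ hiℓ).mono fun ω hω => hω.1
  have hlaw := fun ν => (hρ ν).data_law
  set g := projDiff F h i ℓ with hg
  have hsp2 : ∀ i p, MemLp (sourceProj F (h i) p) 4 (F p) := fun i p =>
    memLp_four_sourceProj (hh i).measurable (hh2 i).memLp_self p
  have hgm : ∀ p, Measurable (g p) := fun p =>
    (measurable_sourceProj (hh i).measurable p).sub (measurable_sourceProj (hh ℓ).measurable p)
  have hg4 : ∀ p, MemLp (g p) 4 (F p) := fun p => (hsp2 i p).sub (hsp2 ℓ p)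
  have hg0 : ∀ p, ∫ ξ, g p ξ ∂(F p) = 0 := fun p => by
    simp only [hg, projDiff]
    rw [integral_sub ((hsp2 i p).integrable (by norm_num)) ((hsp2 ℓ p).integrable (by norm_num)),
      integral_sourceProj (hh i).measurable (hh i).memLp_self,
      integral_sourceProj (hh ℓ).measurable (hh ℓ).memLp_self, sub_zero]
  have e₁ := isSmallOP_sqrt_mul_mean_sub_proj_sub_linEst h𝒢 (fun ν => (hρ ν).stage_one i) hX
    (fun ν => (hρ ν).measurable_sim₁ i) hR₁ h𝒢₂ (fun ν => (hρ ν).stage_two i ℓ hiℓ) hX₂ hW₂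
    (fun ν => (hρ ν).measurable_sim₂ i ℓ) hR₂ hW hlaw hN hinj hn hc hcN (hh i)
  have e₂ := isSmallOP_sqrt_mul_mean_sub_proj_sub_linEst h𝒢 (fun ν => (hρ ν).stage_one ℓ) hX
    (fun ν => (hρ ν).measurable_sim₁ ℓ) hR₁ h𝒢₂ (fun ν => (hρ ν).stage_two' i ℓ hiℓ) hX₂ hW₂
    (fun ν => (hρ ν).measurable_sim₂' i ℓ) hR₂ hW hlaw hN hinj hn hc hcN (hh ℓ)
  have f₁ := isSmallOP_sqrt_mul_linEst_tilt h𝒢 (fun ν => (hρ ν).stage_one i) hX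
    (fun ν => (hρ ν).measurable_sim₁ i) hR₁ hlaw hN hinj hn hc hcN hβ hNβ (hh i) (hh2 i) hgm hg4
    hg0 a
  have f₂ := isSmallOP_sqrt_mul_linEst_tilt h𝒢 (fun ν => (hρ ν).stage_one ℓ) hX
    (fun ν => (hρ ν).measurable_sim₁ ℓ) hR₁ hlaw hN hinj hn hc hcN hβ hNβ (hh ℓ) (hh2 ℓ) hgm hg4
    hg0 a
  have hbad := tendsto_tilt_notMem_ambiguitySet hN hn hc hcN hβ hNβ hgm hg4 hg0 ha
  have hbad' : Tendsto (fun ν => P ν {ω | (fun p j =>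
      (1 + tilt (a * √(n ν)) g ((ρ ν).data ω) p j) / N ν p) ∉
        ambiguitySet (N ν) (chiSquaredQuantile (k - 1) (1 - α))}) atTop (𝓝 0) := by
    refine tendsto_of_tendsto_of_tendsto_of_le_of_le tendsto_const_nhds hbad
      (fun _ => zero_le) fun ν => ?_
    simp only
    rw [← hlaw ν]
    exact Measure.le_map_apply (hρ ν).measurable_data.aemeasurable _
  -- the limits of the two linear terms at the tilt combine to `a` times the variance
  have hv : ∑ p, a / β p * ∫ ξ, sourceProj F (h i) p ξ * g p ξ ∂(F p) -
      ∑ p, a / β p * ∫ ξ, sourceProj F (h ℓ) p ξ * g p ξ ∂(F p) =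
      a * ∑ p, (∫ ξ, g p ξ ^ 2 ∂(F p)) / β p := by
    rw [← Finset.sum_sub_distrib, Finset.mul_sum]
    refine Finset.sum_congr rfl fun p _ => ?_
    have hint : ∀ i, Integrable (fun ξ => sourceProj F (h i) p ξ * g p ξ) (F p) := fun i =>
      ((hsp2 i p).mono_exponent (p := 2) (by norm_num)).integrable_mul
        ((hg4 p).mono_exponent (p := 2) (by norm_num))
    rw [← mul_sub, ← integral_sub (hint i) (hint ℓ)]
    have : ∀ ξ, sourceProj F (h i) p ξ * g p ξ - sourceProj F (h ℓ) p ξ * g p ξ = g p ξ ^ 2 :=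
      fun ξ => by simp only [hg, projDiff]; ring
    simp only [this]
    ring
  refine ((e₁.sub e₂).add (f₁.sub f₂)).mono_of_compl hbad' fun ν => ?_
  filter_upwards [(hρ ν).optimal i ℓ hiℓ] with ω hω hgood
  simp only [not_not] at hgood
  -- optimality of the weights, compared with the tilted weights
  have h1 := hω.2 hgood
  simp only [Set.mem_ofPred_eq, objective_eq (hN ν), relDev_one_add_div (hN ν)] at h1
  have h2 := mul_le_mul_of_nonneg_left ((add_le_add_iff_left _).1 h1) (Real.sqrt_nonneg (n ν))
  have h3 : ∑ p, dataMean (g p) ((ρ ν).data ω) =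
      ∑ p, dataMean (sourceProj F (h i) p) ((ρ ν).data ω) -
        ∑ p, dataMean (sourceProj F (h ℓ) p) ((ρ ν).data ω) := by
    simp only [dataMean, hg, projDiff, Finset.sum_sub_distrib, mul_sub]
  have h4 : (ρ ν).bound h ω i ℓ = (R₂ ν : ℝ)⁻¹ * ∑ r, h i ((ρ ν).sim₂ i ℓ ω r) -
      (R₂ ν : ℝ)⁻¹ * ∑ r, h ℓ ((ρ ν).sim₂' i ℓ ω r) := by
    simp only [Run.bound, Finset.sum_sub_distrib, mul_sub]
  rw [h3, h4, ← hv, abs_of_nonpos (min_le_left _ _), neg_le]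
  refine le_min (by simp) ((neg_abs_le _).trans ?_)
  rw [mul_sub, mul_sub] at h2
  linarith

end TwoSolutions

/-! ### The central limit theorem for data from several sources -/

section CharacteristicFunctions

lemma norm_pow_sub_pow_le {z w : ℂ} (hz : ‖z‖ ≤ 1) (hw : ‖w‖ ≤ 1) (N : ℕ) :
    ‖z ^ N - w ^ N‖ ≤ N * ‖z - w‖ := by
  induction N with
  | zero => simp
  | succ N ih =>
    have e : z ^ (N + 1) - w ^ (N + 1) = (z ^ N - w ^ N) * z + w ^ N * (z - w) := by ring
    rw [e]
    refine (norm_add_le _ _).trans ?_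
    rw [norm_mul, norm_mul, norm_pow]
    have h1 : ‖z ^ N - w ^ N‖ * ‖z‖ ≤ N * ‖z - w‖ := by
      refine (mul_le_of_le_one_right (norm_nonneg _) hz).trans ih
    have h2 : ‖w‖ ^ N * ‖z - w‖ ≤ ‖z - w‖ :=
      mul_le_of_le_one_left (norm_nonneg _) (pow_le_one₀ (norm_nonneg _) hw)
    push_cast
    linarith

variable {α : Type*} [MeasurableSpace α] {μ : Measure α} [IsProbabilityMeasure μ] {u : α → ℝ}

/-- The characteristic function of a centred square integrable variable agrees to second order
with the one of the centred Gaussian of the same variance. -/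
lemma charFun_sub_charFun_gaussianReal_isLittleO (hu : Measurable u) (hu2 : MemLp u 2 μ)
    (h0 : ∫ a, u a ∂μ = 0) :
    (fun s : ℝ => charFun (μ.map u) s -
      charFun (gaussianReal 0 (∫ a, u a ^ 2 ∂μ).toNNReal) s) =o[𝓝 0] fun s : ℝ => s ^ 2 := by
  set v := ∫ a, u a ^ 2 ∂μ with hv
  have hv0 : 0 ≤ v := integral_nonneg fun _ => sq_nonneg _
  -- if the variance vanishes then both laws are the point mass at zero; otherwise the variables are
  -- normalized to unit variance
  rcases hv0.eq_or_lt with h | hpos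
  · have h1 : (fun a => u a ^ 2) =ᵐ[μ] 0 :=
      (integral_eq_zero_iff_of_nonneg (fun _ => sq_nonneg _) hu2.integrable_sq).1 h.symm
    have h2 : u =ᵐ[μ] fun _ => 0 := by
      filter_upwards [h1] with a ha
      simpa using ha
    have h3 : μ.map u = Measure.dirac 0 := by
      rw [Measure.map_congr h2, Measure.map_const, measure_univ, one_smul]
    simp [h3, ← h]
  · set σ := √v
    have hσ : σ ≠ 0 := (Real.sqrt_pos.2 hpos).ne'
    have hσ2 : σ ^ 2 = v := Real.sq_sqrt hv0
    have ht : Tendsto (fun s : ℝ => σ * s) (𝓝 0) (𝓝 0) := by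
      simpa using (continuous_const_mul σ).tendsto (0 : ℝ)
    have h1 := (taylor_charFun_two (P := μ) (X := fun a => σ⁻¹ * u a) (by fun_prop)
      (by simp [integral_const_mul, h0])
      (by simp only [Pi.pow_apply, mul_pow, integral_const_mul, ← hv, ← hσ2]; field_simp)).comp_tendsto ht
    have h2 := (taylor_charFun_two (P := gaussianReal 0 1) (X := id) (by fun_prop)
      (by simp) (by
        have h := variance_eq_sub (IsGaussian.memLp_two_id (μ := gaussianReal 0 1))
        simp only [variance_id_gaussianReal, integral_id_gaussianReal, id_eq] at h
        simpa using h.symm)).comp_tendsto ht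
    have h3 : (fun s : ℝ => (σ * s) ^ 2) =O[𝓝 0] fun s : ℝ => s ^ 2 := by
      simp only [mul_pow]
      exact Asymptotics.isBigO_const_mul_self _ _ _
    refine ((h1.sub h2).trans_isBigO h3).congr_left fun s => ?_
    have e1 : charFun (μ.map fun a => σ⁻¹ * u a) (σ * s) = charFun (μ.map u) s := by
      rw [charFun_map_mul_comp hu.aemeasurable, inv_mul_cancel_left₀ hσ]
    have e2 : charFun (gaussianReal 0 1) (σ * s) = charFun (gaussianReal 0 v.toNNReal) s := by
      rw [charFun_gaussianReal, charFun_gaussianReal, Real.coe_toNNReal _ hv0, ← hσ2]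
      congr 1
      push_cast
      ring
    simp only [Function.comp_apply, e1, Measure.map_id, e2]
    ring

/-- The central limit theorem for row-wise i.i.d. triangular arrays, in terms of characteristic
functions. -/
lemma tendsto_charFun_pow (hu : Measurable u) (hu2 : MemLp u 2 μ) (h0 : ∫ a, u a ∂μ = 0)
    {s : ℕ → ℝ} {K : ℕ → ℕ} {τ : ℝ} (hs : Tendsto s atTop (𝓝 0))
    (hK : Tendsto (fun ν => K ν * s ν ^ 2) atTop (𝓝 τ)) :
    Tendsto (fun ν => charFun (μ.map u) (s ν) ^ K ν) atTop
      (𝓝 (Complex.exp (-(τ * ∫ a, u a ^ 2 ∂μ : ℝ) / 2))) := by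
  have := Measure.isProbabilityMeasure_map (μ := μ) hu.aemeasurable
  set v := ∫ a, u a ^ 2 ∂μ with hv
  have hv0 : 0 ≤ v := integral_nonneg fun _ => sq_nonneg _
  have h1 := (charFun_sub_charFun_gaussianReal_isLittleO hu hu2 h0).comp_tendsto hs
  have h2 : Tendsto (fun ν => (K ν : ℝ) * ‖charFun (μ.map u) (s ν) -
      charFun (gaussianReal 0 v.toNNReal) (s ν)‖) atTop (𝓝 0) := by
    have h3 := ((Asymptotics.isBigO_refl (fun ν => (K ν : ℝ)) atTop).mul_isLittleO h1.norm_left)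
    exact (h3.trans_isBigO (hK.isBigO_one ℝ)).tendsto_zero_of_tendsto tendsto_const_nhds
  have h3 : Tendsto (fun ν => charFun (gaussianReal 0 v.toNNReal) (s ν) ^ K ν) atTop
      (𝓝 (Complex.exp (-(τ * v : ℝ) / 2))) := by
    have e : ∀ ν, charFun (gaussianReal 0 v.toNNReal) (s ν) ^ K ν =
        Complex.exp (-((K ν * s ν ^ 2) * v : ℝ) / 2) := fun ν => by
      rw [charFun_gaussianReal, Real.coe_toNNReal _ hv0, ← Complex.exp_nat_mul]
      congr 1
      push_cast
      ring
    simp only [e]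
    have h4 := (Complex.continuous_ofReal.tendsto _).comp (hK.mul_const v)
    exact (Complex.continuous_exp.tendsto _).comp ((h4.neg).div_const 2)
  have h4 : Tendsto (fun ν => charFun (μ.map u) (s ν) ^ K ν -
      charFun (gaussianReal 0 v.toNNReal) (s ν) ^ K ν) atTop (𝓝 0) :=
    squeeze_zero_norm (fun ν => norm_pow_sub_pow_le (norm_charFun_le_one _)
      (norm_charFun_le_one _) _) h2
  simpa using h4.add h3

end CharacteristicFunctions

section CentralLimit

variable {m : ℕ} {S : Fin m → Type*} [∀ p, MeasurableSpace (S p)]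
  {F : ∀ p, Measure (S p)} [∀ p, IsProbabilityMeasure (F p)] {ι : Type*} [Fintype ι]
  {g : ι → ∀ p, S p → ℝ}

lemma integral_prod_inputLaw {N : Fin m → ℕ} (f : ∀ p, S p → ℂ) :
    ∫ x : Inputs S N, ∏ p, ∏ j, f p (x p j) ∂(inputLaw F N) = ∏ p, (∫ ξ, f p ξ ∂(F p)) ^ N p := by
  rw [inputLaw, integral_fintype_prod_eq_prod (f := fun p (y : Fin (N p) → S p) => ∏ j, f p (y j))]
  refine Finset.prod_congr rfl fun p _ => ?_
  rw [integral_fintype_prod_eq_prod (f := fun _ : Fin (N p) => f p)]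
  simp

/-- The asymptotic covariance matrix of the weighted sums of the empirical means of `g`. -/
noncomputable def asymCov (F : ∀ p, Measure (S p)) (β : Fin m → ℝ) (g : ι → ∀ p, S p → ℝ) :
    Matrix ι ι ℝ :=
  Matrix.of fun i j => ∑ p, (∫ ξ, g i p ξ * g j p ξ ∂(F p)) / β p

lemma dotProduct_asymCov {β : Fin m → ℝ} (hg2 : ∀ i p, MemLp (g i p) 2 (F p)) (t : ι → ℝ) :
    t ⬝ᵥ (asymCov F β g).mulVec t =
      ∑ p, (∫ ξ, (∑ i, t i * g i p ξ) ^ 2 ∂(F p)) / β p := by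
  have h : ∀ p, ∫ ξ, (∑ i, t i * g i p ξ) ^ 2 ∂(F p) =
      ∑ i, ∑ j, t i * (t j * ∫ ξ, g i p ξ * g j p ξ ∂(F p)) := fun p => by
    have e : ∀ ξ, (∑ i, t i * g i p ξ) ^ 2 = ∑ i, ∑ j, t i * (t j * (g i p ξ * g j p ξ)) :=
      fun ξ => by
        rw [sq, Finset.sum_mul_sum]
        exact Finset.sum_congr rfl fun i _ => Finset.sum_congr rfl fun j _ => by ring
    have hi : ∀ i j, Integrable (fun ξ => t i * (t j * (g i p ξ * g j p ξ))) (F p) := fun i j =>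
      (((hg2 i p).integrable_mul (hg2 j p)).const_mul _).const_mul _
    simp only [e]
    rw [integral_finsetSum _ fun i _ => integrable_finsetSum _ fun j _ => hi i j]
    refine Finset.sum_congr rfl fun i _ => ?_
    rw [integral_finsetSum _ fun j _ => hi i j]
    simp only [integral_const_mul]
  simp only [h, dotProduct, Matrix.mulVec, asymCov, Matrix.of_apply, Finset.sum_mul,
    Finset.mul_sum, Finset.sum_div]
  rw [Finset.sum_comm (s := (Finset.univ : Finset (Fin m)))]
  refine Finset.sum_congr rfl fun i _ => ?_
  rw [Finset.sum_comm (s := (Finset.univ : Finset (Fin m)))]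
  exact Finset.sum_congr rfl fun j _ => Finset.sum_congr rfl fun p _ => by ring

lemma posSemidef_asymCov {β : Fin m → ℝ} (hβ : ∀ p, 0 < β p)
    (hg2 : ∀ i p, MemLp (g i p) 2 (F p)) : (asymCov F β g).PosSemidef := by
  refine Matrix.PosSemidef.of_dotProduct_mulVec_nonneg ?_ fun t => ?_
  · ext i j
    simp [asymCov, mul_comm]
  · rw [star_trivial, dotProduct_asymCov hg2]
    exact Finset.sum_nonneg fun p _ => div_nonneg (integral_nonneg fun _ => sq_nonneg _) (hβ p).le

/-- The vector of the normalized sums over the sources of the empirical means of `g`. -/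
noncomputable def scoreVec {N : Fin m → ℕ} (g : ι → ∀ p, S p → ℝ) (a : ℝ) (x : Inputs S N) :
    EuclideanSpace ℝ ι :=
  WithLp.toLp 2 fun i => a * ∑ p, dataMean (g i p) x

lemma measurable_scoreVec {N : Fin m → ℕ} (hg : ∀ i p, Measurable (g i p)) (a : ℝ) :
    Measurable (scoreVec (N := N) g a) := by
  unfold scoreVec dataMean
  fun_prop

/-- By independence, the characteristic function of the score vector factors over the sources and
the data points. -/
lemma charFun_map_scoreVec {N : Fin m → ℕ} (hg : ∀ i p, Measurable (g i p)) (a : ℝ)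
    (t : EuclideanSpace ℝ ι) :
    charFun ((inputLaw F N).map (scoreVec g a)) t =
      ∏ p, charFun ((F p).map fun ξ => ∑ i, t i * g i p ξ) (a / N p) ^ N p := by
  rw [charFun_apply, integral_map (measurable_scoreVec hg a).aemeasurable (by fun_prop)]
  have hu : ∀ p, Measurable fun ξ => ∑ i, t i * g i p ξ := fun p => by fun_prop
  have e : ∀ p, charFun ((F p).map fun ξ => ∑ i, t i * g i p ξ) (a / N p) =
      ∫ ξ, Complex.exp (((a / N p : ℝ) : ℂ) * ((∑ i, t i * g i p ξ : ℝ) : ℂ) * Complex.I) ∂(F p) :=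
    fun p => by
      rw [charFun_apply_real, integral_map (hu p).aemeasurable (by fun_prop)]
  simp only [e]
  rw [← integral_prod_inputLaw]
  refine integral_congr_ae (.of_forall fun x => ?_)
  simp only [← Complex.exp_sum, ← Finset.sum_mul, ← Complex.ofReal_mul, ← Complex.ofReal_sum]
  congr 3
  simp only [scoreVec, PiLp.inner_apply, RCLike.inner_apply, conj_trivial, dataMean,
    Finset.mul_sum]
  rw [Finset.sum_comm]
  refine Finset.sum_congr rfl fun p _ => ?_
  rw [Finset.sum_comm]
  refine Finset.sum_congr rfl fun j _ => Finset.sum_congr rfl fun i _ => ?_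
  ring

variable [DecidableEq ι] {N : ℕ → Fin m → ℕ} {n : ℕ → ℝ} {β : Fin m → ℝ}

/-- The multivariate central limit theorem for data from several sources. -/
theorem liminf_scoreVec_ge (hg : ∀ i p, Measurable (g i p)) (hg2 : ∀ i p, MemLp (g i p) 2 (F p))
    (hg0 : ∀ i p, ∫ ξ, g i p ξ ∂(F p) = 0) (hn : Tendsto n atTop atTop)
    (hβ : ∀ p, 0 < β p)
    (hNβ : ∀ p, Tendsto (fun ν => (N ν p : ℝ) / n ν) atTop (𝓝 (β p)))
    {G : Set (EuclideanSpace ℝ ι)} (hG : IsOpen G) :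
    multivariateGaussian 0 (asymCov F β g) G ≤
      liminf (fun ν => inputLaw F (N ν) (scoreVec g √(n ν) ⁻¹' G)) atTop := by
  have hm := fun ν => measurable_scoreVec (N := N ν) hg √(n ν)
  let μs : ℕ → ProbabilityMeasure (EuclideanSpace ℝ ι) := fun ν =>
    ⟨(inputLaw F (N ν)).map (scoreVec g √(n ν)),
      Measure.isProbabilityMeasure_map (hm ν).aemeasurable⟩
  let μ₀ : ProbabilityMeasure (EuclideanSpace ℝ ι) :=
    ⟨multivariateGaussian 0 (asymCov F β g), inferInstance⟩
  have hlim : Tendsto μs atTop (𝓝 μ₀) := by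
    refine ProbabilityMeasure.tendsto_of_tendsto_charFun fun t => ?_
    simp only [μs, μ₀, ProbabilityMeasure.coe_mk, charFun_map_scoreVec hg,
      charFun_multivariateGaussian (posSemidef_asymCov hβ hg2), dotProduct_asymCov hg2]
    have e : Complex.exp ((inner ℝ t (0 : EuclideanSpace ℝ ι) : ℝ) * Complex.I -
        ((∑ p, (∫ ξ, (∑ i, t i * g i p ξ) ^ 2 ∂(F p)) / β p : ℝ) : ℂ) / 2) =
        ∏ p, Complex.exp (-((β p)⁻¹ * ∫ ξ, (∑ i, t i * g i p ξ) ^ 2 ∂(F p) : ℝ) / 2) := by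
      rw [← Complex.exp_sum]
      congr 1
      rw [inner_zero_right, ← Finset.sum_div, Finset.sum_neg_distrib, ← Complex.ofReal_sum]
      simp only [Complex.ofReal_zero, zero_mul, zero_sub, div_eq_inv_mul, mul_neg]
    rw [e]
    refine tendsto_finsetProd _ fun p _ => ?_
    have h1 : Tendsto (fun ν => n ν / N ν p) atTop (𝓝 (β p)⁻¹) := by
      simpa only [inv_div] using (hNβ p).inv₀ (hβ p).ne'
    refine tendsto_charFun_pow (by fun_prop) (memLp_finsetSum _ fun i _ => (hg2 i p).const_mul _)
      ?_ ?_ ?_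
    · rw [integral_finsetSum _ fun i _ => ((hg2 i p).integrable one_le_two).const_mul _]
      simp [integral_const_mul, hg0]
    · have h2 := h1.mul (Real.tendsto_sqrt_atTop.comp hn).inv_tendsto_atTop
      rw [mul_zero] at h2
      refine h2.congr' ?_
      filter_upwards [hn.eventually_gt_atTop 0] with ν hν
      have h3 : √(n ν) ≠ 0 := (Real.sqrt_pos.2 hν).ne'
      simp only [Pi.inv_apply, Function.comp_apply]
      rw [div_mul_eq_mul_div]
      congr 1
      rw [mul_inv_eq_iff_eq_mul₀ h3, Real.mul_self_sqrt hν.le]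
    · refine h1.congr' ?_
      filter_upwards [hn.eventually_gt_atTop 0] with ν hν
      rw [div_pow, Real.sq_sqrt hν.le]
      -- if `N ν p = 0` then both sides are zero, as `x / 0 = 0`
      by_cases h4 : (N ν p : ℝ) = 0
      · simp [h4]
      · field_simp
  have h := ProbabilityMeasure.le_liminf_measure_open_of_tendsto hlim hG
  simpa only [μs, μ₀, ProbabilityMeasure.coe_mk, Measure.map_apply (hm _) hG.measurableSet] using h

end CentralLimit

/-! ### The chi-square distribution and its quantiles -/

section ChiSquared

lemma measurable_sum_sq (q : ℕ) : Measurable fun z : Fin q → ℝ => ∑ i, z i ^ 2 := by fun_prop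

instance isProbabilityMeasure_chiSquared (q : ℕ) : IsProbabilityMeasure (chiSquared q) :=
  Measure.isProbabilityMeasure_map (measurable_sum_sq q).aemeasurable

lemma chiSquared_apply (q : ℕ) {A : Set ℝ} (hA : MeasurableSet A) :
    chiSquared q A = Measure.pi (fun _ : Fin q => gaussianReal 0 1) {z | ∑ i, z i ^ 2 ∈ A} :=
  Measure.map_apply (measurable_sum_sq q) hA

/-- Given all but one of the Gaussian variables, the sum of squares determines the remaining one up
to its sign. -/
lemma chiSquared_singleton {q : ℕ} (hq : 0 < q) (c : ℝ) : chiSquared q {c} = 0 := by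
  obtain ⟨d, rfl⟩ : ∃ d, q = d + 1 := ⟨q - 1, by omega⟩
  rw [chiSquared_apply _ (measurableSet_singleton c)]
  have hp := measurePreserving_piFinSuccAbove (fun _ : Fin (d + 1) => gaussianReal 0 1) 0
  set B : Set (ℝ × (Fin d → ℝ)) := {y | y.1 ^ 2 + ∑ i, y.2 i ^ 2 = c} with hB
  have hBm : MeasurableSet B := measurableSet_eq_fun (by fun_prop) (by fun_prop)
  have e : {z : Fin (d + 1) → ℝ | ∑ i, z i ^ 2 ∈ ({c} : Set ℝ)} =
      MeasurableEquiv.piFinSuccAbove (fun _ => ℝ) 0 ⁻¹' B := by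
    ext z
    simp only [hB, Set.mem_ofPred_eq, Set.mem_singleton_iff, Set.mem_preimage, Fin.sum_univ_succ]
    rfl
  rw [e, hp.measure_preimage hBm.nullMeasurableSet, Measure.prod_apply_symm hBm]
  refine lintegral_eq_zero_of_ae_eq_zero (.of_forall fun y => ?_)
  have hfin : Set.Finite ((fun a : ℝ => (a, y)) ⁻¹' B) := by
    refine (Set.toFinite {√(c - ∑ i, y i ^ 2), -√(c - ∑ i, y i ^ 2)}).subset fun a ha => ?_
    have h1 : a ^ 2 = c - ∑ i, y i ^ 2 := eq_sub_of_add_eq ha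
    have h2 : √(c - ∑ i, y i ^ 2) = |a| := by rw [← h1, Real.sqrt_sq_eq_abs]
    simp only [h2, Set.mem_insert_iff, Set.mem_singleton_iff]
    rcases abs_choice a with h | h <;> rw [h] <;> simp
  have := nullSingletonClass_gaussianReal (μ := 0) (v := 1) one_ne_zero
  exact hfin.measure_zero _

lemma chiSquared_real_Iic_zero {q : ℕ} (hq : 0 < q) : (chiSquared q).real (Set.Iic 0) = 0 := by
  have h : chiSquared q (Set.Iic 0) ≤ chiSquared q {0} := by
    rw [chiSquared_apply _ measurableSet_Iic, chiSquared_apply _ (measurableSet_singleton _)]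
    exact measure_mono fun z hz => le_antisymm hz (Finset.sum_nonneg fun _ _ => sq_nonneg _)
  rw [chiSquared_singleton hq] at h
  simp [Measure.real, le_antisymm h zero_le]

variable {q : ℕ} {γ : ℝ}

/-- The quantile is attained, by right continuity of the distribution function. -/
lemma le_chiSquared_real_Iic_quantile (hγ1 : γ < 1) :
    γ ≤ (chiSquared q).real (Set.Iic (chiSquaredQuantile q γ)) := by
  set A := {x : ℝ | γ ≤ (chiSquared q).real (Set.Iic x)} with hA
  have hne : A.Nonempty := by
    have h := (tendsto_cdf_atTop (chiSquared q)).eventually (lt_mem_nhds hγ1)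
    obtain ⟨x, hx⟩ := h.exists
    exact ⟨x, by rw [cdf_eq_real] at hx; exact hx.le⟩
  have h1 : ∀ᶠ x in 𝓝[>] (sInf A), γ ≤ cdf (chiSquared q) x := by
    filter_upwards [self_mem_nhdsWithin] with x hx
    obtain ⟨y, hy, hyx⟩ := exists_lt_of_csInf_lt hne hx
    rw [cdf_eq_real]
    exact le_trans hy (measureReal_mono (Set.Iic_subset_Iic.2 hyx.le))
  have h2 : Tendsto (cdf (chiSquared q)) (𝓝[>] (sInf A)) (𝓝 (cdf (chiSquared q) (sInf A))) :=
    ((cdf (chiSquared q)).right_continuous (sInf A)).tendsto.mono_left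
      (nhdsWithin_mono _ Set.Ioi_subset_Ici_self)
  have h3 := ge_of_tendsto h2 h1
  rwa [cdf_eq_real] at h3

lemma chiSquaredQuantile_pos (hq : 0 < q) (hγ0 : 0 < γ) (hγ1 : γ < 1) :
    0 < chiSquaredQuantile q γ := by
  by_contra h
  have h1 := le_chiSquared_real_Iic_quantile (q := q) hγ1
  have h2 := measureReal_mono (μ := chiSquared q) (Set.Iic_subset_Iic.2 (not_lt.1 h))
  rw [chiSquared_real_Iic_zero hq] at h2
  linarith

lemma le_chiSquared_Iio_quantile (hq : 0 < q) (hγ1 : γ < 1) :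
    ENNReal.ofReal γ ≤ chiSquared q (Set.Iio (chiSquaredQuantile q γ)) := by
  refine (ENNReal.ofReal_le_ofReal (le_chiSquared_real_Iic_quantile (q := q) hγ1)).trans ?_
  rw [ofReal_measureReal, ← Set.Iio_union_right]
  refine (measure_union_le _ _).trans ?_
  rw [chiSquared_singleton hq, add_zero]

end ChiSquared

/-! ### Simultaneous bounds for Gaussian vectors -/

section Scheffe

variable {q : ℕ}

lemma stdGaussian_ball_eq (r : ℝ) (hr : 0 ≤ r) :
    stdGaussian (EuclideanSpace ℝ (Fin q)) {y | ‖y‖ < r} = chiSquared q (Set.Iio (r ^ 2)) := by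
  rw [← map_pi_eq_stdGaussian, Measure.map_apply (by fun_prop)
    (measurableSet_lt measurable_norm measurable_const), chiSquared_apply _ measurableSet_Iio]
  congr 1
  ext z
  simp only [Set.mem_preimage, Set.mem_ofPred_eq, Set.mem_Iio]
  rw [← sq_lt_sq₀ (norm_nonneg _) hr, EuclideanSpace.real_norm_sq_eq]

/-- Scheffé's simultaneous bounds for the coordinates of a Gaussian vector: by the Cauchy–Schwarz
inequality all of them hold if the underlying standard Gaussian vector has norm less than `r`. -/
theorem chiSquared_le_multivariateGaussian {M : Matrix (Fin q) (Fin q) ℝ} (hM : M.PosSemidef)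
    (hpos : ∀ i, 0 < M i i) {r : ℝ} (hr : 0 ≤ r) :
    chiSquared q (Set.Iio (r ^ 2)) ≤
      multivariateGaussian 0 M {y | ∀ i, -(r * √(M i i)) < y i} := by
  -- the Gaussian vector with covariance `M` is the image of a standard one under the root of `M`
  open scoped MatrixOrder in
  set L := Matrix.toEuclideanCLM (n := Fin q) (𝕜 := ℝ) (CFC.sqrt M) with hL
  have hmeas : MeasurableSet {y : EuclideanSpace ℝ (Fin q) | ∀ i, -(r * √(M i i)) < y i} := by
    rw [Set.ofPred_forall]
    exact MeasurableSet.iInter fun i => measurableSet_lt measurable_const (by fun_prop)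
  have hLm : Measurable fun x => 0 + L x := by fun_prop
  rw [multivariateGaussian, ← stdGaussian_ball_eq r hr, Measure.map_apply hLm hmeas]
  refine measure_mono fun y hy i => ?_
  open scoped MatrixOrder in
  have hadj : ContinuousLinearMap.adjoint L = L := by
    rw [← ContinuousLinearMap.star_eq_adjoint]
    exact (CFC.sqrt_nonneg M).isSelfAdjoint.map _
  have hLL : L * L = Matrix.toEuclideanCLM (n := Fin q) (𝕜 := ℝ) M := by
    open scoped MatrixOrder in
    rw [hL, ← map_mul, CFC.sqrt_mul_sqrt_self _ hM.nonneg]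
  set e : EuclideanSpace ℝ (Fin q) := EuclideanSpace.single i 1 with he
  have h1 : ∀ z : EuclideanSpace ℝ (Fin q), inner ℝ e z = z i := fun z => by
    simp [he, EuclideanSpace.inner_single_left]
  have h2 : inner ℝ (L e) y = (L y) i := by
    rw [← h1 (L y), ← ContinuousLinearMap.adjoint_inner_left, hadj]
  have h3 : ‖L e‖ ^ 2 = M i i := by
    rw [← real_inner_self_eq_norm_sq, ← ContinuousLinearMap.adjoint_inner_left, hadj,
      real_inner_comm]
    change inner ℝ e ((L * L) e) = _
    rw [h1, hLL]
    simp [he, Matrix.ofLp_toEuclideanCLM]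
  have h4 : ‖L e‖ = √(M i i) := by rw [← h3, Real.sqrt_sq (norm_nonneg _)]
  have h5 := abs_real_inner_le_norm (L e) y
  rw [h2, h4] at h5
  have h6 : √(M i i) * ‖y‖ < √(M i i) * r :=
    mul_lt_mul_of_pos_left hy (Real.sqrt_pos.2 (hpos i))
  have h7 := (abs_le.1 h5).1
  simp only [zero_add]
  linarith

end Scheffe

/-! ### Multiple comparisons with the best -/

section MultipleComparisons

variable {k : ℕ} {θ : Fin k → ℝ} {U : Fin k → Fin k → ℝ} {c : Fin k}

/-- If the bounds for the best solution are valid then it is in the confidence set. -/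
lemma mem_confidenceSet_of_bounds (hk : 2 ≤ k) (hc : ∀ i, i ≠ c → θ i < θ c)
    (hU : ∀ ℓ, ℓ ≠ c → θ c - θ ℓ ≤ U c ℓ) : c ∈ confidenceSet U := by
  have hne : Nonempty {ℓ : Fin k // ℓ ≠ c} := by
    have : Nontrivial (Fin k) := Fin.nontrivial_iff_two_le.2 hk
    obtain ⟨ℓ, hℓ⟩ := exists_ne c
    exact ⟨⟨ℓ, hℓ⟩⟩
  obtain ⟨ℓ, hℓ⟩ :=
    exists_eq_ciInf_of_finite (f := fun ℓ : {ℓ : Fin k // ℓ ≠ c} => (U c ℓ : ℝ))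
  refine lt_max_of_lt_right (lt_of_lt_of_eq ?_ hℓ)
  linarith [hc ℓ ℓ.2, hU ℓ ℓ.2]

/-- Validity of the bounds for the best solution implies that all the intervals of the multiple
comparisons with the best cover. -/
lemma mem_mcbInterval_of_bounds (hk : 2 ≤ k) (hc : ∀ i, i ≠ c → θ i < θ c)
    (hU : ∀ ℓ, ℓ ≠ c → θ c - θ ℓ ≤ U c ℓ) (i : Fin k) :
    θ i - (⨆ ℓ : {ℓ : Fin k // ℓ ≠ i}, θ ℓ) ∈ Set.Icc (mcbLower U i) (mcbUpper U i) := by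
  have hcI := mem_confidenceSet_of_bounds hk hc hU
  have hne : Nonempty {ℓ : Fin k // ℓ ≠ i} := by
    have : Nontrivial (Fin k) := Fin.nontrivial_iff_two_le.2 hk
    obtain ⟨ℓ, hℓ⟩ := exists_ne i
    exact ⟨⟨ℓ, hℓ⟩⟩
  have hbdd : BddAbove (Set.range fun ℓ : {ℓ : Fin k // ℓ ≠ i} => θ ℓ) := Set.finite_range _ |>.bddAbove
  have hlow : mcbLower U i ≤ 0 := by
    unfold mcbLower
    split_ifs
    · exact le_rfl
    · simp
  by_cases hi : i = c
  · subst hi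
    obtain ⟨ℓ, hℓ⟩ := exists_eq_ciSup_of_finite (f := fun ℓ : {ℓ : Fin k // ℓ ≠ i} => θ ℓ)
    refine ⟨hlow.trans ?_, le_max_of_le_right (le_ciInf fun ℓ' => ?_)⟩
    · rw [← hℓ]
      linarith [hc ℓ ℓ.2]
    · linarith [hU ℓ' ℓ'.2, le_ciSup hbdd ℓ']
  · have hsup : (⨆ ℓ : {ℓ : Fin k // ℓ ≠ i}, θ ℓ) = θ c := by
      refine le_antisymm (ciSup_le fun ℓ => ?_) (le_ciSup hbdd ⟨c, fun h => hi h.symm⟩)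
      by_cases h : (ℓ : Fin k) = c
      · rw [h]
      · exact (hc ℓ h).le
    rw [hsup]
    refine ⟨?_, (sub_nonpos.2 (hc i hi).le).trans (le_max_left _ _)⟩
    have hI : confidenceSet U ≠ {i} := fun h => hi (by rw [h] at hcI; exact hcI.symm)
    rw [mcbLower, if_neg hI, neg_le]
    refine le_max_of_le_right (neg_le_neg ?_)
    refine (ciInf_le (Set.finite_range _).bddBelow ⟨c, hcI, fun h => hi h.symm⟩).trans ?_
    linarith [hU i hi]

end MultipleComparisons

/-! ### Atomless data, fourth moments and positive variances -/

section Assumptions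

variable {m : ℕ} {S : Fin m → Type*} [∀ p, MeasurableSpace (S p)]
  {F : ∀ p, Measure (S p)} [∀ p, IsProbabilityMeasure (F p)]

/-- Data from distributions without atoms have no ties, almost surely. -/
lemma ae_injective_inputLaw [∀ p, MeasurableEq (S p)] (hF : ∀ p, NullSingletonClass (F p))
    (N : Fin m → ℕ) : ∀ᵐ x ∂(inputLaw F N), ∀ p, Function.Injective (x p) := by
  have h : ∀ p, ∀ j j' : Fin (N p), j ≠ j' → ∀ᵐ x ∂(inputLaw F N), x p j ≠ x p j' := by
    intro p j j' hj
    have := hF p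
    have hp := measurePreserving_updateSlot F (⟨p, j⟩ : Slot N)
    have hm : MeasurableSet {x : Inputs S N | x p j = x p j'} :=
      measurableSet_eq_fun (by fun_prop) (by fun_prop)
    rw [ae_iff]
    simp only [ne_eq, not_not]
    rw [← hp.measure_preimage hm.nullMeasurableSet, Measure.prod_apply_symm (hp.measurable hm)]
    refine lintegral_eq_zero_of_ae_eq_zero (.of_forall fun z => ?_)
    have e : (fun ξ : S p => (ξ, z)) ⁻¹' ((fun q : S p × Inputs S N =>
        updateSlot q.2 (⟨p, j⟩ : Slot N) q.1) ⁻¹' {x | x p j = x p j'}) = {z p j'} := by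
      ext ξ
      have h1 : updateSlot z (⟨p, j⟩ : Slot N) ξ p j = ξ := updateSlot_apply_self z ⟨p, j⟩ ξ
      have h2 : updateSlot z (⟨p, j⟩ : Slot N) ξ p j' = z p j' :=
        updateSlot_apply_of_ne z (s := (⟨p, j⟩ : Slot N)) ξ (by simpa using hj.symm)
      simp only [Set.mem_preimage, Set.mem_ofPred_eq, h1, h2, Set.mem_singleton_iff]
    exact (congrArg (F p) e).trans (measure_singleton _)
  have h' : ∀ᵐ x ∂(inputLaw F N), ∀ p, ∀ j j' : Fin (N p), j ≠ j' → x p j ≠ x p j' := by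
    simp only [ae_all_iff]
    exact h
  filter_upwards [h'] with x hx p j j' hjj
  by_contra hne
  exact hx p j j' hne hjj

lemma nullSingletonClass_of_absolutelyContinuous {d : ℕ} (hd : 0 < d)
    {Ξ : Set (EuclideanSpace ℝ (Fin d))} {μ : Measure Ξ} (h : μ.map Subtype.val ≪ volume) :
    NullSingletonClass μ := by
  have : Nonempty (Fin d) := ⟨⟨0, hd⟩⟩
  constructor
  intro x
  have h1 : μ.map Subtype.val {(x : EuclideanSpace ℝ (Fin d))} = 0 := h (measure_singleton _)
  rw [Measure.map_apply measurable_subtype_coe (measurableSet_singleton _)] at h1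
  exact measure_mono_null (fun y hy => by simp_all) h1

lemma covariance_eq_zero_of_subsingleton {α : Type*} [MeasurableSpace α] [Subsingleton α]
    {μ : Measure α} [IsProbabilityMeasure μ] (f g : α → ℝ) : covariance f g μ = 0 := by
  have h : ∀ a, f a - ∫ b, f b ∂μ = 0 := fun a => by
    have e : f = fun _ => f a := funext fun b => congrArg f (Subsingleton.elim b a)
    rw [e]
    simp
  simp [covariance, h]

variable {k : ℕ} {T : Fin k → Fin m → ℕ} {h : ∀ i, Inputs S (T i) → ℝ}

/-- In dimension zero the influence functions would be constant and their covariances zero, so that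
a positive definite covariance matrix excludes this case. -/
lemma nullSingletonClass_of_posDef (hk : 2 ≤ k) {d : Fin m → ℕ}
    {Ξ : ∀ p, Set (EuclideanSpace ℝ (Fin (d p)))} {F : ∀ p, Measure (Ξ p)}
    [∀ p, IsProbabilityMeasure (F p)] (hF : ∀ p, (F p).map Subtype.val ≪ volume)
    {h : ∀ i, Inputs (fun p => Ξ p) (T i) → ℝ} (h_cov : ∀ p, (influenceCov h F p).PosDef)
    (p : Fin m) : NullSingletonClass (F p) := by
  refine nullSingletonClass_of_absolutelyContinuous (Nat.pos_of_ne_zero fun hd => ?_) (hF p)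
  have h1 : Subsingleton (EuclideanSpace ℝ (Fin (d p))) := by
    have : IsEmpty (Fin (d p)) := by rw [hd]; infer_instance
    infer_instance
  have h2 := (h_cov p).diag_pos (i := (⟨0, by omega⟩ : Fin k))
  simp only [influenceCov, Matrix.of_apply] at h2
  rw [covariance_eq_zero_of_subsingleton] at h2
  exact lt_irrefl _ h2

lemma memLp_two_sq_of_integrable_pow_four {α : Type*} [MeasurableSpace α] {μ : Measure α}
    {f : α → ℝ} (hf : Measurable f) (hi : Integrable (fun a => |f a| ^ 4) μ) :
    MemLp (fun a => f a ^ 2) 2 μ := by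
  refine (memLp_two_iff_integrable_sq (hf.pow_const 2).aestronglyMeasurable).2 ?_
  refine hi.congr (.of_forall fun a => ?_)
  simp only [Even.pow_abs (show Even 4 by decide)]
  ring

lemma reuseMemLp_sq_of_integrable {T : Fin m → ℕ} {φ : Inputs S T → ℝ} (hm : Measurable φ)
    (h4 : ∀ I : ∀ p, Fin (T p) → Fin (T p),
      Integrable (fun z => |φ fun p t => z p (I p t)| ^ 4) (inputLaw F T)) :
    ReuseMemLp F fun z => φ z ^ 2 :=
  ⟨hm.pow_const 2, fun I => memLp_two_sq_of_integrable_pow_four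
    (hm.comp (measurable_reuse I)) (h4 I)⟩

lemma ReuseMemLp.of_sq {T : Fin m → ℕ} {φ : Inputs S T → ℝ} (hm : Measurable φ)
    (h : ReuseMemLp F fun z => φ z ^ 2) : ReuseMemLp F φ :=
  ⟨hm, fun I => (memLp_two_iff_integrable_sq
    (hm.comp (measurable_reuse I)).aestronglyMeasurable).2 ((h.memLp I).integrable one_le_two)⟩

/-- The variances of the differences of influence functions are positive. -/
lemma integral_sq_projDiff_pos (hh : ∀ i, ReuseMemLp F (h i)) {p : Fin m}
    (h_cov : (influenceCov h F p).PosDef) {i ℓ : Fin k} (hiℓ : i ≠ ℓ) :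
    0 < ∫ ξ, projDiff F h i ℓ p ξ ^ 2 ∂(F p) := by
  have hsp : ∀ i, MemLp (sourceProj F (h i) p) 2 (F p) := fun i =>
    memLp_finsetSum _ fun t _ => memLp_slotProj (hh i).measurable (hh i).memLp_self ⟨p, t⟩
  have hM : ∀ i j, influenceCov h F p i j =
      ∫ ξ, sourceProj F (h i) p ξ * sourceProj F (h j) p ξ ∂(F p) := fun i j => by
    have hi : ∀ i, influence (h i) F p =ᵐ[F p] sourceProj F (h i) p := fun i =>
      influence_ae_eq (hh i) p
    have h0 : ∀ i, ∫ ξ, influence (h i) F p ξ ∂(F p) = 0 := fun i => by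
      rw [integral_congr_ae (hi i), integral_sourceProj (hh i).measurable (hh i).memLp_self]
    simp only [influenceCov, Matrix.of_apply, covariance, h0, sub_zero]
    refine integral_congr_ae ?_
    filter_upwards [hi i, hi j] with ξ h1 h2
    rw [h1, h2]
  -- the variance is the quadratic form at the contrast between `i` and `ℓ`
  have hne : (Pi.single i 1 - Pi.single ℓ 1 : Fin k → ℝ) ≠ 0 := fun h => by
    have := congrFun h i
    simp [hiℓ] at this
  have hpos := h_cov.dotProduct_mulVec_pos hne
  have hint : ∀ i j, Integrable (fun ξ => sourceProj F (h i) p ξ * sourceProj F (h j) p ξ) (F p) :=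
    fun i j => (hsp i).integrable_mul (hsp j)
  have hint' : ∀ i j l, Integrable (fun ξ => sourceProj F (h i) p ξ * sourceProj F (h j) p ξ -
      sourceProj F (h i) p ξ * sourceProj F (h l) p ξ) (F p) :=
    fun i j l => (hint i j).sub (hint i l)
  have e : ∀ ξ, projDiff F h i ℓ p ξ ^ 2 =
      (sourceProj F (h i) p ξ * sourceProj F (h i) p ξ -
        sourceProj F (h i) p ξ * sourceProj F (h ℓ) p ξ) -
      (sourceProj F (h ℓ) p ξ * sourceProj F (h i) p ξ -
        sourceProj F (h ℓ) p ξ * sourceProj F (h ℓ) p ξ) := fun ξ => by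
    simp only [projDiff]
    ring
  simp only [e]
  rw [integral_sub (hint' i i ℓ) (hint' ℓ i ℓ),
    integral_sub (hint i i) (hint i ℓ), integral_sub (hint ℓ i) (hint ℓ ℓ),
    ← hM, ← hM, ← hM, ← hM]
  refine lt_of_lt_of_eq hpos ?_
  rw [star_trivial]
  simp only [Matrix.mulVec_sub, sub_dotProduct, dotProduct_sub, Matrix.mulVec_single_one,
    single_dotProduct, Matrix.col_apply, one_mul]
  ring

lemma exists_eventually_mul_le {N : ℕ → Fin m → ℕ} {n : ℕ → ℝ} {β : Fin m → ℝ}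
    (hn : Tendsto n atTop atTop) (hβ : ∀ p, 0 < β p)
    (hNβ : ∀ p, Tendsto (fun ν => (N ν p : ℝ) / n ν) atTop (𝓝 (β p))) :
    ∃ c : ℝ, 0 < c ∧ ∀ᶠ ν in atTop, ∀ p, c * n ν ≤ N ν p := by
  obtain ⟨c, hc, hcβ⟩ : ∃ c : ℝ, 0 < c ∧ ∀ p, c < β p := by
    rcases isEmpty_or_nonempty (Fin m) with h | h
    · exact ⟨1, one_pos, fun p => isEmptyElim p⟩
    · obtain ⟨p₀, hp₀⟩ := Finite.exists_min β
      exact ⟨β p₀ / 2, half_pos (hβ p₀), fun p => (half_lt_self (hβ p₀)).trans_le (hp₀ p)⟩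
  refine ⟨c, hc, ?_⟩
  filter_upwards [eventually_all.2 fun p => (hNβ p).eventually (lt_mem_nhds (hcβ p)),
    hn.eventually_gt_atTop 0] with ν h1 h2 p
  exact ((lt_div_iff₀ h2).1 (h1 p)).le

end Assumptions

/-! ### Asymptotic coverage -/

section Coverage

variable {k m : ℕ} {S : Fin m → Type*} [∀ p, MeasurableSpace (S p)] [∀ p, MeasurableEq (S p)]
  {F : ∀ p, Measure (S p)} [∀ p, IsProbabilityMeasure (F p)] {T : Fin k → Fin m → ℕ}
  {h : ∀ i, Inputs S (T i) → ℝ} {N : ℕ → Fin m → ℕ} {R₁ R₂ : ℕ → ℕ} {n : ℕ → ℝ} {c α : ℝ}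
  {β : Fin m → ℝ} {Ω : ℕ → Type*} [∀ ν, MeasurableSpace (Ω ν)] {P : ∀ ν, Measure (Ω ν)}
  [∀ ν, IsProbabilityMeasure (P ν)] {ρ : ∀ ν, Run S T (N ν) (R₁ ν) (R₂ ν) (Ω ν)}

/-- Continuity from below of the distribution function. -/
lemma exists_lt_chiSquared_Iio {q : ℕ} {b : ℝ} (hb : 0 < b) {y : ℝ≥0∞}
    (hy : y < chiSquared q (Set.Iio b)) : ∃ u, 0 < u ∧ u < b ∧ y < chiSquared q (Set.Iio u) := by
  obtain ⟨u, hu1, hu2, hu3⟩ := exists_seq_strictMono_tendsto' hb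
  have e : Set.Iio b = ⋃ j, Set.Iio (u j) := by
    ext x
    simp only [Set.mem_Iio, Set.mem_iUnion]
    exact ⟨fun hx => (hu3.eventually (lt_mem_nhds hx)).exists,
      fun ⟨j, hj⟩ => hj.trans (hu2 j).2⟩
  have hmono : Monotone fun j => Set.Iio (u j) := fun i j hij => Set.Iio_subset_Iio (hu1.monotone hij)
  rw [e, hmono.measure_iUnion, lt_iSup_iff] at hy
  obtain ⟨j, hj⟩ := hy
  exact ⟨u j, (hu2 j).1, (hu2 j).2, hj⟩

/-- With asymptotic probability at least `1 - α`, the estimated bounds for all comparisons with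
the best solution are valid. -/
theorem eventually_le_prob_bounds (hρ : ∀ ν, (ρ ν).IsNIOUC (P ν) F h α) (hk : 2 ≤ k)
    (hα : α ∈ Set.Ioo (0 : ℝ) 1) (hh2 : ∀ i, ReuseMemLp F fun z => h i z ^ 2)
    (h_meas : ∀ i, Measurable (h i)) (hT : ∀ i, Nonempty (Slot (T i)))
    (hF : ∀ p, NullSingletonClass (F p)) (ic : Fin k)
    (hv : ∀ ℓ, ℓ ≠ ic → 0 < ∑ p, (∫ ξ, projDiff F h ic ℓ p ξ ^ 2 ∂(F p)) / β p)
    (hN : ∀ ν p, 0 < N ν p) (hn : Tendsto n atTop atTop) (hβ : ∀ p, 0 < β p)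
    (hNβ : ∀ p, Tendsto (fun ν => (N ν p : ℝ) / n ν) atTop (𝓝 (β p)))
    (hR₁ : Tendsto (fun ν => (R₁ ν : ℝ) / n ν) atTop atTop)
    (hR₂ : Tendsto (fun ν => (R₂ ν : ℝ) / n ν) atTop atTop) {y : ℝ} (hy : y < 1 - α) :
    ∀ᶠ ν in atTop, y ≤ (P ν).real {ω | ∀ ℓ, ℓ ≠ ic →
      perf (h ic) F - perf (h ℓ) F ≤ (ρ ν).bound h ω ic ℓ} := by
  have hh : ∀ i, ReuseMemLp F (h i) := fun i => .of_sq (h_meas i) (hh2 i)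
  obtain ⟨c, hc, hcN⟩ := exists_eventually_mul_le hn hβ hNβ
  have hinj : ∀ ν, ∀ᵐ ω ∂(P ν), ∀ p, Function.Injective ((ρ ν).data ω p) := fun ν => by
    have h1 := ae_injective_inputLaw hF (N ν)
    rw [← (hρ ν).data_law] at h1
    exact ae_of_ae_map (hρ ν).measurable_data.aemeasurable h1
  set d := k - 1 with hd
  have hd0 : 0 < d := by omega
  have hcard : Fintype.card {ℓ : Fin k // ℓ ≠ ic} = d := by
    rw [Fintype.card_subtype_compl, Fintype.card_fin, Fintype.card_subtype_eq]
  let e : Fin d ≃ {ℓ : Fin k // ℓ ≠ ic} := (Fintype.equivFinOfCardEq hcard).symm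
  set q := chiSquaredQuantile d (1 - α) with hq
  have hq0 : 0 < q := chiSquaredQuantile_pos hd0 (by linarith [hα.2]) (by linarith [hα.1])
  let g : Fin d → ∀ p, S p → ℝ := fun i => projDiff F h ic (e i)
  let v : Fin d → ℝ := fun i => ∑ p, (∫ ξ, g i p ξ ^ 2 ∂(F p)) / β p
  have hv0 : ∀ i, 0 < v i := fun i => hv (e i) (e i).2
  have hsp2 : ∀ i p, MemLp (sourceProj F (h i) p) 2 (F p) := fun i p =>
    memLp_finsetSum _ fun t _ => memLp_slotProj (hh i).measurable (hh i).memLp_self ⟨p, t⟩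
  have hgm : ∀ i p, Measurable (g i p) := fun i p =>
    (measurable_sourceProj (h_meas ic) p).sub (measurable_sourceProj (h_meas (e i)) p)
  have hg2 : ∀ i p, MemLp (g i p) 2 (F p) := fun i p => (hsp2 ic p).sub (hsp2 (e i) p)
  have hg0 : ∀ i p, ∫ ξ, g i p ξ ∂(F p) = 0 := fun i p => by
    simp only [g, projDiff]
    rw [integral_sub ((hsp2 ic p).integrable one_le_two) ((hsp2 (e i) p).integrable one_le_two),
      integral_sourceProj (h_meas ic) (hh ic).memLp_self,
      integral_sourceProj (h_meas (e i)) (hh (e i)).memLp_self, sub_zero]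
  have hMv : ∀ i, asymCov F β g i i = v i := fun i => by
    simp only [asymCov, Matrix.of_apply, v, sq]
  obtain ⟨y', hyy', hy'⟩ := exists_between hy
  -- the slack between `u` and the quantile `q` absorbs the remainder terms
  obtain ⟨u, hu0, huq, hu⟩ := exists_lt_chiSquared_Iio hq0
    (((ENNReal.ofReal_lt_ofReal_iff (by linarith [hα.2])).2 hy').trans_le
      (le_chiSquared_Iio_quantile hd0 (by linarith [hα.1])))
  -- the expansion is applied with radius `r'`, the central limit theorem with the smaller `r`
  set r := √u with hr
  set r' := √((u + q) / 2) with hr'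
  have hr2 : r ^ 2 = u := Real.sq_sqrt hu0.le
  have hr'2 : r' ^ 2 = (u + q) / 2 := Real.sq_sqrt (by positivity)
  have hrr' : r < r' := Real.sqrt_lt_sqrt hu0.le (by linarith)
  set G : Set (EuclideanSpace ℝ (Fin d)) := {y | ∀ i, -(r * √(v i)) < y i} with hG
  have hGo : IsOpen G := by
    rw [hG, Set.ofPred_forall]
    exact isOpen_iInter_of_finite fun i => isOpen_lt continuous_const (by fun_prop)
  have hlim : ENNReal.ofReal y' <
      liminf (fun ν => inputLaw F (N ν) (scoreVec g √(n ν) ⁻¹' G)) atTop := by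
    refine hu.trans_le (le_trans ?_ (liminf_scoreVec_ge hgm hg2 hg0 hn hβ hNβ hGo))
    rw [← hr2]
    have h1 := chiSquared_le_multivariateGaussian (posSemidef_asymCov hβ hg2)
      (fun i => by rw [hMv]; exact hv0 i) (Real.sqrt_nonneg u)
    simpa only [hMv] using h1
  have hsmall : ∀ i, Tendsto (fun ν => P ν {ω | (r' - r) * √(v i) ≤
      |min 0 (√(n ν) * ((ρ ν).bound h ω ic (e i) - (perf (h ic) F - perf (h (e i)) F)) -
        √(n ν) * ∑ p, dataMean (g i p) ((ρ ν).data ω) - r' / √(v i) * v i)|}) atTop (𝓝 0) :=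
    fun i => by
      refine isSmallOP_min_bound hρ hh hh2 hT hinj hN hn hc hcN hβ hNβ hR₁ hR₂
        (e i).2.symm (a := r' / √(v i)) ?_ _
        (mul_pos (sub_pos.2 hrr') (Real.sqrt_pos.2 (hv0 i)))
      change _ * v i < q
      rw [div_pow, Real.sq_sqrt (hv0 i).le, hr'2, div_mul_cancel₀ _ (hv0 i).ne']
      linarith
  have hsum : Tendsto (fun ν => ∑ i, P ν {ω | (r' - r) * √(v i) ≤
      |min 0 (√(n ν) * ((ρ ν).bound h ω ic (e i) - (perf (h ic) F - perf (h (e i)) F)) -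
        √(n ν) * ∑ p, dataMean (g i p) ((ρ ν).data ω) - r' / √(v i) * v i)|}) atTop (𝓝 0) := by
    have h1 := tendsto_finsetSum (Finset.univ : Finset (Fin d)) fun i _ => hsmall i
    simpa using h1
  have hδ : (0 : ℝ≥0∞) < ENNReal.ofReal (y' - y) := by simpa using hyy'
  filter_upwards [eventually_lt_of_lt_liminf hlim, hsum.eventually (gt_mem_nhds hδ)] with ν h1 h2
  rw [← (hρ ν).data_law, Measure.map_apply (hρ ν).measurable_data
    (measurable_scoreVec hgm _ hGo.measurableSet)] at h1
  have h3 : P ν ((ρ ν).data ⁻¹' (scoreVec g √(n ν) ⁻¹' G)) ≤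
      P ν {ω | ∀ ℓ, ℓ ≠ ic → perf (h ic) F - perf (h ℓ) F ≤ (ρ ν).bound h ω ic ℓ} +
        ∑ i, P ν {ω | (r' - r) * √(v i) ≤
      |min 0 (√(n ν) * ((ρ ν).bound h ω ic (e i) - (perf (h ic) F - perf (h (e i)) F)) -
        √(n ν) * ∑ p, dataMean (g i p) ((ρ ν).data ω) - r' / √(v i) * v i)|} := by
    refine le_trans (measure_mono ?_) ((measure_union_le _ _).trans
      (add_le_add_right (measure_biUnion_finset_le Finset.univ _) _))
    intro ω hω
    by_contra hcon
    simp only [Set.mem_union, Set.mem_ofPred_eq, Set.mem_iUnion, Finset.mem_univ, exists_prop,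
      true_and, not_or, not_exists, not_le] at hcon
    -- the score exceeds `-r √v`, the gain from the tilt is `r' √v`, and the remainder is less than
    -- `(r' - r) √v`
    refine hcon.1 fun ℓ hℓ => ?_
    obtain ⟨i, hi⟩ := e.surjective ⟨ℓ, hℓ⟩
    have hiℓ : (e i : Fin k) = ℓ := by rw [hi]
    have h4 := hcon.2 i
    have h5 : -(r * √(v i)) < √(n ν) * ∑ p, dataMean (g i p) ((ρ ν).data ω) := hω i
    rw [abs_of_nonpos (min_le_left _ _)] at h4
    set Y := √(n ν) * ((ρ ν).bound h ω ic (e i) - (perf (h ic) F - perf (h (e i)) F)) with hY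
    have h6 := min_le_right 0 (Y - √(n ν) * ∑ p, dataMean (g i p) ((ρ ν).data ω) -
      r' / √(v i) * v i)
    have h7 : r' / √(v i) * v i = r' * √(v i) := by
      rw [div_mul_eq_mul_div, mul_div_assoc, Real.div_sqrt]
    have h8 : 0 < Y := by
      rw [h7] at h4 h6
      linarith
    rw [← hiℓ]
    exact le_of_not_gt fun hlt => h8.not_ge
      (mul_nonpos_of_nonneg_of_nonpos (Real.sqrt_nonneg _) (sub_nonpos.2 hlt.le))
  have h4 := h1.trans_le (h3.trans (add_le_add_right h2.le _))
  rw [← ofReal_measureReal, ← ENNReal.ofReal_add measureReal_nonneg (by linarith)] at h4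
  have h5 := (ENNReal.ofReal_lt_ofReal_iff'.1 h4).1
  linarith

end Coverage

end NIOUC

theorem mainTheorem1 {k m : ℕ} (hk : 2 ≤ k)
    -- input spaces, true input distributions (with densities), output functions
    {d : Fin m → ℕ} (Ξ : ∀ p, Set (EuclideanSpace ℝ (Fin (d p))))
    (F : ∀ p, Measure (Ξ p)) [∀ p, IsProbabilityMeasure (F p)]
    (hF : ∀ p, (F p).map Subtype.val ≪ volume)
    (T : Fin k → Fin m → ℕ) (hT : ∀ i p, 0 < T i p)
    (h : ∀ i, NIOUC.Inputs (fun p => Ξ p) (T i) → ℝ) (h_meas : ∀ i, Measurable (h i))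
    (h_sq : ∀ i, Integrable (fun z => |h i z| ^ 2) (NIOUC.inputLaw F (T i)))
    -- the unique optimal solution
    (ic : Fin k) (hic : ∀ i, i ≠ ic → NIOUC.perf (h i) F < NIOUC.perf (h ic) F)
    -- the covariance matrices of the influence functions are positive definite
    (h_cov : ∀ p, (NIOUC.influenceCov h F p).PosDef)
    -- fourth moments under the true input model, with inputs possibly reused
    (h_four : ∀ i, ∀ I : ∀ p, Fin (T i p) → Fin (T i p),
      Integrable (fun z => |h i (fun p t => z p (I p t))| ^ 4) (NIOUC.inputLaw F (T i)))
    (α : ℝ) (hα : α ∈ Set.Ioo (0 : ℝ) 1)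
    -- data sizes and simulation budgets, along an arbitrary sequence
    (N : ℕ → Fin m → ℕ) (hN : ∀ ν p, 0 < N ν p) (R₁ R₂ : ℕ → ℕ)
    (n : ℕ → ℝ) (hn : ∀ ν, n ν = (∑ p, (N ν p : ℝ)) / m) (hn_top : Tendsto n atTop atTop)
    (β : Fin m → ℝ) (hβ : ∀ p, 0 < β p)
    (hNβ : ∀ p, Tendsto (fun ν => (N ν p : ℝ) / n ν) atTop (𝓝 (β p)))
    (hR₁ : Tendsto (fun ν => (R₁ ν : ℝ) / n ν) atTop atTop)
    (hR₂ : Tendsto (fun ν => (R₂ ν : ℝ) / n ν) atTop atTop)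
    -- runs of the algorithm
    (Ω : ℕ → Type*) [∀ ν, MeasurableSpace (Ω ν)] (P : ∀ ν, Measure (Ω ν))
    [∀ ν, IsProbabilityMeasure (P ν)]
    (ρ : ∀ ν, NIOUC.Run (fun p => Ξ p) T (N ν) (R₁ ν) (R₂ ν) (Ω ν))
    (hρ : ∀ ν, (ρ ν).IsNIOUC (P ν) F h α)
    -- the fourth moments over the ambiguity set are bounded (in probability, uniformly in `ν`)
    (h_sup : ∀ i, ∀ ε : ℝ, 0 < ε → ∃ M : ℝ≥0, ∀ᶠ ν in atTop,
      (P ν).real {ω | (M : ℝ≥0∞) < (ρ ν).supFourthMoment h α i ω} ≤ ε) :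
    1 - α ≤ liminf (fun ν => (P ν).real {ω | ∀ i,
        NIOUC.perf (h i) F - (⨆ ℓ : {ℓ : Fin k // ℓ ≠ i}, NIOUC.perf (h ℓ) F) ∈
          Set.Icc (NIOUC.mcbLower ((ρ ν).bound h ω) i) (NIOUC.mcbUpper ((ρ ν).bound h ω) i)})
        atTop ∧
      1 - α ≤ liminf (fun ν => (P ν).real {ω |
        ic ∈ NIOUC.confidenceSet ((ρ ν).bound h ω)}) atTop := by
  -- for `m = 0` the average data size would be the junk value `0 / 0 = 0`, which contradicts
  -- `hn_top`
  have hm : 0 < m := by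
    rcases Nat.eq_zero_or_pos m with h0 | h0
    · subst h0
      obtain ⟨ν, hν⟩ := (hn_top.eventually_gt_atTop 0).exists
      simp [hn] at hν
    · exact h0
  have hSlot : ∀ i, Nonempty (NIOUC.Slot (T i)) := fun i => ⟨⟨⟨0, hm⟩, ⟨0, hT i _⟩⟩⟩
  have hh2 : ∀ i, NIOUC.ReuseMemLp F fun z => h i z ^ 2 := fun i =>
    NIOUC.reuseMemLp_sq_of_integrable (h_meas i) (h_four i)
  have hnull : ∀ p, NullSingletonClass (F p) := NIOUC.nullSingletonClass_of_posDef hk hF h_cov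
  have hv : ∀ ℓ, ℓ ≠ ic → 0 < ∑ p, (∫ ξ, NIOUC.projDiff F h ic ℓ p ξ ^ 2 ∂(F p)) / β p :=
    fun ℓ hℓ => Finset.sum_pos (fun p _ => div_pos (NIOUC.integral_sq_projDiff_pos
      (fun i => .of_sq (h_meas i) (hh2 i)) (h_cov p) hℓ.symm) (hβ p)) ⟨⟨0, hm⟩, Finset.mem_univ _⟩
  have key : ∀ y < 1 - α, ∀ᶠ ν in atTop, y ≤ (P ν).real {ω | ∀ ℓ, ℓ ≠ ic →
      NIOUC.perf (h ic) F - NIOUC.perf (h ℓ) F ≤ (ρ ν).bound h ω ic ℓ} := fun y hy =>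
    NIOUC.eventually_le_prob_bounds hρ hk hα hh2 h_meas hSlot hnull ic hv hN hn_top hβ hNβ hR₁ hR₂
      hy
  have hlim : ∀ A : ∀ ν, Set (Ω ν), (∀ ν, {ω | ∀ ℓ, ℓ ≠ ic →
      NIOUC.perf (h ic) F - NIOUC.perf (h ℓ) F ≤ (ρ ν).bound h ω ic ℓ} ⊆ A ν) →
      1 - α ≤ liminf (fun ν => (P ν).real (A ν)) atTop := by
    refine fun A hA => le_of_forall_lt_imp_le_of_dense fun y hy => ?_
    refine le_liminf_of_le ?_ ?_
    · exact (isBoundedUnder_of ⟨1, fun ν => measureReal_le_one⟩).isCoboundedUnder_ge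
    · filter_upwards [key y hy] with ν hν
      exact hν.trans (measureReal_mono (hA ν))
  exact ⟨hlim _ fun ν ω hω => NIOUC.mem_mcbInterval_of_bounds hk hic hω,
    hlim _ fun ν ω hω => NIOUC.mem_confidenceSet_of_bounds hk hic hω⟩
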